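/- Work in $L^2[0,\infty[$. Let $X$ be multiplication by $x$, let $(If)(x)=x^{-1/4}f(2\sqrt x)$ (a unitary operator), and let $\mathcal F_m$ ($|\mathrm{Re}\,m|<1$) be the Hankel transformation, i.e. the bounded operator with $(\mathcal F_mf)(k)=\int_0^\infty J_m(kx)\sqrt{kx}\,f(x)\,dx$ for $f\in L^2[0,\infty[$ of bounded support. *Rank one perturbations.* Below, $\langle x^{m/2}|$ is the bilinear functional $g\mapsto\int_0^\infty x^{m/2}g(x)\,dx$ (without complex conjugation), and $(-z)^m$ and $\ln(-z)$ are the principal branches. For $|\mathrm{Re}\,m|<1$, $m\neq0$ and $\lambda\in\mathbb C\cup\{\infty\}$, let $H_{m,\lambda}$ (formally $X+\lambda|x^{m/2}\rangle\langle x^{m/2}|$) be the closed operator with $$(z-H_{m,\lambda})^{-1}=(z-X)^{-1}+\Big(\lambda^{-1}-(-z)^m\frac{\pi}{\sin \pi m}\Big)^{-1}(z-X)^{-1}|x^{m/2}\rangle\langle x^{m/2}|(z-X)^{-1}$$ for all $z\in\mathbb C\setminus[0,\infty[$ with $\lambda^{-1}\ne(-z)^m\pi/\sin\pi m$ (so $H_{m,0}=X$).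 For $\rho\in\mathbb C\cup\{\infty\}$, let $H_0^\rho$ be the closed operator with $$(z-H_0^\rho)^{-1}=(z-X)^{-1}-(\rho+\ln(-z))^{-1}(z-X)^{-1}|x^0\rangle\langle x^0|(z-X)^{-1}$$ for all $z\in\mathbb C\setminus[0,\infty[$ with $\rho+\ln(-z)\neq0$ (so $H_0^\infty=X$). *Almost homogeneous Schrödinger operators.* Let $L_\alpha=-\partial_x^2+(\alpha-\frac14)x^{-2}$, let $L_\alpha^{\min}$ be the closure of $L_\alpha$ on $C_c^\infty]0,\infty[$, and let $L_\alpha^{\max}$ be $L_\alpha$ on $\{f\in L^2: L_\alpha f\in L^2\}$. For $|\mathrm{Re}\,m|<1$, $m\neq 0$ and $\kappa\in\mathbb C\cup\{\infty\}$, let $\tilde H_{m,\kappa}$ be the restriction of $L_{m^2}^{\max}$ to those $f$ for which, for some $c\in\mathbb C$, $f-c(x^{1/2-m}+\kappa x^{1/2+m})$ coincides near $0$ with an element of $\mathrm{Dom}(L_{m^2}^{\min})$; for $\kappa=\infty$ use $x^{1/2+m}$. For $\nu\in\mathbb C\cup\{\infty\}$, let $\tilde H_0^\nu$ be the restriction of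 $L_0^{\max}$ to those $f$ for which, for some $c\in\mathbb C$, $f-c(x^{1/2}\ln x+\nu x^{1/2})$ coincides near $0$ with an element of $\mathrm{Dom}(L_0^{\min})$; for $\nu=\infty$ use $x^{1/2}$. **Theorem.** The operators $H_{m,\lambda}$, $H_0^\rho$ above exist, $\mathcal F_m$ exists and is boundedly invertible, and the following holds, including the equality of domains. 1. Let $|\mathrm{Re}\,m|<1$, $m\ne0$. If $\lambda,\kappa\in\mathbb C\cup\{\infty\}$ satisfy $$\lambda\,\frac{\pi}{\sin(\pi m)}\cdot\kappa\,\frac{\Gamma(m)}{\Gamma(-m)}=1$$ (where $\lambda=0$ corresponds to $\kappa=\infty$ and $\lambda=\infty$ to $\kappa=0$), then $$\mathcal F_m^{-1}I^{-1}H_{m,\lambda}I\mathcal F_m=\tfrac14\tilde H_{m,\kappa}.$$ 2. If $\rho,\nu\in\mathbb C\cup\{\infty\}$ satisfy $\rho=2\gamma-2\nu$, where $\gamma$ is the Euler–Mascheroni constant (and $\rho=\infty$ corresponds to $\nu=\infty$), then $$\mathcal F_0^{-1}I^{-1}H_0^{\rho}I\mathcal F_0=\tfrac14\tilde H_0^{\nu}.$$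 -/

import Mathlib

open MeasureTheory Set
open scoped ENNReal

noncomputable section

namespace RankOneBessel

/-! ### The Hilbert space `L²[0,∞[` -/

/-- Lebesgue measure on the half-line. -/
abbrev hμ : Measure ℝ := volume.restrict (Ioi (0 : ℝ))

/-- The Hilbert space `L²[0,∞[`. -/
abbrev L2 : Type := Lp ℂ 2 hμ

/-! ### Operators given by a family of resolvents -/

/-- `H` has `Ω` in its resolvent set, and `(z - H)⁻¹ = R z` for all `z ∈ Ω`. -/
def HasResolvents (Ω : Set ℂ) (R : Ω → L2 →L[ℂ] L2) (H : L2 →ₗ.[ℂ] L2) : Prop :=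
  ∀ z : Ω, (∀ f : H.domain, R z ((z : ℂ) • (f : L2) - H f) = f) ∧
    ∀ g : L2, ∃ h : R z g ∈ H.domain, (z : ℂ) • R z g - H ⟨R z g, h⟩ = g

/-- The operator whose resolvents are `R z`, `z ∈ Ω`: its graph is `{(R z g, z R z g - g)}`, which
for a pseudoresolvent is the same set for all `z`. -/
def ofResolvents (Ω : Set ℂ) (R : Ω → L2 →L[ℂ] L2) : L2 →ₗ.[ℂ] L2 :=
  (⨅ z : Ω, LinearMap.range
    ((R z).prod ((z : ℂ) • R z - ContinuousLinearMap.id ℂ L2)).toLinearMap).toLinearPMap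

/-- Whenever an operator with the prescribed resolvents exists, `ofResolvents` is this operator. -/
theorem HasResolvents.ofResolvents_eq {Ω : Set ℂ} {R : Ω → L2 →L[ℂ] L2} {H : L2 →ₗ.[ℂ] L2}
    (h : HasResolvents Ω R H) (hΩ : Ω.Nonempty) : ofResolvents Ω R = H := by
  have key : (⨅ z : Ω, LinearMap.range
      ((R z).prod ((z : ℂ) • R z - ContinuousLinearMap.id ℂ L2)).toLinearMap) = H.graph := by
    have hz : ∀ z : Ω, LinearMap.range
        ((R z).prod ((z : ℂ) • R z - ContinuousLinearMap.id ℂ L2)).toLinearMap = H.graph := by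
      intro z
      ext ⟨a, b⟩
      rw [LinearMap.mem_range, LinearPMap.mem_graph_iff]
      constructor
      · rintro ⟨g, hg⟩
        obtain ⟨hd, he⟩ := (h z).2 g
        have h1 : R z g = a := congrArg Prod.fst hg
        have h2 : (z : ℂ) • R z g - g = b := congrArg Prod.snd hg
        refine ⟨⟨R z g, hd⟩, h1, ?_⟩
        change H ⟨R z g, hd⟩ = b
        rw [← h2, eq_sub_iff_add_eq, add_comm]
        exact (sub_eq_iff_eq_add.mp he).symm
      · rintro ⟨f, hf, hb⟩
        refine ⟨(z : ℂ) • (f : L2) - H f, ?_⟩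
        have h1 := (h z).1 f
        simp only at hf hb
        subst hf
        subst hb
        refine Prod.ext h1 ?_
        change (z : ℂ) • R z ((z : ℂ) • (f : L2) - H f) - ((z : ℂ) • (f : L2) - H f) = H f
        rw [h1]
        abel
    have : Nonempty Ω := hΩ.to_subtype
    rw [iInf_congr hz, ciInf_const]
  unfold ofResolvents
  rw [key]
  exact LinearPMap.eq_of_eq_graph (Submodule.toLinearPMap_graph_eq _
    fun x hx hx' => LinearPMap.graph_fst_eq_zero_snd H hx hx')

/-! ### The operators `H_{m,λ}` and `H_0^ρ` -/

/-- For `z ∉ [0,∞[` there is `C > 0` with `1 + x ≤ C |z - x|` for all `x ≥ 0`. -/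
theorem exists_one_add_le {z : ℂ} (hz : -z ∈ Complex.slitPlane) :
    ∃ C : ℝ, 0 < C ∧ ∀ x : ℝ, 0 < x → 1 + x ≤ C * ‖z - x‖ := by
  obtain ⟨d, hd, hdx⟩ : ∃ d : ℝ, 0 < d ∧ ∀ x : ℝ, 0 < x → d ≤ ‖z - x‖ := by
    rcases hz with h | h
    · refine ⟨-z.re, by simpa using h, fun x hx => ?_⟩
      have := Complex.abs_re_le_norm (z - x)
      have h2 := neg_abs_le (z - x).re
      simp at this h2
      linarith
    · refine ⟨|z.im|, by simpa using h, fun x hx => ?_⟩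
      simpa using Complex.abs_im_le_norm (z - x)
  refine ⟨(1 + ‖z‖) / d + 1, by positivity, fun x hx => ?_⟩
  have h1 : x ≤ ‖z‖ + ‖z - x‖ := by
    have := norm_sub_le z (z - x)
    simp only [sub_sub_cancel, Complex.norm_real, Real.norm_eq_abs, abs_of_pos hx] at this
    exact this
  have h2 : (1 + ‖z‖) ≤ (1 + ‖z‖) / d * ‖z - x‖ := by
    rw [div_mul_eq_mul_div, le_div_iff₀ hd]
    exact mul_le_mul_of_nonneg_left (hdx x hx) (by positivity)
  nlinarith

theorem memLp_top_resolvent {z : ℂ} (hz : -z ∈ Complex.slitPlane) :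
    MemLp (fun x : ℝ => (z - x)⁻¹) ⊤ hμ := by
  obtain ⟨C, hC, h⟩ := exists_one_add_le hz
  refine memLp_top_of_bound (by fun_prop) C ?_
  filter_upwards [ae_restrict_mem measurableSet_Ioi] with x hx
  have h1 := h x hx
  have hx' : (0 : ℝ) < x := hx
  have h0 : 0 < ‖z - x‖ := by
    by_contra h'
    have : ‖z - x‖ = 0 := le_antisymm (not_lt.mp h') (norm_nonneg _)
    rw [this] at h1
    linarith
  rw [norm_inv, inv_le_iff_one_le_mul₀ h0]
  linarith

theorem memLp_two_profile {m z : ℂ} (hm : |m.re| < 1) (hz : -z ∈ Complex.slitPlane) :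
    MemLp (fun x : ℝ => (x : ℂ) ^ (m / 2) / (z - x)) 2 hμ := by
  obtain ⟨C, hC, h⟩ := exists_one_add_le hz
  obtain ⟨hm1, hm2⟩ := abs_lt.mp hm
  have hmeas : AEStronglyMeasurable (fun x : ℝ => (x : ℂ) ^ (m / 2) / (z - x)) hμ := by
    refine Measurable.aestronglyMeasurable ?_
    exact (Complex.measurable_ofReal.pow_const _).div (by fun_prop)
  rw [memLp_two_iff_integrable_sq_norm hmeas]
  have hb : Integrable (fun x : ℝ => if x ≤ 1 then C ^ 2 * x ^ m.re else C ^ 2 * x ^ (m.re - 2))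
      hμ := by
    have hsplit : Ioi (0 : ℝ) = Ioc 0 1 ∪ Ioi 1 := by
      rw [Ioc_union_Ioi_eq_Ioi zero_le_one]
    change IntegrableOn _ (Ioi (0 : ℝ))
    rw [hsplit, integrableOn_union]
    constructor
    · have : IntegrableOn (fun x : ℝ => C ^ 2 * x ^ m.re) (Ioc 0 1) := by
        have := (intervalIntegral.intervalIntegrable_rpow' (a := 0) (b := 1) hm1)
        rw [intervalIntegrable_iff_integrableOn_Ioc_of_le zero_le_one] at this
        exact this.const_mul _
      refine this.congr_fun (fun x hx => ?_) measurableSet_Ioc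
      simp [hx.2]
    · have : IntegrableOn (fun x : ℝ => C ^ 2 * x ^ (m.re - 2)) (Ioi 1) :=
        (integrableOn_Ioi_rpow_of_lt (by linarith) zero_lt_one).const_mul _
      refine this.congr_fun (fun x hx => ?_) measurableSet_Ioi
      have : ¬ x ≤ 1 := not_le.mpr hx
      simp [this]
  refine hb.mono' (hmeas.norm.pow 2) ?_
  filter_upwards [ae_restrict_mem measurableSet_Ioi] with x hx
  have hx' : (0 : ℝ) < x := hx
  have h1 := h x hx'
  have h0 : 0 < ‖z - x‖ := by
    by_contra h'
    have : ‖z - x‖ = 0 := le_antisymm (not_lt.mp h') (norm_nonneg _)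
    rw [this] at h1
    linarith
  have hnum : ‖(x : ℂ) ^ (m / 2)‖ ^ 2 = x ^ m.re := by
    rw [Complex.norm_cpow_eq_rpow_re_of_pos hx', ← Real.rpow_natCast, ← Real.rpow_mul hx'.le]
    congr 1
    simp
  rw [norm_pow, norm_norm, norm_div, div_pow, hnum, div_le_iff₀ (by positivity)]
  have hxm : 0 < x ^ m.re := Real.rpow_pos_of_pos hx' _
  split_ifs with hx1
  · have : 1 ≤ C * ‖z - x‖ := by linarith
    have : 1 ≤ (C * ‖z - x‖) ^ 2 := one_le_pow₀ this
    nlinarith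
  · have h3 : x ^ (m.re - 2) * x ^ 2 = x ^ m.re := by
      rw [← Real.rpow_natCast x 2, ← Real.rpow_add hx']
      congr 1
      simp
    have : x ≤ C * ‖z - x‖ := by linarith
    have : x ^ 2 ≤ (C * ‖z - x‖) ^ 2 := pow_le_pow_left₀ hx'.le this 2
    have hp : 0 < x ^ (m.re - 2) := Real.rpow_pos_of_pos hx' _
    calc x ^ m.re = x ^ (m.re - 2) * x ^ 2 := h3.symm
      _ ≤ x ^ (m.re - 2) * (C * ‖z - x‖) ^ 2 := mul_le_mul_of_nonneg_left this hp.le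
      _ = _ := by ring

/-- The operator `(z - X)⁻¹` of multiplication by `(z - x)⁻¹`. -/
def resolventX (z : ℂ) (hz : -z ∈ Complex.slitPlane) : L2 →L[ℂ] L2 :=
  (ContinuousLinearMap.mul ℂ ℂ).holderL hμ ⊤ 2 2 ((memLp_top_resolvent hz).toLp _)

/-- The vector `(z - X)⁻¹ |x^{m/2}⟩`. -/
def profile (m z : ℂ) (hm : |m.re| < 1) (hz : -z ∈ Complex.slitPlane) : L2 :=
  (memLp_two_profile hm hz).toLp _

/-- The bilinear pairing with a vector `e`, that is, `g ↦ ∫₀^∞ e(x) g(x) dx`. -/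
def pairing (e : L2) : L2 →L[ℂ] ℂ :=
  (ContinuousLinearMap.mul ℂ ℂ).lpPairing hμ 2 2 e

/-- `(z - X)⁻¹ + c (z - X)⁻¹ |x^{m/2}⟩⟨x^{m/2}| (z - X)⁻¹`, where `⟨x^{m/2}|` is the bilinear
functional `g ↦ ∫₀^∞ x^{m/2} g(x) dx` (no complex conjugation). -/
def rankOneResolvent (m z : ℂ) (hm : |m.re| < 1) (hz : -z ∈ Complex.slitPlane) (c : ℂ) :
    L2 →L[ℂ] L2 :=
  resolventX z hz + c • (pairing (profile m z hm hz)).smulRight (profile m z hm hz)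

/-- `⟨x^{m/2}|(z - X)⁻¹|x^{m/2}⟩ = (-z)^m π / sin (π m)` (for `m ≠ 0`, and by continuation
for `0 ≤ Re m < 1`). -/
def freeG (m z : ℂ) : ℂ := (-z) ^ m * (Real.pi / Complex.sin (Real.pi * m))

/-- The points `z ∉ [0,∞[` at which the formula for the resolvent of `H_{m,λ}` is defined. -/
def regularSet (m : ℂ) : OnePoint ℂ → Set ℂ
  | OnePoint.infty => {z | -z ∈ Complex.slitPlane}
  | (lam : ℂ) => {z | -z ∈ Complex.slitPlane ∧ 1 - lam * freeG m z ≠ 0}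

/-- `(λ⁻¹ - ⟨x^{m/2}|(z - X)⁻¹|x^{m/2}⟩)⁻¹`, written so that it is also right for `λ = 0`. -/
def resolventCoeff (m : ℂ) : OnePoint ℂ → ℂ → ℂ
  | OnePoint.infty, z => (-freeG m z)⁻¹
  | (lam : ℂ), z => lam / (1 - lam * freeG m z)

theorem neg_mem_of_mem_regularSet {m : ℂ} {lam : OnePoint ℂ} {z : ℂ} (h : z ∈ regularSet m lam) :
    -z ∈ Complex.slitPlane := by
  cases lam with
  | infty => exact h
  | coe a => exact h.1

/-- The resolvents of `H_{m,λ}`. -/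
def pertResolvent (m : ℂ) (hm : |m.re| < 1) (lam : OnePoint ℂ) (z : regularSet m lam) :
    L2 →L[ℂ] L2 :=
  rankOneResolvent m z hm (neg_mem_of_mem_regularSet z.2) (resolventCoeff m lam z)

/-- The operator `H_{m,λ}`, formally `X + λ |x^{m/2}⟩⟨x^{m/2}|`
(for `|Re m| < 1`, `m ≠ 0`, `λ ∈ ℂ ∪ {∞}`). -/
def Hpert (m : ℂ) (hm : |m.re| < 1) (lam : OnePoint ℂ) : L2 →ₗ.[ℂ] L2 :=
  ofResolvents (regularSet m lam) (pertResolvent m hm lam)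

/-- The points `z ∉ [0,∞[` at which the formula for the resolvent of `H_0^ρ` is defined. -/
def regularSetLog : OnePoint ℂ → Set ℂ
  | OnePoint.infty => {z | -z ∈ Complex.slitPlane}
  | (rho : ℂ) => {z | -z ∈ Complex.slitPlane ∧ rho + Complex.log (-z) ≠ 0}

/-- `-(ρ + ln (-z))⁻¹`, which is `0` for `ρ = ∞`. -/
def resolventCoeffLog : OnePoint ℂ → ℂ → ℂ
  | OnePoint.infty, _ => 0
  | (rho : ℂ), z => -(rho + Complex.log (-z))⁻¹

theorem neg_mem_of_mem_regularSetLog {rho : OnePoint ℂ} {z : ℂ} (h : z ∈ regularSetLog rho) :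
    -z ∈ Complex.slitPlane := by
  cases rho with
  | infty => exact h
  | coe a => exact h.1

/-- The resolvents of `H_0^ρ`. -/
def pertResolventLog (rho : OnePoint ℂ) (z : regularSetLog rho) : L2 →L[ℂ] L2 :=
  rankOneResolvent 0 z (by simp) (neg_mem_of_mem_regularSetLog z.2) (resolventCoeffLog rho z)

/-- The operator `H_0^ρ`, `ρ ∈ ℂ ∪ {∞}`. -/
def HpertLog (rho : OnePoint ℂ) : L2 →ₗ.[ℂ] L2 :=
  ofResolvents (regularSetLog rho) (pertResolventLog rho)

/-! ### Schrödinger operators with inverse square potentials -/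

/-- Test functions on `]0,∞[`, i.e. elements of `C_c^∞]0,∞[`. -/
structure IsTest (φ : ℝ → ℂ) : Prop where
  smooth : ContDiff ℝ (⊤ : ℕ∞) φ
  compact : HasCompactSupport φ
  support : tsupport φ ⊆ Ioi 0

/-- The differential expression `L_α φ = -φ'' + (α - 1/4) x⁻² φ`. -/
def Lexpr (α : ℂ) (φ : ℝ → ℂ) (x : ℝ) : ℂ :=
  -iteratedDeriv 2 φ x + (α - 1 / 4) / (x : ℂ) ^ 2 * φ x

theorem two_le_smooth : (2 : WithTop ℕ∞) ≤ ((⊤ : ℕ∞) : WithTop ℕ∞) :=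
  WithTop.coe_le_coe.mpr (le_top : (2 : ℕ∞) ≤ ⊤)

theorem isTest_zero : IsTest (0 : ℝ → ℂ) :=
  ⟨contDiff_const, HasCompactSupport.zero, by simp⟩

theorem IsTest.add {φ ψ : ℝ → ℂ} (hφ : IsTest φ) (hψ : IsTest ψ) : IsTest (φ + ψ) :=
  ⟨hφ.smooth.add hψ.smooth, hφ.compact.add hψ.compact,
    (tsupport_add φ ψ).trans (union_subset hφ.support hψ.support)⟩

theorem IsTest.smul {φ : ℝ → ℂ} (c : ℂ) (hφ : IsTest φ) : IsTest (c • φ) := by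
  have hs : tsupport (c • φ) ⊆ tsupport φ :=
    closure_mono (Function.support_const_smul_subset c φ)
  exact ⟨contDiff_const.smul hφ.smooth,
    hφ.compact.of_isClosed_subset (isClosed_tsupport _) hs, hs.trans hφ.support⟩

theorem Lexpr_add (α : ℂ) {φ ψ : ℝ → ℂ} (hφ : IsTest φ) (hψ : IsTest ψ) :
    Lexpr α (φ + ψ) = Lexpr α φ + Lexpr α ψ := by
  funext x
  have h : iteratedDeriv 2 (φ + ψ) x = iteratedDeriv 2 φ x + iteratedDeriv 2 ψ x :=
    iteratedDeriv_add (hφ.smooth.contDiffAt.of_le two_le_smooth)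
      (hψ.smooth.contDiffAt.of_le two_le_smooth)
  simp only [Lexpr, h, Pi.add_apply]
  ring

theorem Lexpr_smul (α c : ℂ) {φ : ℝ → ℂ} (hφ : IsTest φ) :
    Lexpr α (c • φ) = c • Lexpr α φ := by
  funext x
  have h : iteratedDeriv 2 (c • φ) x = c • iteratedDeriv 2 φ x :=
    iteratedDeriv_const_smul (hφ.smooth.contDiffAt.of_le two_le_smooth) c
  simp only [Lexpr, h, Pi.smul_apply, smul_eq_mul]
  ring

/-- The graph of `L_α` on `C_c^∞]0,∞[`. -/
def graphTest (α : ℂ) : Submodule ℂ (L2 × L2) where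
  carrier := {p | ∃ φ : ℝ → ℂ, IsTest φ ∧ p.1 =ᵐ[hμ] φ ∧ p.2 =ᵐ[hμ] Lexpr α φ}
  zero_mem' := ⟨0, isTest_zero, Lp.coeFn_zero _ _ _, by
    have : Lexpr α 0 = 0 := by
      have := Lexpr_smul α 0 isTest_zero
      simpa using this
    rw [this]
    exact Lp.coeFn_zero _ _ _⟩
  add_mem' := by
    rintro p q ⟨φ, hφ, hp1, hp2⟩ ⟨ψ, hψ, hq1, hq2⟩
    refine ⟨φ + ψ, hφ.add hψ, (Lp.coeFn_add _ _).trans (hp1.add hq1), ?_⟩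
    rw [Lexpr_add α hφ hψ]
    exact (Lp.coeFn_add _ _).trans (hp2.add hq2)
  smul_mem' := by
    rintro c p ⟨φ, hφ, hp1, hp2⟩
    refine ⟨c • φ, hφ.smul c, (Lp.coeFn_smul _ _).trans (hp1.const_smul c), ?_⟩
    rw [Lexpr_smul α c hφ]
    exact (Lp.coeFn_smul _ _).trans (hp2.const_smul c)

/-- The minimal operator `L_α^min`: the closure of `L_α` on `C_c^∞]0,∞[`. -/
def Lmin (α : ℂ) : L2 →ₗ.[ℂ] L2 := (graphTest α).topologicalClosure.toLinearPMap

theorem IsTest.memLp {φ : ℝ → ℂ} (hφ : IsTest φ) : MemLp φ 2 hμ :=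
  hφ.smooth.continuous.memLp_of_hasCompactSupport hφ.compact

theorem IsTest.memLp_Lexpr (α : ℂ) {φ : ℝ → ℂ} (hφ : IsTest φ) : MemLp (Lexpr α φ) 2 hμ := by
  have hc : Continuous (iteratedDeriv 2 φ) :=
    hφ.smooth.continuous_iteratedDeriv 2 two_le_smooth
  have hs : HasCompactSupport (iteratedDeriv 2 φ) := by
    rw [iteratedDeriv_succ, iteratedDeriv_one]
    exact hφ.compact.deriv.deriv
  have h2 : Continuous fun x : ℝ => (α - 1 / 4) / (x : ℂ) ^ 2 * φ x := by
    rw [continuous_iff_continuousAt]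
    intro x
    by_cases hx : x = 0
    · have h0 : φ =ᶠ[nhds x] 0 := by
        rw [← notMem_tsupport_iff_eventuallyEq]
        intro hx'
        have := hφ.support hx'
        simp [hx] at this
      have : (fun x : ℝ => (α - 1 / 4) / (x : ℂ) ^ 2 * φ x) =ᶠ[nhds x] fun _ => 0 := by
        filter_upwards [h0] with y hy
        simp [hy]
      exact continuousAt_const.congr this.symm
    · have hx' : (x : ℂ) ^ 2 ≠ 0 := by simpa using hx
      exact (continuousAt_const.div (Complex.continuous_ofReal.pow 2).continuousAt hx').mul hφ.smooth.continuous.continuousAt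
  exact (hc.neg.memLp_of_hasCompactSupport hs.neg).add
    (h2.memLp_of_hasCompactSupport hφ.compact.mul_left)

/-- The graph of the maximal operator: pairs `(f, g)` in `L²` with `L_α f = g` in the sense of
distributions on `]0,∞[`. -/
def graphMax (α : ℂ) : Submodule ℂ (L2 × L2) where
  carrier := {p | ∀ φ : ℝ → ℂ, IsTest φ →
    ∫ x in Ioi (0 : ℝ), p.1 x * Lexpr α φ x = ∫ x in Ioi (0 : ℝ), p.2 x * φ x}
  zero_mem' := by
    intro φ _
    have h : ∀ ψ : ℝ → ℂ, ∫ x in Ioi (0 : ℝ), (0 : L2) x * ψ x = 0 := by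
      intro ψ
      refine integral_eq_zero_of_ae ?_
      filter_upwards [Lp.coeFn_zero ℂ 2 hμ] with x hx
      rw [hx]
      simp
    exact (h _).trans (h _).symm
  add_mem' := by
    intro p q hp hq φ hφ
    have h : ∀ (f g : L2) (ψ : ℝ → ℂ), MemLp ψ 2 hμ → ∫ x in Ioi (0 : ℝ), (f + g) x * ψ x =
        (∫ x in Ioi (0 : ℝ), f x * ψ x) + ∫ x in Ioi (0 : ℝ), g x * ψ x := by
      intro f g ψ hψ
      have hi := integral_add ((Lp.memLp f).integrable_mul hψ) ((Lp.memLp g).integrable_mul hψ)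
      refine Eq.trans (integral_congr_ae ?_) hi
      filter_upwards [Lp.coeFn_add f g] with x hx
      simp only [Pi.mul_apply]
      rw [hx, Pi.add_apply, add_mul]
    rw [Prod.fst_add, Prod.snd_add, h _ _ _ (hφ.memLp_Lexpr α), h _ _ _ hφ.memLp, hp φ hφ, hq φ hφ]
  smul_mem' := by
    intro c p hp φ hφ
    have h : ∀ (f : L2) (ψ : ℝ → ℂ), ∫ x in Ioi (0 : ℝ), (c • f) x * ψ x =
        c * ∫ x in Ioi (0 : ℝ), f x * ψ x := by
      intro f ψ
      rw [← integral_const_mul]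
      refine integral_congr_ae ?_
      filter_upwards [Lp.coeFn_smul c f] with x hx
      rw [hx, Pi.smul_apply, smul_eq_mul, mul_assoc]
    rw [Prod.smul_fst, Prod.smul_snd, h, h, hp φ hφ]

/-- The maximal operator `L_α^max`: its domain consists of all `f ∈ L²` with `L_α f ∈ L²`. -/
def Lmax (α : ℂ) : L2 →ₗ.[ℂ] L2 := (graphMax α).toLinearPMap

/-- The `f ∈ L²` such that, for some `c ∈ ℂ`, `f - c u` belongs to `Dom (L_α^min)` around `0`, i.e.
coincides near `0` with an element of `Dom (L_α^min)`. -/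
def boundaryCondition (α : ℂ) (u : ℝ → ℂ) : Submodule ℂ L2 where
  carrier := {f | ∃ c : ℂ, ∃ h ∈ (Lmin α).domain, ∃ ε : ℝ, 0 < ε ∧
    ∀ᵐ x ∂hμ, x < ε → f x - c * u x = h x}
  zero_mem' := ⟨0, 0, zero_mem _, 1, one_pos, by
    filter_upwards [Lp.coeFn_zero ℂ 2 hμ] with x hx
    simp⟩
  add_mem' := by
    rintro f g ⟨c, h, hh, ε, hε, hf⟩ ⟨d, k, hk, δ, hδ, hg⟩
    refine ⟨c + d, h + k, add_mem hh hk, min ε δ, lt_min hε hδ, ?_⟩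
    filter_upwards [hf, hg, Lp.coeFn_add f g, Lp.coeFn_add h k] with x h1 h2 h3 h4 hx
    rw [h3, h4, Pi.add_apply, Pi.add_apply, ← h1 (lt_of_lt_of_le hx (min_le_left _ _)),
      ← h2 (lt_of_lt_of_le hx (min_le_right _ _))]
    ring
  smul_mem' := by
    rintro a f ⟨c, h, hh, ε, hε, hf⟩
    refine ⟨a * c, a • h, Submodule.smul_mem _ a hh, ε, hε, ?_⟩
    filter_upwards [hf, Lp.coeFn_smul a f, Lp.coeFn_smul a h] with x h1 h3 h4 hx
    rw [h3, h4, Pi.smul_apply, Pi.smul_apply, ← h1 hx, smul_eq_mul, smul_eq_mul]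
    ring

/-- The function defining the boundary condition of `H̃_{m,κ}`: `x^{1/2-m} + κ x^{1/2+m}`
for `κ ∈ ℂ`, and `x^{1/2+m}` for `κ = ∞`. -/
def bdryFun (m : ℂ) : OnePoint ℂ → ℝ → ℂ
  | OnePoint.infty, x => (x : ℂ) ^ (1 / 2 + m)
  | (kap : ℂ), x => (x : ℂ) ^ (1 / 2 - m) + kap * (x : ℂ) ^ (1 / 2 + m)

/-- The function defining the boundary condition of `H̃_0^ν`: `x^{1/2} ln x + ν x^{1/2}`
for `ν ∈ ℂ`, and `x^{1/2}` for `ν = ∞`. -/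
def bdryFunLog : OnePoint ℂ → ℝ → ℂ
  | OnePoint.infty, x => (x : ℂ) ^ (1 / 2 : ℂ)
  | (nu : ℂ), x => (x : ℂ) ^ (1 / 2 : ℂ) * Real.log x + nu * (x : ℂ) ^ (1 / 2 : ℂ)

/-- The almost homogeneous Schrödinger operator `H̃_{m,κ}`, a restriction of `L_{m²}^max`. -/
def Hschr (m : ℂ) (kap : OnePoint ℂ) : L2 →ₗ.[ℂ] L2 :=
  (Lmax (m ^ 2)).domRestrict (boundaryCondition (m ^ 2) (bdryFun m kap))

/-- The almost homogeneous Schrödinger operator `H̃_0^ν`, a restriction of `L_0^max`. -/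
def HschrLog (nu : OnePoint ℂ) : L2 →ₗ.[ℂ] L2 :=
  (Lmax 0).domRestrict (boundaryCondition 0 (bdryFunLog nu))

/-! ### The Hankel transformation -/

/-- The Bessel function `J_m(x)`, `x > 0`, `m ∈ ℂ`, given by its power series. -/
def besselJ (m : ℂ) (x : ℝ) : ℂ :=
  ((x / 2 : ℝ) : ℂ) ^ m *
    ∑' n : ℕ, (-1) ^ n / ((n.factorial : ℂ) * Complex.Gamma (m + n + 1)) *
      ((x / 2 : ℝ) : ℂ) ^ (2 * n)

/-- `F` is the Hankel transformation `𝓕_m`: the bounded operator on `L²[0,∞[` with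
`(𝓕_m f)(k) = ∫₀^∞ J_m(kx) √(kx) f(x) dx` for all `f ∈ L²[0,∞[` of bounded support, for which
the integral converges absolutely. -/
def IsHankel (m : ℂ) (F : L2 →L[ℂ] L2) : Prop :=
  ∀ f : L2, (∃ R : ℝ, ∀ᵐ x ∂hμ, R < x → f x = 0) →
    ∀ᵐ k ∂hμ, F f k = ∫ x in Ioi (0 : ℝ), besselJ m (k * x) * (Real.sqrt (k * x) : ℂ) * f x

/-- There is at most one Hankel transformation `𝓕_m`. -/
theorem IsHankel.unique {m : ℂ} {F G : L2 →L[ℂ] L2} (hF : IsHankel m F) (hG : IsHankel m G) :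
    F = G := by
  refine ContinuousLinearMap.ext_on (s := {f : L2 | ∃ R : ℝ, ∀ᵐ x ∂hμ, R < x → f x = 0}) ?_ ?_
  · refine Dense.mono Submodule.subset_span ?_
    intro f
    rw [Metric.mem_closure_iff]
    intro ε hε
    obtain ⟨g, hg, hfg, -, hgL⟩ := (Lp.memLp f).exists_hasCompactSupport_eLpNorm_sub_le
      ENNReal.ofNat_ne_top (ε := ENNReal.ofReal (ε / 2)) (by simpa using hε)
    refine ⟨hgL.toLp g, ?_, ?_⟩
    · obtain ⟨R, hR⟩ := hg.isCompact.bddAbove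
      refine ⟨R, ?_⟩
      filter_upwards [hgL.coeFn_toLp] with x hx hRx
      rw [hx]
      by_contra h
      exact absurd (hR (subset_tsupport g h)) (not_le.mpr hRx)
    · rw [dist_eq_norm, Lp.norm_def]
      have h : eLpNorm (f - hgL.toLp g : L2) 2 hμ ≤ ENNReal.ofReal (ε / 2) := by
        refine le_trans (le_of_eq (eLpNorm_congr_ae ?_)) hfg
        filter_upwards [Lp.coeFn_sub f (hgL.toLp g), hgL.coeFn_toLp] with x h1 h2
        rw [h1, Pi.sub_apply, Pi.sub_apply, h2]
      have := ENNReal.toReal_le_of_le_ofReal (by positivity) h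
      linarith
  · intro f hf
    apply Lp.ext
    filter_upwards [hF f hf, hG f hf] with k h1 h2
    rw [h1, h2]

/-! ### The unitary operator `I` and similarity -/

/-- A weighted change of variables on the half-line preserving the `L²` norm. -/
structure IsChange (φ φ' w : ℝ → ℝ) : Prop where
  deriv : ∀ x ∈ Ioi (0 : ℝ), HasDerivWithinAt φ (φ' x) (Ioi 0) x
  inj : InjOn φ (Ioi 0)
  image : φ '' Ioi 0 = Ioi 0
  meas : Measurable φ
  measW : Measurable w
  pos : ∀ x ∈ Ioi (0 : ℝ), 0 < φ' x
  sq : ∀ x ∈ Ioi (0 : ℝ), w x ^ 2 = φ' x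

theorem IsChange.lintegral {φ φ' w : ℝ → ℝ} (h : IsChange φ φ' w) (g : ℝ → ℝ≥0∞) :
    ∫⁻ x, g x ∂hμ = ∫⁻ x, ENNReal.ofReal (w x ^ 2) * g (φ x) ∂hμ := by
  have := lintegral_image_eq_lintegral_abs_deriv_mul measurableSet_Ioi h.deriv h.inj g
  rw [h.image] at this
  rw [this]
  refine setLIntegral_congr_fun measurableSet_Ioi fun x hx => ?_
  simp only [h.sq x hx, abs_of_pos (h.pos x hx)]

theorem IsChange.quasi {φ φ' w : ℝ → ℝ} (h : IsChange φ φ' w) :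
    Measure.QuasiMeasurePreserving φ hμ hμ := by
  refine ⟨h.meas, Measure.AbsolutelyContinuous.mk fun s hs h0 => ?_⟩
  rw [Measure.map_apply h.meas hs]
  have h1 := h.lintegral (s.indicator 1)
  have hm : Measurable fun x => ENNReal.ofReal (w x ^ 2) * s.indicator (1 : ℝ → ℝ≥0∞) (φ x) :=
    (h.measW.pow_const 2).ennreal_ofReal.mul ((measurable_one.indicator hs).comp h.meas)
  rw [lintegral_indicator_one hs, h0, eq_comm, lintegral_eq_zero_iff hm] at h1
  rw [← compl_mem_ae_iff]
  filter_upwards [h1, ae_restrict_mem measurableSet_Ioi] with x hx hx0 hxs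
  have hxs' : φ x ∈ s := hxs
  have hp := h.pos x hx0
  rw [← h.sq x hx0] at hp
  simp [hxs'] at hx
  rw [hx] at hp
  simp at hp

theorem IsChange.eLpNorm_eq {φ φ' w : ℝ → ℝ} (h : IsChange φ φ' w) (f : ℝ → ℂ) :
    eLpNorm (fun x => (w x : ℂ) * f (φ x)) 2 hμ = eLpNorm f 2 hμ := by
  rw [eLpNorm_eq_lintegral_rpow_enorm_toReal two_ne_zero ENNReal.ofNat_ne_top,
    eLpNorm_eq_lintegral_rpow_enorm_toReal two_ne_zero ENNReal.ofNat_ne_top,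
    h.lintegral fun x => ‖f x‖ₑ ^ (2 : ℝ≥0∞).toReal]
  congr 2
  funext x
  rw [enorm_mul, ENNReal.mul_rpow_of_nonneg _ _ (by simp)]
  have : ‖(w x : ℂ)‖ₑ ^ (2 : ℝ≥0∞).toReal = ENNReal.ofReal (w x ^ 2) := by
    rw [← ofReal_norm, Complex.norm_real, Real.norm_eq_abs, ENNReal.toReal_ofNat,
      ENNReal.rpow_ofNat, ← ENNReal.ofReal_pow (abs_nonneg _), sq_abs]
  rw [this]

theorem IsChange.memLp {φ φ' w : ℝ → ℝ} (h : IsChange φ φ' w) (f : L2) :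
    MemLp (fun x => (w x : ℂ) * f (φ x)) 2 hμ := by
  refine ⟨?_, ?_⟩
  · exact (Complex.measurable_ofReal.comp h.measW).aestronglyMeasurable.mul
      ((Lp.aestronglyMeasurable f).comp_quasiMeasurePreserving h.quasi)
  · rw [h.eLpNorm_eq]
    exact Lp.eLpNorm_lt_top f

/-- The isometry `f ↦ w · (f ∘ φ)` of `L²[0,∞[`. -/
def IsChange.isometry {φ φ' w : ℝ → ℝ} (h : IsChange φ φ' w) : L2 →ₗᵢ[ℂ] L2 where
  toFun f := (h.memLp f).toLp _
  map_add' f g := by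
    apply Lp.ext
    filter_upwards [(h.memLp (f + g)).coeFn_toLp, (h.memLp f).coeFn_toLp, (h.memLp g).coeFn_toLp,
      Lp.coeFn_add ((h.memLp f).toLp _) ((h.memLp g).toLp _),
      h.quasi.ae (Lp.coeFn_add f g)] with x h1 h2 h3 h4 h5
    rw [h1, h4, Pi.add_apply, h2, h3, h5, Pi.add_apply, mul_add]
  map_smul' c f := by
    apply Lp.ext
    filter_upwards [(h.memLp (c • f)).coeFn_toLp, (h.memLp f).coeFn_toLp,
      Lp.coeFn_smul c ((h.memLp f).toLp _), h.quasi.ae (Lp.coeFn_smul c f)] with x h1 h2 h4 h5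
    rw [h1, RingHom.id_apply, h4, Pi.smul_apply, h2, h5, Pi.smul_apply, smul_eq_mul, smul_eq_mul]
    ring
  norm_map' f := by
    change ‖(h.memLp f).toLp _‖ = ‖f‖
    rw [Lp.norm_toLp, h.eLpNorm_eq, Lp.norm_def]

theorem IsChange.isometry_coe {φ φ' w : ℝ → ℝ} (h : IsChange φ φ' w) (f : L2) :
    h.isometry f =ᵐ[hμ] fun x => (w x : ℂ) * f (φ x) := (h.memLp f).coeFn_toLp

theorem IsChange.comp_eq {φ φ' w ψ ψ' v : ℝ → ℝ} (h : IsChange φ φ' w) (k : IsChange ψ ψ' v)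
    (hφψ : ∀ x ∈ Ioi (0 : ℝ), ψ (φ x) = x) (hwv : ∀ x ∈ Ioi (0 : ℝ), w x * v (φ x) = 1)
    (f : L2) : h.isometry (k.isometry f) = f := by
  apply Lp.ext
  filter_upwards [h.isometry_coe (k.isometry f), h.quasi.ae (k.isometry_coe f),
    ae_restrict_mem measurableSet_Ioi] with x h1 h2 hx
  rw [h1, h2, hφψ x hx, ← mul_assoc, ← Complex.ofReal_mul, hwv x hx, Complex.ofReal_one, one_mul]

theorem isChange_I : IsChange (fun x => 2 * Real.sqrt x) (fun x => x ^ (-(1 / 2) : ℝ))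
    (fun x => x ^ (-(1 / 4) : ℝ)) where
  deriv x hx := by
    have h := ((Real.hasDerivAt_sqrt (ne_of_gt hx)).const_mul 2).hasDerivWithinAt (s := Ioi 0)
    refine h.congr_deriv ?_
    rw [Real.rpow_neg (le_of_lt hx), ← Real.sqrt_eq_rpow]
    have : 0 < Real.sqrt x := Real.sqrt_pos.mpr hx
    field_simp
  inj x hx y hy h := by
    have h' : Real.sqrt x = Real.sqrt y := by simpa using h
    exact (Real.sqrt_inj (le_of_lt hx) (le_of_lt hy)).mp h'
  image := by
    ext y
    constructor
    · rintro ⟨x, hx, rfl⟩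
      exact mul_pos two_pos (Real.sqrt_pos.mpr hx)
    · intro hy
      have hy' : (0 : ℝ) < y := hy
      refine ⟨(y / 2) ^ 2, by simp only [mem_Ioi]; positivity, ?_⟩
      simp only
      rw [Real.sqrt_sq (by positivity)]
      ring
  meas := by fun_prop
  measW := by fun_prop
  pos x hx := Real.rpow_pos_of_pos hx _
  sq x hx := by
    rw [← Real.rpow_natCast, ← Real.rpow_mul (le_of_lt hx)]
    norm_num

theorem isChange_I_inv : IsChange (fun y => y ^ 2 / 4) (fun y => y / 2)
    (fun y => (y / 2) ^ (1 / 2 : ℝ)) where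
  deriv y _ := by
    have h := ((hasDerivAt_pow 2 y).div_const 4).hasDerivWithinAt (s := Ioi 0)
    refine h.congr_deriv ?_
    norm_num
    ring
  inj x hx y hy h := by
    have hx' : (0 : ℝ) < x := hx
    have hy' : (0 : ℝ) < y := hy
    simp only at h
    nlinarith
  image := by
    ext y
    constructor
    · rintro ⟨x, hx, rfl⟩
      have hx' : (0 : ℝ) < x := hx
      simp only [mem_Ioi]
      positivity
    · intro hy
      refine ⟨2 * Real.sqrt y, mul_pos two_pos (Real.sqrt_pos.mpr hy), ?_⟩
      simp only
      rw [mul_pow, Real.sq_sqrt (le_of_lt hy)]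
      ring
  meas := by fun_prop
  measW := by fun_prop
  pos y hy := half_pos hy
  sq y hy := by
    rw [← Real.rpow_natCast, ← Real.rpow_mul (le_of_lt (half_pos hy))]
    norm_num

/-- The unitary operator `(I f)(x) = x^{-1/4} f(2√x)`, with the inverse
`(I⁻¹ f)(y) = (y/2)^{1/2} f(y²/4)`. -/
def unitaryI : L2 ≃ₗᵢ[ℂ] L2 where
  toLinearEquiv := LinearEquiv.ofLinearMap isChange_I.isometry.toLinearMap
    isChange_I_inv.isometry.toLinearMap
    (LinearMap.ext fun f => isChange_I.comp_eq isChange_I_inv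
      (fun x hx => by
        rw [mul_pow, Real.sq_sqrt (le_of_lt hx)]
        ring)
      (fun x hx => by
        rw [mul_div_cancel_left₀ _ two_ne_zero, Real.sqrt_eq_rpow, ← Real.rpow_mul (le_of_lt hx),
          ← Real.rpow_add hx]
        norm_num) f)
    (LinearMap.ext fun f => isChange_I_inv.comp_eq isChange_I
      (fun y hy => by
        have hy' : (0 : ℝ) < y := hy
        rw [show y ^ 2 / 4 = (y / 2) ^ 2 by ring, Real.sqrt_sq (by positivity)]
        ring)
      (fun y hy => by
        have hy' : (0 : ℝ) < y / 2 := half_pos hy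
        rw [show y ^ 2 / 4 = (y / 2) ^ 2 by ring, ← Real.rpow_natCast, ← Real.rpow_mul hy'.le,
          ← Real.rpow_add hy']
        norm_num) f)
  norm_map' f := isChange_I.isometry.norm_map f

theorem unitaryI_coe (f : L2) :
    unitaryI f =ᵐ[hμ] fun x => ((x ^ (-(1 / 4) : ℝ) : ℝ) : ℂ) * f (2 * Real.sqrt x) :=
  isChange_I.isometry_coe f

theorem unitaryI_symm_coe (f : L2) :
    unitaryI.symm f =ᵐ[hμ] fun y => (((y / 2) ^ (1 / 2 : ℝ) : ℝ) : ℂ) * f (y ^ 2 / 4) :=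
  isChange_I_inv.isometry_coe f

/-- The operator `W⁻¹ H W` with its natural domain `{f | W f ∈ Dom H}`. -/
def conjugate (W : L2 ≃L[ℂ] L2) (H : L2 →ₗ.[ℂ] L2) : L2 →ₗ.[ℂ] L2 where
  domain := H.domain.comap (W : L2 →ₗ[ℂ] L2)
  toFun := (W.symm : L2 →ₗ[ℂ] L2) ∘ₗ H.toFun ∘ₗ
    (((W : L2 →ₗ[ℂ] L2).comp (H.domain.comap (W : L2 →ₗ[ℂ] L2)).subtype).codRestrict H.domain
      fun f => f.2)

/-- The relation `(λπ / sin (πm)) · (κ Γ(m) / Γ(-m)) = 1` between `λ, κ ∈ ℂ ∪ {∞}`, extended by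
continuity: `λ = 0` corresponds to `κ = ∞`, and `λ = ∞` to `κ = 0`. -/
def Related (m : ℂ) : OnePoint ℂ → OnePoint ℂ → Prop
  | OnePoint.infty, kap => kap = ((0 : ℂ) : OnePoint ℂ)
  | (lam : ℂ), OnePoint.infty => lam = 0
  | (lam : ℂ), (kap : ℂ) => lam * (Real.pi / Complex.sin (Real.pi * m)) *
      (kap * (Complex.Gamma m / Complex.Gamma (-m))) = 1

/-- The relation `ρ = 2γ - 2ν` between `ρ, ν ∈ ℂ ∪ {∞}`, where `γ` is the Euler-Mascheroni
constant and `ρ = ∞` corresponds to `ν = ∞`. -/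
def RelatedLog : OnePoint ℂ → OnePoint ℂ → Prop
  | OnePoint.infty, nu => nu = OnePoint.infty
  | (_ : ℂ), OnePoint.infty => False
  | (rho : ℂ), (nu : ℂ) => rho = 2 * Real.eulerMascheroniConstant - 2 * nu

end RankOneBessel

end

open RankOneBessel

noncomputable section

namespace RankOneBessel

open Filter Topology

/-! ### Elements of `L²` and the bilinear pairing -/

/-! Put `W = I 𝓕_m`. On the Gaussians `G_s = x^{m+1/2} e^{-s x²/2}` everything is explicit: `𝓕_m G_s
= s^{-m-1} G_{1/s}`, `I` carries `G_s` to a multiple of `x^{m/2} e^{-2sx}`, and `W L G_s = 4x W G_s`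
for `L = L_{m²}`. These vectors are total because exponential moments determine a function, and `W`
preserves the bilinear pairing. So nearly all facts about `W` reduce to Gamma integrals, and no
asymptotics of Bessel functions are needed.

Boundedness of `𝓕_m` for complex `m` is a Mellin transform argument. After conjugation by `I` the
map becomes the reflection `ω ↦ -ω`, times a quotient of Gamma values on one vertical line, which is
bounded by a Harnack inequality (`exists_norm_Gamma_le`). The operator so constructed is identified
with the Bessel integral by testing against narrow Gaussians and integrating the power series term
by term (`hankelCLM_isHankel`).

For `(f, L f)` in the maximal graph, the defect `4x W f - W L f` need not vanish. Its integrals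
against `x^{m/2} e^{-2sx}` are boundary forms of `(f, L f)` with Gaussians, and such a form depends
only on the value of the cutoff at `0`, not on the width. Hence the defect is exactly `c(f) x^{m/2}`
(`defect_eq`), with `c(f)` proportional to the boundary form with `x^{1/2+m} e^{-x²/2}`. This is
where the vector `x^{m/2}` of the rank one perturbation comes from. Dividing by `z - x` gives `(z -
X)⁻¹ W (z - L/4) f = W f + (c(f)/4) (z - X)⁻¹ x^{m/2}`.

Let `ℓ_z(f)` be the pairing of `W (z - L/4) f` with `(z - X)⁻¹ x^{m/2}`. The rank one formula with
coefficient `κ_z` returns `W f` as soon as `c(f)/4 + κ_z ℓ_z(f) = 0`. Both `c` and `ℓ_z` vanish on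
the minimal graph, and the operators in question extend the minimal one by a single vector, so one
scalar identity has to be checked. Surjectivity follows from the symmetry of the rank one resolvent:
its range is isotropic, with the added vector, for the boundary form, and the quotient of the
maximal graph by the minimal graph is controlled by two boundary values (`mem_graphMin_of_two`).
This is `hasResolvents_rankOne`.

It remains to compute `ℓ_z` on two vectors. On the Gaussian with `x^{1/2+m}` it is constant in `z`.
On the second solution, `x^{1/2-m}` or `x^{1/2} ln x`, a Laplace representation computes it for
negative `z`, where the integrand is an elementary function plus an exact derivative, and analytic
continuation gives the rest. The answers contain `(-z)^m Γ(1-m)` and `γ + ln(-z)/2`. The reflection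
formula for `Γ` then turns the scalar identity into the stated relation between the parameters
(`coeff_identity`, `coeff_identity_log`). -/

/-- The class in `L²` of a function (`0` if it is not square integrable). -/
def toL2 (f : ℝ → ℂ) : L2 := open Classical in if h : MemLp f 2 hμ then h.toLp f else 0

theorem toL2_coe {f : ℝ → ℂ} (h : MemLp f 2 hμ) : toL2 f =ᵐ[hμ] f := by
  rw [toL2, dif_pos h]
  exact h.coeFn_toLp

theorem eq_toL2 {f : ℝ → ℂ} {g : L2} (h : g =ᵐ[hμ] f) : g = toL2 f := by
  have hf : MemLp f 2 hμ := (memLp_congr_ae h).mp (Lp.memLp g)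
  exact Lp.ext (h.trans (toL2_coe hf).symm)

theorem toL2_congr {f g : ℝ → ℂ} (h : f =ᵐ[hμ] g) : toL2 f = toL2 g := by
  by_cases hf : MemLp f 2 hμ
  · exact eq_toL2 ((toL2_coe hf).trans h)
  · have hg : ¬ MemLp g 2 hμ := fun hg => hf ((memLp_congr_ae h).mpr hg)
    rw [toL2, dif_neg hf, toL2, dif_neg hg]

theorem toL2_congr_pos {f g : ℝ → ℂ} (h : ∀ x, 0 < x → f x = g x) : toL2 f = toL2 g := by
  refine toL2_congr ?_
  filter_upwards [ae_restrict_mem measurableSet_Ioi] with x hx using h x hx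

theorem toL2_add {f g : ℝ → ℂ} (hf : MemLp f 2 hμ) (hg : MemLp g 2 hμ) :
    toL2 (fun x => f x + g x) = toL2 f + toL2 g := by
  refine (eq_toL2 ?_).symm
  filter_upwards [Lp.coeFn_add (toL2 f) (toL2 g), toL2_coe hf, toL2_coe hg] with x h1 h2 h3
  rw [h1, Pi.add_apply, h2, h3]

theorem toL2_sub {f g : ℝ → ℂ} (hf : MemLp f 2 hμ) (hg : MemLp g 2 hμ) :
    toL2 (fun x => f x - g x) = toL2 f - toL2 g := by
  refine (eq_toL2 ?_).symm
  filter_upwards [Lp.coeFn_sub (toL2 f) (toL2 g), toL2_coe hf, toL2_coe hg] with x h1 h2 h3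
  rw [h1, Pi.sub_apply, h2, h3]

theorem toL2_smul (c : ℂ) {f : ℝ → ℂ} (hf : MemLp f 2 hμ) :
    toL2 (fun x => c * f x) = c • toL2 f := by
  refine (eq_toL2 ?_).symm
  filter_upwards [Lp.coeFn_smul c (toL2 f), toL2_coe hf] with x h1 h2
  rw [h1, Pi.smul_apply, h2, smul_eq_mul]

theorem pairing_apply (e g : L2) : pairing e g = ∫ x, e x * g x ∂hμ := by
  rw [pairing, ContinuousLinearMap.lpPairing_eq_integral]
  rfl

theorem integrable_mul_L2 (e g : L2) : Integrable (fun x => e x * g x) hμ :=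
  (Lp.memLp e).integrable_mul (Lp.memLp g)

theorem pairing_comm (e g : L2) : pairing e g = pairing g e := by
  rw [pairing_apply, pairing_apply]
  simp only [mul_comm]

theorem pairing_add_left (e e' g : L2) : pairing (e + e') g = pairing e g + pairing e' g := by
  simp [pairing]

theorem pairing_sub_left (e e' g : L2) : pairing (e - e') g = pairing e g - pairing e' g := by
  simp [pairing]

theorem pairing_smul_left (c : ℂ) (e g : L2) : pairing (c • e) g = c * pairing e g := by
  simp [pairing]

theorem pairing_toL2_right (e : L2) {f : ℝ → ℂ} (hf : MemLp f 2 hμ) :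
    pairing e (toL2 f) = ∫ x, e x * f x ∂hμ := by
  rw [pairing_apply]
  refine integral_congr_ae ?_
  filter_upwards [toL2_coe hf] with x hx
  rw [hx]

theorem pairing_toL2 {f g : ℝ → ℂ} (hf : MemLp f 2 hμ) (hg : MemLp g 2 hμ) :
    pairing (toL2 f) (toL2 g) = ∫ x, f x * g x ∂hμ := by
  rw [pairing_apply]
  refine integral_congr_ae ?_
  filter_upwards [toL2_coe hf, toL2_coe hg] with x hx hy
  rw [hx, hy]

theorem memLp_conj (e : L2) : MemLp (fun x => (starRingEnd ℂ) (e x)) 2 hμ := by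
  refine (memLp_congr_norm ?_ (Lp.aestronglyMeasurable e) ?_).mpr (Lp.memLp e)
  · exact Complex.continuous_conj.comp_aestronglyMeasurable (Lp.aestronglyMeasurable e)
  · exact Eventually.of_forall fun x => by simp

theorem inner_eq_pairing (e g : L2) :
    inner ℂ e g = pairing (toL2 fun x => (starRingEnd ℂ) (e x)) g := by
  rw [L2.inner_def, pairing_apply]
  refine integral_congr_ae ?_
  filter_upwards [toL2_coe (memLp_conj e)] with x hx
  rw [hx, RCLike.inner_apply, mul_comm]

theorem exists_eq_pairing (ψ : L2 →L[ℂ] ℂ) : ∃ e : L2, ψ = pairing e := by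
  refine ⟨toL2 fun x => (starRingEnd ℂ) ((InnerProductSpace.toDual ℂ L2).symm ψ x), ?_⟩
  ext g
  rw [← inner_eq_pairing, InnerProductSpace.toDual_symm_apply]

/-- A set of vectors is total as soon as only the zero vector pairs to zero with all of them. -/
theorem span_dense_of_pairing {ι : Type*} {v : ι → L2}
    (h : ∀ e : L2, (∀ i, pairing e (v i) = 0) → e = 0) :
    (Submodule.span ℂ (range v)).topologicalClosure = ⊤ := by
  rw [Submodule.topologicalClosure_eq_top_iff, Submodule.eq_bot_iff]
  intro e he
  have h0 : (toL2 fun x => (starRingEnd ℂ) (e x)) = 0 := by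
    refine h _ fun i => ?_
    rw [← inner_eq_pairing, ← inner_conj_symm,
      (Submodule.mem_orthogonal _ _).mp he _ (Submodule.subset_span (mem_range_self i)), map_zero]
  apply Lp.ext
  have h1 := toL2_coe (memLp_conj e)
  rw [h0] at h1
  filter_upwards [h1, Lp.coeFn_zero ℂ 2 hμ] with x h1 h2
  rw [h2] at h1 ⊢
  simpa using h1.symm

/-! ### Functions with vanishing exponential moments -/

/-- Since `θ` maps into `]0,1]` and has the left inverse `r`, a test function `g` on the half-line
has the form `q ∘ θ` with `q` continuous on `[0,1]`. Weierstrass approximation of `q` by polynomials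
in `θ` shows that `H` integrates to zero against `g`. -/
theorem ae_eq_zero_of_moments {H : ℝ → ℂ} {θ r : ℝ → ℝ} (hH : Integrable H hμ)
    (hθm : Measurable θ) (hθ : ∀ x, 0 < x → θ x ∈ Ioc (0 : ℝ) 1) (hr : ∀ x, 0 < x → r (θ x) = x)
    (hrc : ContinuousOn r (Ioc 0 1)) (hr0 : Tendsto r (𝓝[>] 0) atTop)
    (h : ∀ n : ℕ, ∫ x, H x * ((θ x ^ n : ℝ) : ℂ) ∂hμ = 0) : H =ᵐ[hμ] 0 := by
  have hpoly : ∀ p : Polynomial ℝ, ∫ x, H x * ((p.eval (θ x) : ℝ) : ℂ) ∂hμ = 0 := by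
    intro p
    have hi : ∀ n : ℕ, Integrable (fun x => H x * ((θ x ^ n : ℝ) : ℂ)) hμ := by
      intro n
      refine hH.mul_bdd (c := 1) (by fun_prop) ?_
      filter_upwards [ae_restrict_mem measurableSet_Ioi] with x hx
      have := hθ x hx
      rw [Complex.norm_real, norm_pow, Real.norm_eq_abs, abs_of_pos this.1]
      exact pow_le_one₀ this.1.le this.2
    simp_rw [Polynomial.eval_eq_sum_range, Complex.ofReal_sum, Finset.mul_sum]
    rw [integral_finsetSum]
    · refine Finset.sum_eq_zero fun n _ => ?_
      have : ∀ x, H x * ((p.coeff n * θ x ^ n : ℝ) : ℂ)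
          = (p.coeff n : ℂ) * (H x * ((θ x ^ n : ℝ) : ℂ)) := by
        intro x
        push_cast
        ring
      simp_rw [this]
      rw [integral_const_mul, h, mul_zero]
    · intro n _
      refine ((hi n).const_mul (p.coeff n : ℂ)).congr (Eventually.of_forall fun x => ?_)
      push_cast
      ring
  have hloc : LocallyIntegrableOn H (Ioi 0) volume :=
    IntegrableOn.locallyIntegrableOn hH
  have key := isOpen_Ioi.ae_eq_zero_of_integral_contDiff_smul_eq_zero hloc (fun g hg hgc hgs => ?_)
  · rw [EventuallyEq, ae_restrict_iff' measurableSet_Ioi]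
    exact key
  have hgz : ∀ x ≤ 0, g x = 0 := fun x hx =>
    image_eq_zero_of_notMem_tsupport fun hx' => not_lt.mpr hx (hgs hx')
  have h1 : ∫ x, g x • H x = ∫ x, H x * (g x : ℂ) ∂hμ := by
    rw [← setIntegral_eq_integral_of_forall_compl_eq_zero (s := Ioi 0)]
    · simp_rw [Complex.real_smul, mul_comm]
    · intro x hx
      rw [hgz x (not_lt.mp hx), zero_smul]
  rw [h1]
  obtain ⟨B, hB⟩ := hgc.isCompact.bddAbove
  have hgB : ∀ x, B < x → g x = 0 := fun x hx =>
    image_eq_zero_of_notMem_tsupport fun hx' => not_lt.mpr (hB hx') hx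
  -- The value `0` at `u = 0` makes `q` continuous there: `r u → ∞` as `u ↓ 0`, which leaves the
  -- compact support of `g`.
  let q : ℝ → ℝ := fun u => if u = 0 then 0 else g (r u)
  have hq : ContinuousOn q (Icc 0 1) := by
    intro u hu
    rcases eq_or_lt_of_le hu.1 with rfl | hu0
    · have h0 : ∀ᶠ u in 𝓝[Icc (0 : ℝ) 1] 0, q u = 0 := by
        have h2 := hr0.eventually (eventually_gt_atTop B)
        rw [eventually_nhdsWithin_iff] at h2 ⊢
        filter_upwards [h2] with u h3 h4
        rcases eq_or_lt_of_le h4.1 with rfl | hu0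
        · simp [q]
        · simp only [q, if_neg hu0.ne']
          exact hgB _ (h3 hu0)
      refine (continuousWithinAt_const (b := (0 : ℝ))).congr_of_eventuallyEq h0 (by simp [q])
    · have h2 : ContinuousWithinAt (fun u => g (r u)) (Icc 0 1) u := by
        have : ContinuousWithinAt r (Icc 0 1) u := by
          refine (hrc u ⟨hu0, hu.2⟩).mono_of_mem_nhdsWithin ?_
          have : Ioi (0 : ℝ) ∈ 𝓝[Icc 0 1] u := mem_nhdsWithin_of_mem_nhds (Ioi_mem_nhds hu0)
          filter_upwards [this, self_mem_nhdsWithin] with v hv hv' using ⟨hv, hv'.2⟩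
        exact hg.continuous.continuousAt.comp_continuousWithinAt this
      refine h2.congr_of_eventuallyEq ?_ (by simp [q, hu0.ne'])
      filter_upwards [mem_nhdsWithin_of_mem_nhds (Ioi_mem_nhds hu0)] with v hv
      have hv' : v ≠ 0 := ne_of_gt hv
      simp [q, hv']
  have hqg : ∀ x, 0 < x → q (θ x) = g x := by
    intro x hx
    simp only [q, if_neg (hθ x hx).1.ne', hr x hx]
  have hbound : ∀ ε > 0, ‖∫ x, H x * (g x : ℂ) ∂hμ‖ ≤ ε * ∫ x, ‖H x‖ ∂hμ := by
    intro ε hε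
    obtain ⟨p, hp⟩ := exists_polynomial_near_of_continuousOn 0 1 q hq ε hε
    have hcp : ∃ C, ∀ u ∈ Icc (0 : ℝ) 1, ‖p.eval u‖ ≤ C :=
      isCompact_Icc.exists_bound_of_continuousOn p.continuous.continuousOn
    obtain ⟨C, hC⟩ := hcp
    have hi1 : Integrable (fun x => H x * ((p.eval (θ x) : ℝ) : ℂ)) hμ := by
      refine hH.mul_bdd (c := C) ?_ ?_
      · exact (Complex.measurable_ofReal.comp
          (p.continuous.measurable.comp hθm)).aestronglyMeasurable
      · filter_upwards [ae_restrict_mem measurableSet_Ioi] with x hx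
        rw [Complex.norm_real]
        exact hC _ (Ioc_subset_Icc_self (hθ x hx))
    have hi2 : Integrable (fun x => H x * (g x : ℂ)) hμ := by
      obtain ⟨D, hD⟩ := hgc.exists_bound_of_continuous hg.continuous
      refine hH.mul_bdd (c := D) ?_ ?_
      · exact (Complex.continuous_ofReal.comp hg.continuous).aestronglyMeasurable
      · exact Eventually.of_forall fun x => by rw [Complex.norm_real]; exact hD x
    have h3 : ∫ x, H x * (g x : ℂ) ∂hμ
        = ∫ x, (H x * (g x : ℂ) - H x * ((p.eval (θ x) : ℝ) : ℂ)) ∂hμ := by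
      rw [integral_sub hi2 hi1, hpoly, sub_zero]
    rw [h3, ← integral_const_mul]
    refine norm_integral_le_of_norm_le (hH.norm.const_mul ε) ?_
    filter_upwards [ae_restrict_mem measurableSet_Ioi] with x hx
    rw [← mul_sub, norm_mul, mul_comm, ← Complex.ofReal_sub, Complex.norm_real, ← hqg x hx,
      norm_sub_rev]
    exact mul_le_mul_of_nonneg_right (hp _ (Ioc_subset_Icc_self (hθ x hx))).le (norm_nonneg _)
  have hlim : Tendsto (fun ε : ℝ => ε * ∫ x, ‖H x‖ ∂hμ) (𝓝[>] 0) (𝓝 0) := by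
    have : Tendsto (fun ε : ℝ => ε * ∫ x, ‖H x‖ ∂hμ) (𝓝 0) (𝓝 (0 * ∫ x, ‖H x‖ ∂hμ)) :=
      tendsto_id.mul_const _
    rw [zero_mul] at this
    exact this.mono_left nhdsWithin_le_nhds
  have := ge_of_tendsto hlim (eventually_nhdsWithin_of_forall fun ε hε => hbound ε hε)
  exact norm_le_zero_iff.mp this

theorem ae_eq_zero_of_exp_moments {H : ℝ → ℂ} (hH : Integrable H hμ)
    (h : ∀ n : ℕ, ∫ x, H x * ((Real.exp (-(n * x)) : ℝ) : ℂ) ∂hμ = 0) : H =ᵐ[hμ] 0 := by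
  refine ae_eq_zero_of_moments (θ := fun x => Real.exp (-x)) (r := fun u => -Real.log u) hH
    (by fun_prop) ?_ ?_ ?_ ?_ ?_
  · intro x hx
    exact ⟨Real.exp_pos _, Real.exp_le_one_iff.mpr (by linarith)⟩
  · intro x _
    simp
  · exact (Real.continuousOn_log.mono fun u hu => hu.1.ne').neg
  · exact tendsto_neg_atBot_atTop.comp Real.tendsto_log_nhdsGT_zero
  · intro n
    simp_rw [← Real.exp_nat_mul, mul_neg]
    exact h n

theorem ae_eq_zero_of_gaussian_moments {H : ℝ → ℂ} (hH : Integrable H hμ)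
    (h : ∀ n : ℕ, ∫ x, H x * ((Real.exp (-(n * (x ^ 2 / 2))) : ℝ) : ℂ) ∂hμ = 0) :
    H =ᵐ[hμ] 0 := by
  refine ae_eq_zero_of_moments (θ := fun x => Real.exp (-(x ^ 2 / 2)))
    (r := fun u => Real.sqrt (2 * -Real.log u)) hH (by fun_prop) ?_ ?_ ?_ ?_ ?_
  · intro x hx
    exact ⟨Real.exp_pos _, Real.exp_le_one_iff.mpr (by have := sq_nonneg x; linarith)⟩
  · intro x hx
    simp only [Real.log_exp, neg_neg]
    rw [mul_div_cancel₀ _ two_ne_zero, Real.sqrt_sq hx.le]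
  · exact ((Real.continuousOn_log.mono fun u hu => hu.1.ne').neg.const_smul (2 : ℝ)).sqrt
  · refine Real.tendsto_sqrt_atTop.comp ?_
    exact (tendsto_neg_atBot_atTop.comp Real.tendsto_log_nhdsGT_zero).const_mul_atTop two_pos
  · intro n
    simp_rw [← Real.exp_nat_mul, mul_neg]
    exact h n

/-! ### A Harnack inequality for the Gamma function on vertical lines -/

theorem norm_sq_add_natCast (σ y : ℝ) (j : ℕ) :
    ‖(σ + y * Complex.I + j : ℂ)‖ ^ 2 = (σ + j) ^ 2 + y ^ 2 := by
  rw [← Complex.normSq_eq_norm_sq, Complex.normSq_apply]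
  simp
  ring

/-- This compares one factor of Gauss's product for `Γ` at heights `y` and `y + δ`. The exponent is
written as a difference of consecutive terms so that the product over `j` telescopes, with a bound
uniform in `y` and in the number of factors. -/
theorem norm_sq_add_natCast_le {σ : ℝ} (hσ : 0 < σ) (δ : ℝ) :
    ∃ K : ℝ, ∀ (y : ℝ) (j : ℕ), (σ + j) ^ 2 + y ^ 2 ≤ ((σ + j) ^ 2 + (y + δ) ^ 2) *
      Real.exp (K * (1 + |y + δ|) * (1 / (j + 1 + |y + δ|) - 1 / (j + 2 + |y + δ|))) := by
  -- With this choice `σ + j ≥ τ (j + 1)`, so the `j`-th factor is at least of order `(j + 1 + |y +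
  -- δ|)²`, uniformly for small and for large `σ`.
  set τ : ℝ := min σ 1 with hτ
  have hτ0 : 0 < τ := lt_min hσ one_pos
  -- The lower bound `τ² A² / 2`, with `A = j + 1 + |y + δ|`, contributes `2 / τ²`; another factor
  -- `2` comes from `1 / A² ≤ 2 / (A (A + 1))`, valid as `A ≥ 1`. The rest bounds `y² - (y + δ)²`.
  refine ⟨4 / τ ^ 2 * (|δ| * (2 + |δ|)), fun y j => ?_⟩
  set v := y + δ with hv
  have hy : y = v - δ := by rw [hv]; ring
  set A : ℝ := j + 1 + |v| with hA
  have hA1 : 1 ≤ A := by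
    have : (0 : ℝ) ≤ j := j.cast_nonneg
    have := abs_nonneg v
    rw [hA]; linarith
  have hA0 : 0 < A := by linarith
  have e1 : (j : ℝ) + 2 + |v| = A + 1 := by rw [hA]; ring
  rw [e1]
  have e2 : 1 / A - 1 / (A + 1) = 1 / (A * (A + 1)) := by field_simp; ring
  rw [e2]
  set D := |δ| * (2 + |δ|) * (1 + |v|) with hD
  have hD0 : 0 ≤ D := by positivity
  have hdiff : y ^ 2 - v ^ 2 ≤ D := by
    rw [hy, hD]
    have h1 : (v - δ) ^ 2 - v ^ 2 = -(2 * (v * δ)) + δ ^ 2 := by ring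
    have h2 : -(v * δ) ≤ |v| * |δ| := by rw [← abs_mul]; exact neg_le_abs _
    have h3 : δ ^ 2 = |δ| ^ 2 := (sq_abs δ).symm
    have h4 : 0 ≤ |δ| * |δ| * |v| := by positivity
    have h5 : 0 ≤ |δ| := abs_nonneg _
    rw [h1, h3]
    nlinarith
  have hlow : τ ^ 2 / 2 * A ^ 2 ≤ (σ + j) ^ 2 + v ^ 2 := by
    have hj : (0 : ℝ) ≤ j := j.cast_nonneg
    have h1 : τ * (j + 1) ≤ σ + j := by
      have : τ ≤ σ := min_le_left _ _
      have : τ ≤ 1 := min_le_right _ _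
      nlinarith
    have h2 : (τ * (j + 1)) ^ 2 ≤ (σ + j) ^ 2 := pow_le_pow_left₀ (by positivity) h1 2
    have h3 : (τ * |v|) ^ 2 ≤ v ^ 2 := by
      rw [mul_pow, sq_abs]
      have : τ ^ 2 ≤ 1 := pow_le_one₀ hτ0.le (min_le_right _ _)
      nlinarith [sq_nonneg v]
    have h4 : A ^ 2 ≤ 2 * ((j + 1) ^ 2 + |v| ^ 2) := by
      rw [hA]; nlinarith [sq_nonneg ((j : ℝ) + 1 - |v|)]
    have h5 : τ ^ 2 / 2 * A ^ 2 ≤ τ ^ 2 / 2 * (2 * ((j + 1) ^ 2 + |v| ^ 2)) :=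
      mul_le_mul_of_nonneg_left h4 (by positivity)
    nlinarith
  have hX : D ≤ ((σ + j) ^ 2 + v ^ 2) *
      (4 / τ ^ 2 * (|δ| * (2 + |δ|)) * (1 + |v|) * (1 / (A * (A + 1)))) := by
    have h0 : 0 ≤ 4 / τ ^ 2 * (|δ| * (2 + |δ|)) * (1 + |v|) * (1 / (A * (A + 1))) := by positivity
    refine le_trans ?_ (mul_le_mul_of_nonneg_right hlow h0)
    have : τ ^ 2 / 2 * A ^ 2 * (4 / τ ^ 2 * (|δ| * (2 + |δ|)) * (1 + |v|) * (1 / (A * (A + 1))))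
        = D * (2 * A / (A + 1)) := by
      rw [hD]; field_simp; ring
    rw [this]
    refine le_mul_of_one_le_right hD0 ?_
    rw [le_div_iff₀ (by linarith)]
    linarith
  have h6 := Real.add_one_le_exp
    (4 / τ ^ 2 * (|δ| * (2 + |δ|)) * (1 + |v|) * (1 / (A * (A + 1))))
  have h7 : 0 ≤ (σ + j) ^ 2 + v ^ 2 := by positivity
  calc (σ + j) ^ 2 + y ^ 2 ≤ (σ + j) ^ 2 + v ^ 2 + D := by linarith
    _ ≤ ((σ + j) ^ 2 + v ^ 2) *
      (4 / τ ^ 2 * (|δ| * (2 + |δ|)) * (1 + |v|) * (1 / (A * (A + 1))) + 1) := by linarith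
    _ ≤ _ := mul_le_mul_of_nonneg_left h6 h7

/-- In Gauss's limit `Γ(w) = lim n^w n! / ∏ (w + j)` the modulus of `n^w` depends only on the real
part of `w`, so the quotient of the two sides is a quotient of products. By the telescoping bound it
stays below `exp (|K| / 2)` for every `n`, the half coming from the passage to squared moduli. -/
theorem exists_norm_Gamma_le {σ : ℝ} (hσ : 0 < σ) (δ : ℝ) : ∃ C : ℝ, 0 ≤ C ∧ ∀ y : ℝ,
    ‖Complex.Gamma (σ + (y + δ : ℝ) * Complex.I)‖ ≤ C * ‖Complex.Gamma (σ + y * Complex.I)‖ := by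
  obtain ⟨K, hK⟩ := norm_sq_add_natCast_le hσ δ
  refine ⟨Real.exp (|K| / 2), (Real.exp_pos _).le, fun y => ?_⟩
  have hpos : ∀ (v : ℝ) (j : ℕ), 0 < ‖(σ + v * Complex.I + j : ℂ)‖ := by
    intro v j
    have h := norm_sq_add_natCast σ v j
    have : 0 < (σ + j) ^ 2 + v ^ 2 := by positivity
    rw [← h] at this
    exact lt_of_le_of_ne (norm_nonneg _) fun h0 => by simp [← h0] at this
  have hprod : ∀ n : ℕ, ∏ j ∈ Finset.range (n + 1), ‖(σ + y * Complex.I + j : ℂ)‖ ≤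
      Real.exp (|K| / 2) *
        ∏ j ∈ Finset.range (n + 1), ‖(σ + (y + δ : ℝ) * Complex.I + j : ℂ)‖ := by
    intro n
    refine le_of_sq_le_sq ?_ (by positivity)
    rw [mul_pow, ← Finset.prod_pow, ← Finset.prod_pow]
    simp_rw [norm_sq_add_natCast]
    have h1 := Finset.prod_le_prod (s := Finset.range (n + 1))
      (f := fun j : ℕ => (σ + j) ^ 2 + y ^ 2) (fun j _ => by positivity) (fun j _ => hK y j)
    refine h1.trans ?_
    rw [Finset.prod_mul_distrib, ← Real.exp_sum, mul_comm]
    refine mul_le_mul_of_nonneg_right ?_ (Finset.prod_nonneg fun j _ => by positivity)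
    rw [← Real.exp_nat_mul, Real.exp_le_exp, ← Finset.mul_sum]
    have h2 : ∑ j ∈ Finset.range (n + 1),
        (1 / ((j : ℝ) + 1 + |y + δ|) - 1 / (j + 2 + |y + δ|))
        = 1 / (1 + |y + δ|) - 1 / (n + 2 + |y + δ|) := by
      have := Finset.sum_range_sub' (fun j : ℕ => 1 / ((j : ℝ) + 1 + |y + δ|)) (n + 1)
      simp only [Nat.cast_zero, zero_add, Nat.cast_add, Nat.cast_one] at this
      rw [show (n : ℝ) + 2 = n + 1 + 1 by ring, ← this]
      refine Finset.sum_congr rfl fun j _ => ?_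
      rw [show (j : ℝ) + 2 = j + 1 + 1 by ring]
    rw [h2]
    have hv : 0 < 1 + |y + δ| := by positivity
    have h3 : 0 ≤ (1 + |y + δ|) * (1 / (1 + |y + δ|) - 1 / (n + 2 + |y + δ|)) := by
      refine mul_nonneg hv.le (sub_nonneg.mpr ?_)
      exact one_div_le_one_div_of_le hv (by
        have : (0 : ℝ) ≤ n := n.cast_nonneg
        linarith)
    have h4 : (1 + |y + δ|) * (1 / (1 + |y + δ|) - 1 / (n + 2 + |y + δ|)) ≤ 1 := by
      rw [mul_sub, mul_one_div_cancel hv.ne']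
      have : 0 ≤ (1 + |y + δ|) * (1 / (n + 2 + |y + δ|)) := by positivity
      linarith
    rw [mul_assoc]
    calc K * _ ≤ |K| * ((1 + |y + δ|) * (1 / (1 + |y + δ|) - 1 / (n + 2 + |y + δ|))) :=
          mul_le_mul_of_nonneg_right (le_abs_self K) h3
      _ ≤ |K| * 1 := mul_le_mul_of_nonneg_left h4 (abs_nonneg _)
      _ = _ := by push_cast; ring
  have hseq : ∀ n : ℕ, 0 < n → ‖Complex.GammaSeq (σ + (y + δ : ℝ) * Complex.I) n‖ ≤
      Real.exp (|K| / 2) * ‖Complex.GammaSeq (σ + y * Complex.I) n‖ := by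
    intro n hn
    simp only [Complex.GammaSeq, norm_div, norm_mul, norm_prod,
      Complex.norm_natCast_cpow_of_pos hn]
    have hre : ∀ v : ℝ, ((σ : ℂ) + v * Complex.I).re = σ := by intro v; simp
    rw [hre, hre, ← mul_div_assoc, div_le_div_iff₀ (Finset.prod_pos fun j _ => hpos _ j)
      (Finset.prod_pos fun j _ => hpos _ j)]
    calc _ ≤ (n : ℝ) ^ σ * ‖(n.factorial : ℂ)‖ * (Real.exp (|K| / 2) *
        ∏ j ∈ Finset.range (n + 1), ‖(σ + (y + δ : ℝ) * Complex.I + j : ℂ)‖) :=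
          mul_le_mul_of_nonneg_left (hprod n) (by positivity)
      _ = _ := by ring
  refine le_of_tendsto_of_tendsto (Complex.GammaSeq_tendsto_Gamma _).norm
    ((Complex.GammaSeq_tendsto_Gamma _).norm.const_mul _) ?_
  filter_upwards [eventually_gt_atTop 0] with n hn using hseq n hn

/-! ### Power functions with exponential weights -/

theorem integrable_rpow_exp {q c : ℝ} (hq : -1 < q) (hc : 0 < c) :
    Integrable (fun x : ℝ => x ^ q * Real.exp (-(c * x))) hμ := by
  have := integrableOn_rpow_mul_exp_neg_mul_rpow hq one_pos hc
  refine IntegrableOn.congr_fun this (fun x _ => ?_) measurableSet_Ioi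
  simp only [Real.rpow_one, neg_mul]

theorem integrable_cpow_exp {w : ℂ} {c : ℝ} (hw : -1 < w.re) (hc : 0 < c) :
    Integrable (fun x : ℝ => (x : ℂ) ^ w * (Real.exp (-(c * x)) : ℝ)) hμ := by
  refine (integrable_rpow_exp hw hc).mono' ?_ ?_
  · exact ((Complex.measurable_ofReal.pow_const _).mul (by fun_prop)).aestronglyMeasurable
  · filter_upwards [ae_restrict_mem measurableSet_Ioi] with x hx
    rw [norm_mul, Complex.norm_cpow_eq_rpow_re_of_pos hx, Complex.norm_real, Real.norm_eq_abs,
      abs_of_pos (Real.exp_pos _)]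

theorem memLp_cpow_exp {w : ℂ} {c : ℝ} (hw : -1 / 2 < w.re) (hc : 0 < c) :
    MemLp (fun x : ℝ => (x : ℂ) ^ w * (Real.exp (-(c * x)) : ℝ)) 2 hμ := by
  have hmeas : AEStronglyMeasurable (fun x : ℝ => (x : ℂ) ^ w * (Real.exp (-(c * x)) : ℝ)) hμ :=
    ((Complex.measurable_ofReal.pow_const _).mul (by fun_prop)).aestronglyMeasurable
  rw [memLp_two_iff_integrable_sq_norm hmeas]
  refine (integrable_rpow_exp (q := 2 * w.re) (c := 2 * c) (by linarith) (by linarith)).congr ?_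
  filter_upwards [ae_restrict_mem measurableSet_Ioi] with x hx
  have hx' : (0 : ℝ) < x := hx
  rw [norm_mul, Complex.norm_cpow_eq_rpow_re_of_pos hx, Complex.norm_real, Real.norm_eq_abs,
    abs_of_pos (Real.exp_pos _), mul_pow, ← Real.rpow_natCast, ← Real.rpow_mul hx'.le,
    ← Real.exp_nat_mul]
  congr 2 <;> push_cast <;> ring

theorem integral_cpow_exp {w : ℂ} {c : ℝ} (hw : -1 < w.re) (hc : 0 < c) :
    ∫ x, (x : ℂ) ^ w * (Real.exp (-(c * x)) : ℝ) ∂hμ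
      = (c : ℂ) ^ (-(w + 1)) * Complex.Gamma (w + 1) := by
  have h := Complex.integral_cpow_mul_exp_neg_mul_Ioi (a := w + 1) (r := c)
    (by simp; linarith) hc
  rw [add_sub_cancel_right] at h
  rw [Complex.cpow_neg, ← Complex.inv_cpow _ _ (by
    rw [Complex.arg_ofReal_of_nonneg hc.le]; exact Real.pi_pos.ne), ← one_div, ← h]
  refine integral_congr_ae (Eventually.of_forall fun x => ?_)
  push_cast
  rfl

/-! ### Plancherel's theorem for integrable functions, and the Mellin transformation -/

-- Plancherel's theorem is known for the Fourier transformation on the space `L²`. For an integrable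
-- function that transform agrees almost everywhere with the Fourier integral, because both have the
-- same integrals against smooth compactly supported functions, by moving the transform to the other
-- factor.
open FourierTransform SchwartzMap in
theorem eLpNorm_fourier {f : ℝ → ℂ} (h1 : Integrable f) (h2 : MemLp f 2) :
    eLpNorm (𝓕 f) 2 volume = eLpNorm f 2 volume := by
  let f2 : Lp ℂ 2 (volume : Measure ℝ) := h2.toLp f
  have hcont : Continuous (𝓕 f) :=
    VectorFourier.fourierIntegral_continuous Real.continuous_fourierChar
      continuous_inner h1
  have key : (𝓕 f2 : Lp ℂ 2 (volume : Measure ℝ)) =ᵐ[volume] 𝓕 f := by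
    refine ae_eq_of_integral_contDiff_smul_eq ((Lp.memLp _).locallyIntegrable (by norm_num))
      hcont.locallyIntegrable fun g hg hgc => ?_
    have hg₁ : HasCompactSupport (Complex.ofRealCLM ∘ g) := hgc.comp_left rfl
    have hg₂ : ContDiff ℝ (⊤ : ℕ∞) (Complex.ofRealCLM ∘ g) := by fun_prop
    let G : 𝓢(ℝ, ℂ) := hg₁.toSchwartzMap hg₂
    have hG : ∀ x, G x = (g x : ℂ) := fun x => rfl
    have h3 : Lp.toTemperedDistribution (𝓕 f2 : Lp ℂ 2 (volume : Measure ℝ)) G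
        = Lp.toTemperedDistribution f2 (𝓕 G) := by
      rw [← Lp.fourier_toTemperedDistribution_eq, TemperedDistribution.fourier_apply]
    rw [Lp.toTemperedDistribution_apply, Lp.toTemperedDistribution_apply] at h3
    have h4 : ∫ x, (𝓕 G : 𝓢(ℝ, ℂ)) x • f2 x = ∫ x, (𝓕 (G : ℝ → ℂ)) x • f x := by
      refine integral_congr_ae ?_
      filter_upwards [h2.coeFn_toLp] with x hx
      rw [SchwartzMap.fourier_coe]
      simp only [f2, hx]
    have h5 : ∫ x, (𝓕 (G : ℝ → ℂ)) x • f x = ∫ x, G x • (𝓕 f) x := by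
      simpa using! VectorFourier.integral_fourierIntegral_smul_eq_flip (L := innerₗ ℝ)
        Real.continuous_fourierChar continuous_inner G.integrable h1
    rw [h4, h5] at h3
    simpa only [hG, Complex.real_smul, smul_eq_mul] using h3
  rw [← eLpNorm_congr_ae key, ← eLpNorm_congr_ae h2.coeFn_toLp, ← Lp.enorm_def, ← Lp.enorm_def,
    ← ofReal_norm, ← ofReal_norm, Lp.norm_fourier_eq]

theorem eLpNorm_exp_comp (f : ℝ → ℂ) :
    eLpNorm (fun t : ℝ => (Real.exp (t / 2) : ℂ) * f (Real.exp t)) 2 volume = eLpNorm f 2 hμ := by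
  rw [eLpNorm_eq_lintegral_rpow_enorm_toReal two_ne_zero ENNReal.ofNat_ne_top,
    eLpNorm_eq_lintegral_rpow_enorm_toReal two_ne_zero ENNReal.ofNat_ne_top]
  congr 1
  have := lintegral_image_eq_lintegral_abs_deriv_mul MeasurableSet.univ
    (fun t _ => (Real.hasDerivAt_exp t).hasDerivWithinAt (s := univ)) Real.exp_injective.injOn
    (fun x => ‖f x‖ₑ ^ (2 : ℝ≥0∞).toReal)
  rw [image_univ, Real.range_exp, Measure.restrict_univ] at this
  rw [this]
  refine lintegral_congr fun t => ?_
  rw [enorm_mul, ENNReal.mul_rpow_of_nonneg _ _ (by simp)]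
  congr 1
  rw [← ofReal_norm, Complex.norm_real, Real.norm_eq_abs, ENNReal.toReal_ofNat,
    ENNReal.rpow_ofNat, ← ENNReal.ofReal_pow (abs_nonneg _), sq_abs, ← Real.exp_nat_mul,
    abs_of_pos (Real.exp_pos t)]
  congr 2
  push_cast
  ring

theorem toL2_sum {ι : Type*} (A : Finset ι) (c : ι → ℂ) {f : ι → ℝ → ℂ}
    (hf : ∀ i ∈ A, MemLp (f i) 2 hμ) :
    toL2 (fun x => ∑ i ∈ A, c i * f i x) = ∑ i ∈ A, c i • toL2 (f i) := by
  classical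
  induction A using Finset.induction_on with
  | empty =>
    simp only [Finset.sum_empty]
    exact (eq_toL2 (Lp.coeFn_zero ℂ 2 hμ)).symm
  | insert i A hi ih =>
    have h1 : ∀ j ∈ A, MemLp (f j) 2 hμ := fun j hj => hf j (Finset.mem_insert_of_mem hj)
    simp_rw [Finset.sum_insert hi]
    rw [toL2_add ((hf i (Finset.mem_insert_self i A)).const_mul (c i))
      (memLp_finsetSum A fun j hj => (h1 j hj).const_mul (c j)), ih h1,
      toL2_smul (c i) (hf i (Finset.mem_insert_self i A))]

/-! ### The vectors `x^{m/2} e^{-2sx}` -/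

/-- The function `x^{m/2} e^{-2sx}`. -/
def expFun (m : ℂ) (s : ℝ) (x : ℝ) : ℂ := (x : ℂ) ^ (m / 2) * (Real.exp (-(2 * s * x)) : ℝ)

/-- The vector `x^{m/2} e^{-2sx}` of `L²[0,∞[`. -/
def expVec (m : ℂ) (s : ℝ) : L2 := toL2 (expFun m s)

theorem memLp_expFun {m : ℂ} {s : ℝ} (hm : -1 < m.re) (hs : 0 < s) :
    MemLp (expFun m s) 2 hμ :=
  memLp_cpow_exp (by simp; linarith) (by linarith)

theorem expVec_coe {m : ℂ} {s : ℝ} (hm : -1 < m.re) (hs : 0 < s) :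
    expVec m s =ᵐ[hμ] expFun m s := toL2_coe (memLp_expFun hm hs)

theorem expFun_mul {m : ℂ} {s t x : ℝ} (hx : 0 < x) :
    expFun m s x * expFun m t x = (x : ℂ) ^ m * (Real.exp (-(2 * (s + t) * x)) : ℝ) := by
  have hx' : (x : ℂ) ≠ 0 := Complex.ofReal_ne_zero.mpr hx.ne'
  have h1 : (x : ℂ) ^ m = (x : ℂ) ^ (m / 2) * (x : ℂ) ^ (m / 2) := by
    rw [← Complex.cpow_add _ _ hx', add_halves]
  have h2 : Real.exp (-(2 * (s + t) * x)) = Real.exp (-(2 * s * x)) * Real.exp (-(2 * t * x)) := by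
    rw [← Real.exp_add]
    congr 1
    ring
  rw [expFun, expFun, h1, h2]
  push_cast
  ring

theorem pairing_expVec {m : ℂ} {s t : ℝ} (hm : -1 < m.re) (hs : 0 < s) (ht : 0 < t) :
    pairing (expVec m s) (expVec m t)
      = ((2 * (s + t) : ℝ) : ℂ) ^ (-(m + 1)) * Complex.Gamma (m + 1) := by
  rw [expVec, expVec, pairing_toL2 (memLp_expFun hm hs) (memLp_expFun hm ht),
    ← integral_cpow_exp hm (by linarith)]
  refine setIntegral_congr_fun measurableSet_Ioi fun x hx => expFun_mul hx

theorem ae_eq_zero_of_integral_expFun {m : ℂ} {h : ℝ → ℂ}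
    (hi : Integrable (fun x => h x * expFun m 1 x) hμ)
    (h0 : ∀ s, 0 < s → ∫ x, h x * expFun m s x ∂hμ = 0) : h =ᵐ[hμ] 0 := by
  have key := ae_eq_zero_of_exp_moments hi (fun n => by
    -- The choice of `s` factors the weight as `e^{-2x} e^{-nx}`: the first factor secures
    -- integrability, the second gives the moments.
    rw [← h0 (1 + n / 2) (by positivity)]
    refine integral_congr_ae (Eventually.of_forall fun x => ?_)
    simp only [expFun]
    rw [show -(2 * (1 + (n : ℝ) / 2) * x) = -(2 * 1 * x) + -(n * x) by ring, Real.exp_add]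
    push_cast
    ring)
  filter_upwards [key, ae_restrict_mem measurableSet_Ioi] with x hx hx0
  have hx' : (x : ℂ) ≠ 0 := Complex.ofReal_ne_zero.mpr (ne_of_gt hx0)
  refine (mul_eq_zero.mp hx).resolve_right ?_
  rw [expFun]
  refine mul_ne_zero ?_ (Complex.ofReal_ne_zero.mpr (Real.exp_pos _).ne')
  simp [Complex.cpow_eq_zero_iff, hx']

theorem eq_zero_of_pairing_expVec {m : ℂ} (hm : -1 < m.re) {e : L2}
    (h : ∀ s, 0 < s → pairing e (expVec m s) = 0) : e = 0 := by
  have h1 : ∀ s, 0 < s → ∫ x, e x * expFun m s x ∂hμ = 0 := fun s hs => by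
    rw [← pairing_toL2_right e (memLp_expFun hm hs)]
    exact h s hs
  have := ae_eq_zero_of_integral_expFun
    ((Lp.memLp e).integrable_mul (memLp_expFun hm one_pos)) h1
  exact (Lp.eq_zero_iff_ae_eq_zero).mpr this

theorem span_expVec_dense {m : ℂ} (hm : -1 < m.re) :
    (Submodule.span ℂ (range fun s : Ioi (0 : ℝ) => expVec m s)).topologicalClosure = ⊤ :=
  span_dense_of_pairing fun _ he => eq_zero_of_pairing_expVec hm fun s hs => he ⟨s, hs⟩

theorem eq_of_expVec {m : ℂ} (hm : -1 < m.re) {A B : L2 →L[ℂ] L2}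
    (h : ∀ s, 0 < s → A (expVec m s) = B (expVec m s)) : A = B := by
  refine ContinuousLinearMap.ext_on (s := range fun s : Ioi (0 : ℝ) => expVec m s) ?_ ?_
  · rw [dense_iff_closure_eq, ← Submodule.topologicalClosure_coe, span_expVec_dense hm,
      Submodule.top_coe]
  · rintro _ ⟨s, rfl⟩
    exact h s s.2

/-! ### Mellin transforms -/

theorem integrable_exp_comp_iff (G : ℝ → ℂ) :
    Integrable (fun t : ℝ => (Real.exp t : ℂ) * G (Real.exp t)) ↔ Integrable G hμ := by
  have := integrableOn_image_iff_integrableOn_abs_deriv_smul MeasurableSet.univ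
    (fun t _ => (Real.hasDerivAt_exp t).hasDerivWithinAt (s := univ)) Real.exp_injective.injOn G
  rw [image_univ, Real.range_exp, integrableOn_univ] at this
  rw [← IntegrableOn, this]
  simp_rw [abs_of_pos (Real.exp_pos _), Complex.real_smul]

theorem integral_exp_comp (G : ℝ → ℂ) :
    ∫ t : ℝ, (Real.exp t : ℂ) * G (Real.exp t) = ∫ x, G x ∂hμ := by
  have := integral_image_eq_integral_abs_deriv_smul MeasurableSet.univ
    (fun t _ => (Real.hasDerivAt_exp t).hasDerivWithinAt (s := univ)) Real.exp_injective.injOn G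
  rw [image_univ, Real.range_exp, Measure.restrict_univ] at this
  rw [this]
  simp_rw [abs_of_pos (Real.exp_pos _), Complex.real_smul]

/-- The function `e^{t/2} f(e^t)`. -/
def logFun (f : ℝ → ℂ) (t : ℝ) : ℂ := (Real.exp (t / 2) : ℂ) * f (Real.exp t)

theorem cpow_exp (t : ℝ) (w : ℂ) : ((Real.exp t : ℝ) : ℂ) ^ w = Complex.exp (t * w) := by
  rw [Complex.cpow_def_of_ne_zero (Complex.ofReal_ne_zero.mpr (Real.exp_pos t).ne'),
    ← Complex.ofReal_log (Real.exp_pos t).le, Real.log_exp]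

/-- The argument `(m + 1) / 2 - 2πiω` of the Gamma function in the Mellin transforms. -/
def mellinArg (m : ℂ) (ω : ℝ) : ℂ := (m + 1) / 2 - 2 * Real.pi * ω * Complex.I

theorem mellinArg_re (m : ℂ) (ω : ℝ) : (mellinArg m ω).re = (m.re + 1) / 2 := by
  simp [mellinArg]

theorem logFun_expFun (m : ℂ) (s ω t : ℝ) :
    Complex.exp (-(2 * Real.pi * ω * t) * Complex.I) * logFun (expFun m s) t
      = (Real.exp t : ℂ) * (((Real.exp t : ℝ) : ℂ) ^ (mellinArg m ω - 1) *
        (Real.exp (-(2 * s * Real.exp t)) : ℝ)) := by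
  simp only [logFun, expFun, cpow_exp]
  simp only [Complex.ofReal_exp, ← Complex.exp_add]
  congr 1
  rw [mellinArg]
  push_cast
  ring

theorem integrable_logFun_expFun {m : ℂ} {s : ℝ} (hm : -1 < m.re) (hs : 0 < s) :
    Integrable (logFun (expFun m s)) := by
  have h := (integrable_exp_comp_iff fun x : ℝ => (x : ℂ) ^ (mellinArg m 0 - 1) *
    (Real.exp (-(2 * s * x)) : ℝ)).mpr (integrable_cpow_exp (by
      rw [Complex.sub_re, mellinArg_re, Complex.one_re]
      linarith) (by linarith))
  refine h.congr (Eventually.of_forall fun t => ?_)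
  simp only
  rw [← logFun_expFun]
  simp

open FourierTransform in
theorem fourier_logFun_expFun {m : ℂ} {s : ℝ} (hm : -1 < m.re) (hs : 0 < s) (ω : ℝ) :
    𝓕 (logFun (expFun m s)) ω
      = ((2 * s : ℝ) : ℂ) ^ (-mellinArg m ω) * Complex.Gamma (mellinArg m ω) := by
  rw [Real.fourier_eq']
  have h1 := integral_cpow_exp (w := mellinArg m ω - 1) (c := 2 * s) (by
      rw [Complex.sub_re, mellinArg_re, Complex.one_re]
      linarith) (by linarith)
  rw [sub_add_cancel, ← integral_exp_comp] at h1
  rw [← h1]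
  refine integral_congr_ae (Eventually.of_forall fun t => ?_)
  simp only
  rw [← logFun_expFun, smul_eq_mul]
  congr 3
  simp only [RCLike.inner_apply, conj_trivial]
  push_cast
  ring

open FourierTransform in
theorem eLpNorm_fourier_logFun {f : ℝ → ℂ} (h1 : Integrable (logFun f)) (h2 : MemLp f 2 hμ) :
    eLpNorm (𝓕 (logFun f)) 2 volume = eLpNorm f 2 hμ := by
  have h3 : eLpNorm (logFun f) 2 volume = eLpNorm f 2 hμ := eLpNorm_exp_comp f
  rw [eLpNorm_fourier h1 ⟨h1.1, h3 ▸ h2.2⟩, h3]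


theorem logFun_sum {m : ℂ} {ι : Type*} (A : Finset ι) (c : ι → ℂ) (s : ι → ℝ) :
    (logFun fun x => ∑ i ∈ A, c i * expFun m (s i) x)
      = fun t => ∑ i ∈ A, c i * logFun (expFun m (s i)) t := by
  funext t
  simp only [logFun, Finset.mul_sum]
  refine Finset.sum_congr rfl fun i _ => by ring

theorem integrable_logFun_sum {m : ℂ} (hm : -1 < m.re) {ι : Type*} (A : Finset ι) (c : ι → ℂ)
    {s : ι → ℝ} (hs : ∀ i, 0 < s i) :
    Integrable (logFun fun x => ∑ i ∈ A, c i * expFun m (s i) x) := by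
  rw [logFun_sum]
  exact integrable_finsetSum A fun i _ => (integrable_logFun_expFun hm (hs i)).const_mul (c i)

open FourierTransform in
theorem fourier_logFun_sum {m : ℂ} (hm : -1 < m.re) {ι : Type*} (A : Finset ι) (c : ι → ℂ)
    {s : ι → ℝ} (hs : ∀ i, 0 < s i) (ω : ℝ) :
    𝓕 (logFun fun x => ∑ i ∈ A, c i * expFun m (s i) x) ω = ∑ i ∈ A,
      c i * (((2 * s i : ℝ) : ℂ) ^ (-mellinArg m ω) * Complex.Gamma (mellinArg m ω)) := by
  rw [logFun_sum]
  simp_rw [← fun i => fourier_logFun_expFun hm (hs i) ω, Real.fourier_eq', Finset.smul_sum]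
  rw [integral_finsetSum]
  · refine Finset.sum_congr rfl fun i _ => ?_
    rw [← integral_const_mul]
    refine integral_congr_ae (Eventually.of_forall fun t => ?_)
    simp only [smul_eq_mul]
    ring
  · intro i _
    refine ((integrable_logFun_expFun hm (hs i)).const_mul (c i)).bdd_mul (c := 1) (by fun_prop) ?_
    refine Eventually.of_forall fun t => ?_
    rw [Complex.norm_exp]
    simp

/-! ### The operator `Φ` with `Φ (x^{m/2} e^{-2sx}) = s^{-m-1} x^{m/2} e^{-2x/s}` -/

/-- For real `m` the arguments at `ω` and `-ω` are complex conjugate and the moduli agree. In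
general one argument and the conjugate of the other have the same real part, and their imaginary
parts differ by the constant `Im m`, so the Harnack inequality with `δ = Im m` applies. -/
theorem exists_norm_Gamma_mellinArg_le {m : ℂ} (hm : -1 < m.re) : ∃ C : ℝ, 0 ≤ C ∧ ∀ ω : ℝ,
    ‖Complex.Gamma (mellinArg m ω)‖ ≤ C * ‖Complex.Gamma (mellinArg m (-ω))‖ := by
  obtain ⟨C, hC0, hC⟩ := exists_norm_Gamma_le (σ := (m.re + 1) / 2) (by linarith) m.im
  refine ⟨C, hC0, fun ω => ?_⟩
  have h := hC (-(m.im / 2 + 2 * Real.pi * ω))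
  have e1 : (((m.re + 1) / 2 : ℝ) : ℂ) +
      ((-(m.im / 2 + 2 * Real.pi * ω) + m.im : ℝ) : ℂ) * Complex.I = mellinArg m ω := by
    apply Complex.ext <;> simp [mellinArg]
    ring
  have e2 : (((m.re + 1) / 2 : ℝ) : ℂ) + ((-(m.im / 2 + 2 * Real.pi * ω) : ℝ) : ℂ) * Complex.I
      = (starRingEnd ℂ) (mellinArg m (-ω)) := by
    apply Complex.ext
    · rw [Complex.conj_re, mellinArg_re]
      simp
    · rw [Complex.conj_im]
      simp [mellinArg]
  rw [e1, e2, Complex.Gamma_conj, Complex.norm_conj] at h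
  exact h

theorem mellinArg_neg (m : ℂ) (ω : ℝ) : mellinArg m (-ω) = m + 1 - mellinArg m ω := by
  simp only [mellinArg]
  push_cast
  ring

-- In the Mellin picture the map on exponentials is the reflection `ω ↦ -ω` followed by
-- multiplication by `Γ(a(ω)) / Γ(a(-ω))` and a power of `2` of modulus one, where `a(ω) = (m+1)/2 -
-- 2πiω`. The prefactor `s^{-m-1}` is the one for which this works, since `a(ω) + a(-ω) = m + 1`.
-- Plancherel then reduces the estimate to the pointwise bound on the Gamma quotient.
open FourierTransform in
theorem exists_eLpNorm_le {m : ℂ} (hm : -1 < m.re) : ∃ C : ℝ, 0 ≤ C ∧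
    ∀ (A : Finset (Ioi (0 : ℝ))) (c : Ioi (0 : ℝ) → ℂ),
      eLpNorm (fun x => ∑ i ∈ A, c i * (((i : ℝ) : ℂ) ^ (-(m + 1))) * expFun m (i : ℝ)⁻¹ x) 2 hμ ≤
      ENNReal.ofReal C * eLpNorm (fun x => ∑ i ∈ A, c i * expFun m i x) 2 hμ := by
  obtain ⟨C, hC0, hC⟩ := exists_norm_Gamma_mellinArg_le hm
  refine ⟨C, hC0, fun A c => ?_⟩
  have hp : ∀ i : Ioi (0 : ℝ), 0 < (i : ℝ) := fun i => i.2
  have hq : ∀ i : Ioi (0 : ℝ), 0 < (i : ℝ)⁻¹ := fun i => inv_pos.mpr (hp i)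
  rw [← eLpNorm_fourier_logFun (integrable_logFun_sum hm A _ hq)
      (memLp_finsetSum A fun i _ => (memLp_expFun hm (hq i)).const_mul _),
    ← eLpNorm_fourier_logFun (integrable_logFun_sum hm A c hp)
      (memLp_finsetSum A fun i _ => (memLp_expFun hm (hp i)).const_mul _)]
  set g := 𝓕 (logFun fun x => ∑ i ∈ A, c i * expFun m i x) with hg
  have hgm : AEStronglyMeasurable g volume :=
    (VectorFourier.fourierIntegral_continuous Real.continuous_fourierChar
      continuous_inner (integrable_logFun_sum hm A c hp)).aestronglyMeasurable
  -- The reflection of `ω` does not change the norm, and after it the two transforms can be compared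
  -- pointwise.
  rw [← eLpNorm_comp_measurePreserving hgm (Measure.measurePreserving_neg volume)]
  refine eLpNorm_le_mul_eLpNorm_of_ae_le_mul (Eventually.of_forall fun ω => ?_) 2
  rw [Function.comp_apply, hg, fourier_logFun_sum hm A c hp, fourier_logFun_sum hm A _ hq]
  have key : ∑ i ∈ A, c i * (((i : ℝ) : ℂ) ^ (-(m + 1))) *
      (((2 * (i : ℝ)⁻¹ : ℝ) : ℂ) ^ (-mellinArg m ω) * Complex.Gamma (mellinArg m ω))
      = (2 : ℂ) ^ (mellinArg m (-ω) - mellinArg m ω) * Complex.Gamma (mellinArg m ω) *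
        ∑ i ∈ A, c i * ((2 * (i : ℝ) : ℝ) : ℂ) ^ (-mellinArg m (-ω)) := by
    rw [Finset.mul_sum]
    refine Finset.sum_congr rfl fun i _ => ?_
    have hi : ((i : ℝ) : ℂ) ≠ 0 := Complex.ofReal_ne_zero.mpr (hp i).ne'
    have e1 : ((2 * (i : ℝ)⁻¹ : ℝ) : ℂ) ^ (-mellinArg m ω)
        = (2 : ℂ) ^ (-mellinArg m ω) * ((i : ℝ) : ℂ) ^ (mellinArg m ω) := by
      rw [Complex.ofReal_mul, Complex.mul_cpow_ofReal_nonneg zero_le_two (hq i).le,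
        Complex.ofReal_inv, Complex.inv_cpow _ _ (by
          rw [Complex.arg_ofReal_of_nonneg (hp i).le]; exact Real.pi_pos.ne),
        ← Complex.cpow_neg, neg_neg]
      norm_num
    have e2 : ((2 * (i : ℝ) : ℝ) : ℂ) ^ (-mellinArg m (-ω))
        = (2 : ℂ) ^ (-mellinArg m (-ω)) * ((i : ℝ) : ℂ) ^ (-(m + 1)) *
          ((i : ℝ) : ℂ) ^ (mellinArg m ω) := by
      rw [Complex.ofReal_mul, Complex.mul_cpow_ofReal_nonneg zero_le_two (hp i).le, mul_assoc,
        ← Complex.cpow_add _ _ hi]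
      congr 2
      rw [mellinArg_neg]
      ring
    have e3 : (2 : ℂ) ^ (mellinArg m (-ω) - mellinArg m ω) * (2 : ℂ) ^ (-mellinArg m (-ω))
        = (2 : ℂ) ^ (-mellinArg m ω) := by
      rw [← Complex.cpow_add _ _ two_ne_zero]
      congr 1
      ring
    rw [e1, e2, ← e3]
    ring
  have hnorm : ‖(2 : ℂ) ^ (mellinArg m (-ω) - mellinArg m ω)‖ = 1 := by
    have := Complex.norm_cpow_eq_rpow_re_of_pos two_pos (mellinArg m (-ω) - mellinArg m ω)
    rw [Complex.sub_re, mellinArg_re, mellinArg_re, sub_self, Real.rpow_zero] at this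
    exact_mod_cast this
  rw [key, norm_mul, norm_mul, hnorm, one_mul]
  simp_rw [← mul_assoc]
  rw [← Finset.sum_mul, norm_mul, mul_comm ‖∑ i ∈ A, _‖, ← mul_assoc]
  exact mul_le_mul_of_nonneg_right (hC ω) (norm_nonneg _)

theorem exists_norm_linearCombination_le {m : ℂ} (hm : -1 < m.re) : ∃ C : ℝ,
    ∀ c : Ioi (0 : ℝ) →₀ ℂ,
      ‖Finsupp.linearCombination ℂ
        (fun s : Ioi (0 : ℝ) => ((s : ℝ) : ℂ) ^ (-(m + 1)) • expVec m (s : ℝ)⁻¹) c‖ ≤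
      C * ‖Finsupp.linearCombination ℂ (fun s : Ioi (0 : ℝ) => expVec m s) c‖ := by
  obtain ⟨C, hC0, hC⟩ := exists_eLpNorm_le hm
  refine ⟨C, fun c => ?_⟩
  have hp : ∀ i : Ioi (0 : ℝ), 0 < (i : ℝ) := fun i => i.2
  have hq : ∀ i : Ioi (0 : ℝ), 0 < (i : ℝ)⁻¹ := fun i => inv_pos.mpr (hp i)
  have h1 := toL2_sum c.support c (f := fun i : Ioi (0 : ℝ) => expFun m i)
    fun i _ => memLp_expFun hm (hp i)
  have h2 := toL2_sum c.support (fun i => c i * (((i : ℝ) : ℂ) ^ (-(m + 1))))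
    (f := fun i : Ioi (0 : ℝ) => expFun m (i : ℝ)⁻¹) fun i _ => memLp_expFun hm (hq i)
  rw [Finsupp.linearCombination_apply, Finsupp.linearCombination_apply, Finsupp.sum, Finsupp.sum]
  simp_rw [smul_smul]
  change _ = ∑ i ∈ c.support, c i • expVec m i at h1
  change _ = ∑ i ∈ c.support, (c i * (((i : ℝ) : ℂ) ^ (-(m + 1)))) • expVec m (i : ℝ)⁻¹ at h2
  rw [← h1, ← h2, Lp.norm_def, Lp.norm_def]
  have m1 : MemLp (fun x => ∑ i ∈ c.support, c i * expFun m i x) 2 hμ :=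
    memLp_finsetSum _ fun i _ => (memLp_expFun hm (hp i)).const_mul _
  have m2 : MemLp (fun x => ∑ i ∈ c.support, c i * (((i : ℝ) : ℂ) ^ (-(m + 1))) *
      expFun m (i : ℝ)⁻¹ x) 2 hμ :=
    memLp_finsetSum _ fun i _ => (memLp_expFun hm (hq i)).const_mul _
  rw [eLpNorm_congr_ae (toL2_coe m1), eLpNorm_congr_ae (toL2_coe m2)]
  have := ENNReal.toReal_mono (ENNReal.mul_ne_top ENNReal.ofReal_ne_top m1.2.ne)
    (hC c.support c)
  rwa [ENNReal.toReal_mul, ENNReal.toReal_ofReal hC0] at this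

/-- The bounded operator with `Φ (x^{m/2} e^{-2sx}) = s^{-m-1} x^{m/2} e^{-2x/s}`: the Hankel
transformation after the change of variables `I`. -/
def opPhi (m : ℂ) : L2 →L[ℂ] L2 :=
  (Finsupp.linearCombination ℂ
    (fun s : Ioi (0 : ℝ) => ((s : ℝ) : ℂ) ^ (-(m + 1)) • expVec m (s : ℝ)⁻¹)).extendOfNorm
  (Finsupp.linearCombination ℂ (fun s : Ioi (0 : ℝ) => expVec m s))

theorem opPhi_expVec {m : ℂ} (hm : -1 < m.re) {s : ℝ} (hs : 0 < s) :
    opPhi m (expVec m s) = (s : ℂ) ^ (-(m + 1)) • expVec m s⁻¹ := by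
  have h := LinearMap.extendOfNorm_eq
    (f := Finsupp.linearCombination ℂ
      (fun s : Ioi (0 : ℝ) => ((s : ℝ) : ℂ) ^ (-(m + 1)) • expVec m (s : ℝ)⁻¹))
    (e := Finsupp.linearCombination ℂ (fun s : Ioi (0 : ℝ) => expVec m s))
    (by
      rw [DenseRange, dense_iff_closure_eq, ← LinearMap.coe_range, Finsupp.range_linearCombination,
        ← Submodule.topologicalClosure_coe, span_expVec_dense hm, Submodule.top_coe])
    (exists_norm_linearCombination_le hm) (Finsupp.single ⟨s, hs⟩ 1)
  rw [Finsupp.linearCombination_single, Finsupp.linearCombination_single, one_smul, one_smul] at h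
  exact h

theorem opPhi_opPhi {m : ℂ} (hm : -1 < m.re) (f : L2) : opPhi m (opPhi m f) = f := by
  have : (opPhi m).comp (opPhi m) = ContinuousLinearMap.id ℂ L2 := by
    refine eq_of_expVec hm fun s hs => ?_
    rw [ContinuousLinearMap.comp_apply, opPhi_expVec hm hs, map_smul,
      opPhi_expVec hm (inv_pos.mpr hs), smul_smul, inv_inv, ContinuousLinearMap.id_apply,
      Complex.ofReal_inv, Complex.inv_cpow _ _ (by
        rw [Complex.arg_ofReal_of_nonneg hs.le]; exact Real.pi_pos.ne), mul_inv_cancel₀, one_smul]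
    simp [Complex.cpow_eq_zero_iff, hs.ne']
  exact congrArg (fun A => A f) this

/-- A bounded operator which is symmetric on a total set is symmetric. -/
theorem pairing_symm_of_expVec {m : ℂ} (hm : -1 < m.re) {A : L2 →L[ℂ] L2}
    (h : ∀ s t, 0 < s → 0 < t →
      pairing (A (expVec m s)) (expVec m t) = pairing (expVec m s) (A (expVec m t))) (f g : L2) :
    pairing (A f) g = pairing f (A g) := by
  have hd : closure (Submodule.span ℂ (range fun s : Ioi (0 : ℝ) => expVec m s) : Set L2) = univ := by
    rw [← Submodule.topologicalClosure_coe, span_expVec_dense hm, Submodule.top_coe]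
  have h1 : ∀ s, 0 < s → ∀ g, pairing (A (expVec m s)) g = pairing (expVec m s) (A g) := by
    intro s hs g
    have : pairing (A (expVec m s)) = (pairing (expVec m s)).comp A := by
      refine ContinuousLinearMap.ext_on (s := range fun s : Ioi (0 : ℝ) => expVec m s)
        (dense_iff_closure_eq.mpr hd) ?_
      rintro _ ⟨t, rfl⟩
      exact h s t hs t.2
    exact congrArg (fun B => B g) this
  have : (pairing g).comp A = pairing (A g) := by
    refine ContinuousLinearMap.ext_on (s := range fun s : Ioi (0 : ℝ) => expVec m s)
      (dense_iff_closure_eq.mpr hd) ?_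
    rintro _ ⟨t, rfl⟩
    change pairing g (A (expVec m t)) = _
    rw [pairing_comm, h1 t t.2, pairing_comm]
  rw [pairing_comm, pairing_comm f]
  exact congrArg (fun B => B f) this

/-- On exponentials both sides depend only on `s (1/s + t) = 1 + st = t (s + 1/t)`. -/
theorem opPhi_symm {m : ℂ} (hm : -1 < m.re) (f g : L2) :
    pairing (opPhi m f) g = pairing f (opPhi m g) := by
  refine pairing_symm_of_expVec hm (fun s t hs ht => ?_) f g
  rw [opPhi_expVec hm hs, opPhi_expVec hm ht, pairing_smul_left, map_smul, smul_eq_mul,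
    pairing_expVec hm (inv_pos.mpr hs) ht, pairing_expVec hm hs (inv_pos.mpr ht), ← mul_assoc,
    ← mul_assoc, ← Complex.mul_cpow_ofReal_nonneg hs.le (by positivity),
    ← Complex.mul_cpow_ofReal_nonneg ht.le (by positivity), ← Complex.ofReal_mul,
    ← Complex.ofReal_mul]
  congr 3
  have h1 := mul_inv_cancel₀ hs.ne'
  have h2 := mul_inv_cancel₀ ht.ne'
  linear_combination 2 * h1 - 2 * h2

theorem pairing_opPhi_opPhi {m : ℂ} (hm : -1 < m.re) (f g : L2) :
    pairing (opPhi m f) (opPhi m g) = pairing f g := by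
  rw [opPhi_symm hm, opPhi_opPhi hm]

/-! ### Integrals under the change of variables `I` -/

theorem IsChange.integral {φ φ' w : ℝ → ℝ} (h : IsChange φ φ' w) (g : ℝ → ℂ) :
    ∫ x, (φ' x : ℂ) * g (φ x) ∂hμ = ∫ x, g x ∂hμ := by
  have := integral_image_eq_integral_abs_deriv_smul measurableSet_Ioi h.deriv h.inj g
  rw [h.image] at this
  rw [this]
  refine setIntegral_congr_fun measurableSet_Ioi fun x hx => ?_
  simp only [abs_of_pos (h.pos x hx), Complex.real_smul]

theorem IsChange.integrable {φ φ' w : ℝ → ℝ} (h : IsChange φ φ' w) {g : ℝ → ℂ}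
    (hg : Integrable g hμ) : Integrable (fun x => (φ' x : ℂ) * g (φ x)) hμ := by
  have := integrableOn_image_iff_integrableOn_abs_deriv_smul measurableSet_Ioi h.deriv h.inj g
  rw [h.image] at this
  refine IntegrableOn.congr_fun (this.mp hg) (fun x hx => ?_) measurableSet_Ioi
  simp only [abs_of_pos (h.pos x hx), Complex.real_smul]

theorem IsChange.pairing_isometry {φ φ' w : ℝ → ℝ} (h : IsChange φ φ' w) (f g : L2) :
    pairing (h.isometry f) (h.isometry g) = pairing f g := by
  rw [pairing_apply, pairing_apply, ← h.integral fun x => f x * g x]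
  refine integral_congr_ae ?_
  filter_upwards [h.isometry_coe f, h.isometry_coe g, ae_restrict_mem measurableSet_Ioi]
    with x h1 h2 hx
  rw [h1, h2, ← h.sq x hx]
  push_cast
  ring

theorem pairing_unitaryI (f g : L2) : pairing (unitaryI f) (unitaryI g) = pairing f g :=
  isChange_I.pairing_isometry f g

/-! ### Gaussians -/

/-- The function `x^{m+1/2} e^{-s x² / 2}`. -/
def gaussFun (m : ℂ) (s : ℝ) (x : ℝ) : ℂ :=
  (x : ℂ) ^ (m + 1 / 2) * (Real.exp (-(s * x ^ 2 / 2)) : ℝ)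

/-- The vector `x^{m+1/2} e^{-s x² / 2}` of `L²[0,∞[`. -/
def gaussVec (m : ℂ) (s : ℝ) : L2 := toL2 (gaussFun m s)

theorem measurable_gaussFun (m : ℂ) (s : ℝ) : Measurable (gaussFun m s) :=
  (Complex.measurable_ofReal.pow_const _).mul (by fun_prop)

theorem sq_div_cpow {y : ℝ} (hy : 0 < y) (w : ℂ) :
    ((y ^ 2 / 4 : ℝ) : ℂ) ^ w = (2 : ℂ) ^ (-(2 * w)) * (y : ℂ) ^ (2 * w) := by
  have h1 : ((y ^ 2 / 4 : ℝ) : ℂ) = ((y / 2 : ℝ) : ℂ) ^ (2 : ℕ) := by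
    push_cast
    ring
  have h2 : ((y / 2 : ℝ) : ℂ) ^ (2 * w) = (((y / 2 : ℝ) : ℂ) ^ (2 : ℕ)) ^ w := by
    have h3 := Complex.cpow_nat_mul' (x := ((y / 2 : ℝ) : ℂ)) (n := 2)
      (by rw [Complex.arg_ofReal_of_nonneg (by positivity)]; simp [Real.pi_pos])
      (by rw [Complex.arg_ofReal_of_nonneg (by positivity)]; simp [Real.pi_pos.le]) w
    exact_mod_cast h3
  rw [h1, ← h2, div_eq_mul_inv, Complex.ofReal_mul,
    Complex.mul_cpow_ofReal_nonneg hy.le (by norm_num), Complex.ofReal_inv,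
    Complex.inv_cpow _ _ (by
      rw [Complex.arg_ofReal_of_nonneg zero_le_two]; exact Real.pi_pos.ne), ← Complex.cpow_neg,
    mul_comm]
  norm_num

theorem unitaryI_symm_expFun {m : ℂ} {s y : ℝ} (hy : 0 < y) :
    (((y / 2) ^ (1 / 2 : ℝ) : ℝ) : ℂ) * expFun m s (y ^ 2 / 4)
      = (2 : ℂ) ^ (-(m + 1 / 2)) * gaussFun m s y := by
  have hy' : (y : ℂ) ≠ 0 := Complex.ofReal_ne_zero.mpr hy.ne'
  rw [expFun, sq_div_cpow hy, gaussFun, Complex.ofReal_cpow (by positivity), div_eq_mul_inv,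
    Complex.ofReal_mul, Complex.mul_cpow_ofReal_nonneg hy.le (by norm_num), Complex.ofReal_inv,
    Complex.inv_cpow _ _ (by
      rw [Complex.arg_ofReal_of_nonneg zero_le_two]; exact Real.pi_pos.ne), ← Complex.cpow_neg,
    Complex.cpow_add _ _ hy', neg_add, Complex.cpow_add _ _ two_ne_zero,
    show 2 * (m / 2) = m by ring, show 2 * s * (y ^ 2 / 4) = s * y ^ 2 / 2 by ring]
  push_cast
  ring

theorem unitaryI_symm_expVec {m : ℂ} {s : ℝ} (hm : -1 < m.re) (hs : 0 < s) :
    unitaryI.symm (expVec m s) =ᵐ[hμ] fun y => (2 : ℂ) ^ (-(m + 1 / 2)) * gaussFun m s y := by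
  filter_upwards [unitaryI_symm_coe (expVec m s), isChange_I_inv.quasi.ae (expVec_coe hm hs),
    ae_restrict_mem measurableSet_Ioi] with y h1 h2 hy
  rw [h1, h2, unitaryI_symm_expFun hy]

theorem two_cpow_mul_neg (w : ℂ) : (2 : ℂ) ^ w * (2 : ℂ) ^ (-w) = 1 := by
  rw [← Complex.cpow_add _ _ two_ne_zero, add_neg_cancel, Complex.cpow_zero]

theorem memLp_gaussFun {m : ℂ} {s : ℝ} (hm : -1 < m.re) (hs : 0 < s) :
    MemLp (gaussFun m s) 2 hμ := by
  have h1 := (memLp_congr_ae (unitaryI_symm_expVec hm hs)).mp (Lp.memLp _)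
  refine (h1.const_mul ((2 : ℂ) ^ (m + 1 / 2))).congr_norm
    (measurable_gaussFun m s).aestronglyMeasurable (Eventually.of_forall fun x => ?_)
  rw [← mul_assoc, two_cpow_mul_neg, one_mul]

theorem unitaryI_gaussVec {m : ℂ} {s : ℝ} (hm : -1 < m.re) (hs : 0 < s) :
    unitaryI (gaussVec m s) = (2 : ℂ) ^ (m + 1 / 2) • expVec m s := by
  have h : unitaryI.symm (expVec m s) = (2 : ℂ) ^ (-(m + 1 / 2)) • gaussVec m s := by
    rw [gaussVec, ← toL2_smul _ (memLp_gaussFun hm hs)]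
    exact eq_toL2 (unitaryI_symm_expVec hm hs)
  have h2 := congrArg unitaryI h
  rw [LinearIsometryEquiv.apply_symm_apply, map_smul] at h2
  rw [h2, smul_smul, two_cpow_mul_neg, one_smul]

theorem two_mul_ofReal_cpow {s : ℝ} (hs : 0 < s) (w : ℂ) :
    ((2 * s : ℝ) : ℂ) ^ w = (2 : ℂ) ^ w * (s : ℂ) ^ w := by
  rw [Complex.ofReal_mul, Complex.mul_cpow_ofReal_nonneg zero_le_two hs.le]
  norm_num

theorem gauss_change {w : ℂ} {s y : ℝ} (hy : 0 < y) :
    ((y / 2 : ℝ) : ℂ) * (((y ^ 2 / 4 : ℝ) : ℂ) ^ w * (Real.exp (-(2 * s * (y ^ 2 / 4))) : ℝ))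
      = (2 : ℂ) ^ (-(2 * w + 1)) * ((y : ℂ) ^ (2 * w + 1) * (Real.exp (-(s * y ^ 2 / 2)) : ℝ)) := by
  have hy' : (y : ℂ) ≠ 0 := Complex.ofReal_ne_zero.mpr hy.ne'
  rw [sq_div_cpow hy, Complex.cpow_add _ _ hy', Complex.cpow_one, neg_add,
    Complex.cpow_add _ _ two_ne_zero, Complex.cpow_neg_one,
    show 2 * s * (y ^ 2 / 4) = s * y ^ 2 / 2 by ring]
  push_cast
  ring

theorem integrable_gauss {w : ℂ} {s : ℝ} (hw : -1 < w.re) (hs : 0 < s) :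
    Integrable (fun y : ℝ => (y : ℂ) ^ (2 * w + 1) * (Real.exp (-(s * y ^ 2 / 2)) : ℝ)) hμ := by
  have h := (isChange_I_inv.integrable
    (integrable_cpow_exp hw (c := 2 * s) (by linarith))).const_mul ((2 : ℂ) ^ (2 * w + 1))
  refine h.congr ?_
  filter_upwards [ae_restrict_mem measurableSet_Ioi] with y hy
  rw [gauss_change hy, ← mul_assoc, two_cpow_mul_neg, one_mul]

theorem integral_gauss {w : ℂ} {s : ℝ} (hw : -1 < w.re) (hs : 0 < s) :
    ∫ y, (y : ℂ) ^ (2 * w + 1) * (Real.exp (-(s * y ^ 2 / 2)) : ℝ) ∂hμ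
      = (2 : ℂ) ^ w * (s : ℂ) ^ (-(w + 1)) * Complex.Gamma (w + 1) := by
  have h := integral_cpow_exp hw (c := 2 * s) (by linarith)
  rw [← isChange_I_inv.integral] at h
  have h2 : ∫ y, (y : ℂ) ^ (2 * w + 1) * (Real.exp (-(s * y ^ 2 / 2)) : ℝ) ∂hμ
      = (2 : ℂ) ^ (2 * w + 1) * ∫ y, ((y / 2 : ℝ) : ℂ) * (((y ^ 2 / 4 : ℝ) : ℂ) ^ w *
        (Real.exp (-(2 * s * (y ^ 2 / 4))) : ℝ)) ∂hμ := by
    rw [← integral_const_mul]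
    refine setIntegral_congr_fun measurableSet_Ioi fun y hy => ?_
    rw [gauss_change hy, ← mul_assoc, two_cpow_mul_neg, one_mul]
  rw [h2, h, two_mul_ofReal_cpow hs, show (2 : ℂ) ^ w = (2 : ℂ) ^ (2 * w + 1) * 2 ^ (-(w + 1)) by
    rw [← Complex.cpow_add _ _ two_ne_zero]; congr 1; ring]
  ring

/-! ### The operator `I⁻¹ Φ I` -/

/-- The Hankel transformation. -/
def hankelCLM (m : ℂ) : L2 →L[ℂ] L2 :=
  (unitaryI.symm.toContinuousLinearEquiv : L2 →L[ℂ] L2) ∘L (opPhi m) ∘L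
    (unitaryI.toContinuousLinearEquiv : L2 →L[ℂ] L2)

theorem hankelCLM_apply (m : ℂ) (f : L2) :
    hankelCLM m f = unitaryI.symm (opPhi m (unitaryI f)) := rfl

theorem unitaryI_hankelCLM (m : ℂ) (f : L2) :
    unitaryI (hankelCLM m f) = opPhi m (unitaryI f) := by
  rw [hankelCLM_apply, LinearIsometryEquiv.apply_symm_apply]

theorem hankelCLM_hankelCLM {m : ℂ} (hm : -1 < m.re) (f : L2) :
    hankelCLM m (hankelCLM m f) = f := by
  rw [hankelCLM_apply, unitaryI_hankelCLM, opPhi_opPhi hm, LinearIsometryEquiv.symm_apply_apply]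

theorem hankelCLM_symm {m : ℂ} (hm : -1 < m.re) (f g : L2) :
    pairing (hankelCLM m f) g = pairing f (hankelCLM m g) := by
  rw [← pairing_unitaryI, unitaryI_hankelCLM, opPhi_symm hm, ← unitaryI_hankelCLM,
    pairing_unitaryI]

/-- Gaussians are exchanged with Gaussians of inverse width. Together with totality, this explicit
action is what identifies the operator with the Bessel integral and what diagonalizes the Bessel
operator. -/
theorem hankelCLM_gaussVec {m : ℂ} (hm : -1 < m.re) {s : ℝ} (hs : 0 < s) :
    hankelCLM m (gaussVec m s) = (s : ℂ) ^ (-(m + 1)) • gaussVec m s⁻¹ := by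
  apply unitaryI.injective
  rw [unitaryI_hankelCLM, unitaryI_gaussVec hm hs, map_smul, opPhi_expVec hm hs, map_smul,
    unitaryI_gaussVec hm (inv_pos.mpr hs), smul_comm]

/-- The Hankel transformation as an invertible operator. -/
def hankelEquiv (m : ℂ) (hm : -1 < m.re) : L2 ≃L[ℂ] L2 :=
  ContinuousLinearEquiv.equivOfInverse (hankelCLM m) (hankelCLM m) (hankelCLM_hankelCLM hm)
    (hankelCLM_hankelCLM hm)

/-! ### The Bessel kernel -/

/-- The coefficients of the power series of the Bessel function. -/
def besselCoeff (m : ℂ) (n : ℕ) : ℂ := (-1) ^ n / ((n.factorial : ℂ) * Complex.Gamma (m + n + 1))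

/-- Each use of `Γ(w + 1) = w Γ(w)` divides by a number of modulus at least `Re m + 1`. This loses
one of the two factorials in the decay, but the resulting growth `e^{D u²/4}` of the kernel can
still be absorbed by a Gaussian. -/
theorem exists_norm_besselCoeff_le {m : ℂ} (hm : -1 < m.re) :
    ∃ C D : ℝ, 0 ≤ C ∧ 0 < D ∧ ∀ n, ‖besselCoeff m n‖ ≤ C * (D ^ n / n.factorial) := by
  have ha : 0 < m.re + 1 := by linarith
  refine ⟨‖(Complex.Gamma (m + 1))⁻¹‖, (m.re + 1)⁻¹, norm_nonneg _, inv_pos.mpr ha, fun n => ?_⟩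
  have h : ∀ n : ℕ, ‖(Complex.Gamma (m + n + 1))⁻¹‖ ≤
      ‖(Complex.Gamma (m + 1))⁻¹‖ * ((m.re + 1)⁻¹) ^ n := by
    intro n
    induction n with
    | zero => simp
    | succ n ih =>
      have hre : m.re + 1 ≤ (m + n + 1).re := by simp
      have hne : m + n + 1 ≠ 0 := fun h0 => by
        rw [h0, Complex.zero_re] at hre
        linarith
      have e : m + (n + 1 : ℕ) + 1 = (m + n + 1) + 1 := by push_cast; ring
      rw [e, Complex.Gamma_add_one _ hne, mul_inv, norm_mul, pow_succ, ← mul_assoc, mul_comm]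
      refine mul_le_mul ih ?_ (norm_nonneg _) (by positivity)
      rw [norm_inv]
      exact inv_anti₀ ha (hre.trans (Complex.re_le_norm _))
  rw [besselCoeff, norm_div, norm_pow, norm_neg, norm_one, one_pow, norm_mul,
    Complex.norm_natCast, one_div, mul_inv, ← norm_inv]
  calc _ ≤ (n.factorial : ℝ)⁻¹ * (‖(Complex.Gamma (m + 1))⁻¹‖ * ((m.re + 1)⁻¹) ^ n) :=
        mul_le_mul_of_nonneg_left (h n) (by positivity)
    _ = _ := by rw [div_eq_mul_inv]; ring

/-- The terms of the series for `J_m(u) √u`. -/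
def besselTerm (m : ℂ) (n : ℕ) (u : ℝ) : ℂ :=
  ((u / 2 : ℝ) : ℂ) ^ m * (besselCoeff m n * ((u / 2 : ℝ) : ℂ) ^ (2 * n)) * (Real.sqrt u : ℂ)

theorem measurable_besselTerm (m : ℂ) (n : ℕ) : Measurable (besselTerm m n) := by
  unfold besselTerm
  refine Measurable.mul (Measurable.mul ?_ (by fun_prop)) (by fun_prop)
  exact (Complex.measurable_ofReal.comp (measurable_id.div_const 2)).pow_const _

theorem norm_besselTerm_le {m : ℂ} {C D : ℝ}
    (h : ∀ n, ‖besselCoeff m n‖ ≤ C * (D ^ n / n.factorial)) {u : ℝ} (hu : 0 < u) (n : ℕ) :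
    ‖besselTerm m n u‖ ≤
      C * (u / 2) ^ m.re * Real.sqrt u * ((D * u ^ 2 / 4) ^ n / n.factorial) := by
  have hu2 : 0 < u / 2 := half_pos hu
  rw [besselTerm, norm_mul, norm_mul, norm_mul, Complex.norm_cpow_eq_rpow_re_of_pos hu2, norm_pow,
    Complex.norm_real, Complex.norm_real, Real.norm_eq_abs, Real.norm_eq_abs, abs_of_pos hu2,
    abs_of_nonneg (Real.sqrt_nonneg u)]
  calc _ ≤ (u / 2) ^ m.re * (C * (D ^ n / n.factorial) * (u / 2) ^ (2 * n)) * Real.sqrt u := by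
        have := h n
        have : 0 ≤ (u / 2) ^ m.re := (Real.rpow_pos_of_pos hu2 _).le
        gcongr
    _ = _ := by
        rw [pow_mul, show D * u ^ 2 / 4 = D * (u / 2) ^ 2 by ring, mul_pow]
        ring

theorem summable_exp_series (y : ℝ) : HasSum (fun n : ℕ => y ^ n / n.factorial) (Real.exp y) := by
  rw [Real.exp_eq_exp_ℝ]
  exact NormedSpace.expSeries_div_hasSum_exp y

theorem hasSum_besselTerm {m : ℂ} (hm : -1 < m.re) {u : ℝ} (hu : 0 < u) :
    HasSum (fun n => besselTerm m n u) (besselJ m u * (Real.sqrt u : ℂ)) := by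
  obtain ⟨C, D, -, -, h⟩ := exists_norm_besselCoeff_le hm
  have hs : Summable fun n => besselTerm m n u :=
    Summable.of_norm_bounded ((summable_exp_series _).summable.mul_left _)
      (norm_besselTerm_le h hu)
  convert hs.hasSum using 1
  unfold besselTerm besselJ
  rw [tsum_mul_right, tsum_mul_left]
  rfl

theorem norm_besselJ_le {m : ℂ} (hm : -1 < m.re) {C D : ℝ}
    (h : ∀ n, ‖besselCoeff m n‖ ≤ C * (D ^ n / n.factorial)) {u : ℝ} (hu : 0 < u) :
    ‖besselJ m u * (Real.sqrt u : ℂ)‖ ≤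
      C * (u / 2) ^ m.re * Real.sqrt u * Real.exp (D * u ^ 2 / 4) := by
  rw [← (hasSum_besselTerm hm hu).tsum_eq]
  exact tsum_of_norm_bounded ((summable_exp_series _).mul_left _) (norm_besselTerm_le h hu)

/-! ### Gaussian integrals of the Bessel kernel. -/

theorem norm_gaussFun (m : ℂ) (s : ℝ) {x : ℝ} (hx : 0 < x) :
    ‖gaussFun m s x‖ = x ^ (m.re + 1 / 2) * Real.exp (-(s * x ^ 2 / 2)) := by
  rw [gaussFun, norm_mul, Complex.norm_cpow_eq_rpow_re_of_pos hx, Complex.norm_real,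
    Real.norm_eq_abs, abs_of_pos (Real.exp_pos _)]
  norm_num

/-- For `x ≤ R` the growth `e^{D (kx)²/4}` of the kernel bound is beaten by `e^{-s k²/2}` once `s ≥
D R²/2 + 1`, and `e^{-k²/2}` is left over as an integrable majorant independent of `s`. -/
theorem kernel_bound {C D : ℝ} (a : ℝ) (hC : 0 ≤ C) (hD : 0 < D) {R s k x : ℝ}
    (hk : 0 < k) (hx : 0 < x) (hxR : x ≤ R) (hs : D * R ^ 2 / 2 + 1 ≤ s) :
    C * (k * x / 2) ^ a * Real.sqrt (k * x) * Real.exp (D * (k * x) ^ 2 / 4) *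
      (k ^ (a + 1 / 2) * Real.exp (-(s * k ^ 2 / 2))) ≤
    C * 2 ^ (-a) * x ^ (a + 1 / 2) * (k ^ (2 * a + 1) * Real.exp (-(k ^ 2 / 2))) := by
  have e1 : (k * x / 2) ^ a = k ^ a * x ^ a * 2 ^ (-a) := by
    rw [div_eq_mul_inv, Real.mul_rpow (by positivity) (by norm_num), Real.mul_rpow hk.le hx.le,
      Real.inv_rpow zero_le_two, Real.rpow_neg zero_le_two]
  have e2 : Real.sqrt (k * x) = k ^ (1 / 2 : ℝ) * x ^ (1 / 2 : ℝ) := by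
    rw [Real.sqrt_eq_rpow, Real.mul_rpow hk.le hx.le]
  have e3 : k ^ (2 * a + 1) = k ^ a * k ^ (1 / 2 : ℝ) * k ^ (a + 1 / 2) := by
    rw [← Real.rpow_add hk, ← Real.rpow_add hk]
    congr 1
    ring
  have e4 : Real.exp (D * (k * x) ^ 2 / 4) * Real.exp (-(s * k ^ 2 / 2)) ≤
      Real.exp (-(k ^ 2 / 2)) := by
    rw [← Real.exp_add, Real.exp_le_exp]
    have h1 : x ^ 2 ≤ R ^ 2 := pow_le_pow_left₀ hx.le hxR 2
    have h2 : D * x ^ 2 ≤ D * R ^ 2 := mul_le_mul_of_nonneg_left h1 hD.le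
    have h3 : 0 ≤ R ^ 2 * D := by positivity
    have h4 : (D * x ^ 2 / 2 + 1) * k ^ 2 ≤ s * k ^ 2 :=
      mul_le_mul_of_nonneg_right (by linarith) (sq_nonneg k)
    have h5 : 0 ≤ D * x ^ 2 * k ^ 2 := by positivity
    nlinarith
  rw [e1, e2, e3, Real.rpow_add hx]
  calc _ = C * 2 ^ (-a) * (x ^ a * x ^ (1 / 2 : ℝ)) *
        (k ^ a * k ^ (1 / 2 : ℝ) * k ^ (a + 1 / 2)) *
        (Real.exp (D * (k * x) ^ 2 / 4) * Real.exp (-(s * k ^ 2 / 2))) := by ring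
    _ ≤ C * 2 ^ (-a) * (x ^ a * x ^ (1 / 2 : ℝ)) *
        (k ^ a * k ^ (1 / 2 : ℝ) * k ^ (a + 1 / 2)) * Real.exp (-(k ^ 2 / 2)) :=
      mul_le_mul_of_nonneg_left e4 (by positivity)
    _ = _ := by ring

theorem integrable_rpow_gauss {a : ℝ} (ha : -1 < a) :
    Integrable (fun k : ℝ => k ^ (2 * a + 1) * Real.exp (-(k ^ 2 / 2))) hμ := by
  have := integrableOn_rpow_mul_exp_neg_mul_sq (b := 1 / 2) (by norm_num) (s := 2 * a + 1)
    (by linarith)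
  refine IntegrableOn.congr_fun this (fun x _ => ?_) measurableSet_Ioi
  congr 2
  ring

theorem besselTerm_mul_gaussFun (m : ℂ) (n : ℕ) (s : ℝ) {k x : ℝ} (hk : 0 < k) (hx : 0 < x) :
    besselTerm m n (k * x) * gaussFun m s k
      = besselCoeff m n * (2 : ℂ) ^ (-m) * (1 / 4 : ℂ) ^ n * (x : ℂ) ^ (m + 1 / 2) *
        (x : ℂ) ^ (2 * n) *
        ((k : ℂ) ^ (2 * (m + n) + 1) * (Real.exp (-(s * k ^ 2 / 2)) : ℝ)) := by
  have hk' : (k : ℂ) ≠ 0 := Complex.ofReal_ne_zero.mpr hk.ne'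
  have hx' : (x : ℂ) ≠ 0 := Complex.ofReal_ne_zero.mpr hx.ne'
  have e1 : ((k * x / 2 : ℝ) : ℂ) ^ m = (k : ℂ) ^ m * (x : ℂ) ^ m * (2 : ℂ) ^ (-m) := by
    rw [div_eq_mul_inv, Complex.ofReal_mul, Complex.mul_cpow_ofReal_nonneg (by positivity)
      (by norm_num), Complex.ofReal_mul, Complex.mul_cpow_ofReal_nonneg hk.le hx.le,
      Complex.ofReal_inv, Complex.inv_cpow _ _ (by
      rw [Complex.arg_ofReal_of_nonneg zero_le_two]; exact Real.pi_pos.ne), ← Complex.cpow_neg]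
    norm_num
  have e2 : (Real.sqrt (k * x) : ℂ) = (k : ℂ) ^ (1 / 2 : ℂ) * (x : ℂ) ^ (1 / 2 : ℂ) := by
    rw [Real.sqrt_eq_rpow, Real.mul_rpow hk.le hx.le, Complex.ofReal_mul,
      Complex.ofReal_cpow hk.le, Complex.ofReal_cpow hx.le]
    norm_num
  have e3 : (k : ℂ) ^ (2 * (m + n) + 1)
      = (k : ℂ) ^ m * (k : ℂ) ^ (1 / 2 : ℂ) * (k : ℂ) ^ (m + 1 / 2) * (k : ℂ) ^ (2 * n) := by
    rw [← Complex.cpow_add _ _ hk', ← Complex.cpow_add _ _ hk', ← Complex.cpow_natCast,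
      ← Complex.cpow_add _ _ hk']
    congr 1
    push_cast
    ring
  have e4 : ((k * x / 2 : ℝ) : ℂ) ^ (2 * n) = (1 / 4 : ℂ) ^ n * (k : ℂ) ^ (2 * n) *
      (x : ℂ) ^ (2 * n) := by
    rw [pow_mul, pow_mul, pow_mul, ← mul_pow, ← mul_pow]
    congr 1
    push_cast
    ring
  rw [besselTerm, gaussFun, e1, e2, e3, e4, Complex.cpow_add _ _ hx']
  ring

/-- The Gaussian moment produces exactly the factor `Γ(m + n + 1)` in the denominator of the Bessel
coefficient. What remains is the general term of the exponential series of `-x²/(2s)`. -/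
theorem integral_besselTerm_mul_gaussFun {m : ℂ} (hm : -1 < m.re) (n : ℕ) {s x : ℝ} (hs : 0 < s)
    (hx : 0 < x) :
    ∫ k, besselTerm m n (k * x) * gaussFun m s k ∂hμ
      = (s : ℂ) ^ (-(m + 1)) * (x : ℂ) ^ (m + 1 / 2) *
        ((-(s⁻¹ * x ^ 2 / 2 : ℝ) : ℂ) ^ n / (n.factorial : ℂ)) := by
  have hre : -1 < (m + n).re := by
    have : (0 : ℝ) ≤ n := n.cast_nonneg
    simp only [Complex.add_re, Complex.natCast_re]
    linarith
  have hG : Complex.Gamma (m + n + 1) ≠ 0 := Complex.Gamma_ne_zero_of_re_pos (by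
    rw [Complex.add_re, Complex.one_re]; linarith)
  have hs' : (s : ℂ) ≠ 0 := Complex.ofReal_ne_zero.mpr hs.ne'
  have h1 : ∫ k, besselTerm m n (k * x) * gaussFun m s k ∂hμ
      = ∫ k, besselCoeff m n * (2 : ℂ) ^ (-m) * (1 / 4 : ℂ) ^ n * (x : ℂ) ^ (m + 1 / 2) *
        (x : ℂ) ^ (2 * n) *
        ((k : ℂ) ^ (2 * (m + n) + 1) * (Real.exp (-(s * k ^ 2 / 2)) : ℝ)) ∂hμ :=
    setIntegral_congr_fun measurableSet_Ioi fun k hk => besselTerm_mul_gaussFun m n s hk hx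
  rw [h1, integral_const_mul, integral_gauss hre hs, besselCoeff, Complex.cpow_add _ _ two_ne_zero,
    show -(m + n + 1) = -(m + 1) + -(n : ℂ) by ring, Complex.cpow_add _ _ hs',
    Complex.cpow_neg _ (n : ℂ), Complex.cpow_natCast, Complex.cpow_natCast]
  have h2 : (-(s⁻¹ * x ^ 2 / 2 : ℝ) : ℂ) ^ n
      = (-1) ^ n * (1 / 4 : ℂ) ^ n * 2 ^ n * ((s : ℂ) ^ n)⁻¹ * (x : ℂ) ^ (2 * n) := by
    rw [← inv_pow, pow_mul, ← mul_pow, ← mul_pow, ← mul_pow, ← mul_pow]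
    congr 1
    push_cast
    ring
  rw [h2]
  have h3 := two_cpow_mul_neg m
  have h4 : (-1) ^ n / ((n.factorial : ℂ) * Complex.Gamma (m + n + 1)) * Complex.Gamma (m + n + 1)
      = (-1) ^ n / (n.factorial : ℂ) := by
    rw [div_mul_eq_mul_div, mul_div_mul_right _ _ hG]
  set S := (s : ℂ) ^ (-(m + 1))
  set X := (x : ℂ) ^ (m + 1 / 2)
  linear_combination (2 ^ (-m) * (1 / 4) ^ n * X * (x : ℂ) ^ (2 * n) * 2 ^ m * 2 ^ n * S *
    ((s : ℂ) ^ n)⁻¹) * h4 + ((-1) ^ n / (n.factorial : ℂ) * (1 / 4) ^ n * X *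
    (x : ℂ) ^ (2 * n) * 2 ^ n * S * ((s : ℂ) ^ n)⁻¹) * h3

/-- Only narrow Gaussians are treated: for `x ≤ R` and `s` large the kernel bound justifies
summation under the integral, and the terms add up to an exponential. Large `s` is enough for the
moment argument that follows. -/
theorem integral_bessel_mul_gaussFun {m : ℂ} (hm : -1 < m.re) {C D : ℝ} (hC : 0 ≤ C) (hD : 0 < D)
    (h : ∀ n, ‖besselCoeff m n‖ ≤ C * (D ^ n / n.factorial)) {R s x : ℝ} (hx : 0 < x)
    (hxR : x ≤ R) (hs : D * R ^ 2 / 2 + 1 ≤ s) :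
    ∫ k, besselJ m (k * x) * (Real.sqrt (k * x) : ℂ) * gaussFun m s k ∂hμ
      = (s : ℂ) ^ (-(m + 1)) * gaussFun m s⁻¹ x := by
  have hs0 : 0 < s := by
    have : 0 ≤ D * R ^ 2 := by positivity
    linarith
  have key := hasSum_integral_of_dominated_convergence (μ := hμ)
    (F := fun n k => besselTerm m n (k * x) * gaussFun m s k)
    (f := fun k => besselJ m (k * x) * (Real.sqrt (k * x) : ℂ) * gaussFun m s k)
    (fun n k => C * (k * x / 2) ^ m.re * Real.sqrt (k * x) *
      ((D * (k * x) ^ 2 / 4) ^ n / n.factorial) * ‖gaussFun m s k‖) (fun n => ?_) (fun n => ?_)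
      ?_ ?_ ?_
  · refine key.unique ?_
    simp_rw [integral_besselTerm_mul_gaussFun hm _ hs0 hx]
    rw [gaussFun, ← mul_assoc]
    refine HasSum.mul_left _ ?_
    rw [Complex.ofReal_exp, Complex.ofReal_neg, Complex.exp_eq_exp_ℂ]
    exact NormedSpace.expSeries_div_hasSum_exp _
  · exact (((measurable_besselTerm m n).comp (measurable_id.mul_const x)).mul
      (measurable_gaussFun m s)).aestronglyMeasurable
  · filter_upwards [ae_restrict_mem measurableSet_Ioi] with k hk
    rw [norm_mul]
    exact mul_le_mul_of_nonneg_right (norm_besselTerm_le h (mul_pos hk hx) n) (norm_nonneg _)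
  · exact Eventually.of_forall fun k =>
      ((summable_exp_series _).summable.mul_left _).mul_right _
  · have hsum : ∀ k : ℝ, ∑' n : ℕ, C * (k * x / 2) ^ m.re * Real.sqrt (k * x) *
        ((D * (k * x) ^ 2 / 4) ^ n / n.factorial) * ‖gaussFun m s k‖
        = C * (k * x / 2) ^ m.re * Real.sqrt (k * x) * Real.exp (D * (k * x) ^ 2 / 4) *
          ‖gaussFun m s k‖ := by
      intro k
      rw [tsum_mul_right, tsum_mul_left, (summable_exp_series _).tsum_eq]
    simp_rw [hsum]
    refine ((integrable_rpow_gauss hm).const_mul (C * 2 ^ (-m.re) * x ^ (m.re + 1 / 2))).mono' ?_ ?_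
    · refine Measurable.aestronglyMeasurable ?_
      exact ((by fun_prop : Measurable fun k : ℝ => C * (k * x / 2) ^ m.re * Real.sqrt (k * x) *
        Real.exp (D * (k * x) ^ 2 / 4))).mul (measurable_gaussFun m s).norm
    · filter_upwards [ae_restrict_mem measurableSet_Ioi] with k hk
      have hk' : 0 < k := hk
      rw [Real.norm_of_nonneg (by positivity), norm_gaussFun m s hk]
      exact kernel_bound _ hC hD hk hx hxR hs
  · filter_upwards [ae_restrict_mem measurableSet_Ioi] with k hk
    exact (hasSum_besselTerm hm (mul_pos hk hx)).mul_right _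

theorem measurable_besselJ_sqrt {m : ℂ} (hm : -1 < m.re) : ∃ B : ℝ → ℂ, Measurable B ∧
    ∀ u, 0 < u → B u = besselJ m u * (Real.sqrt u : ℂ) := by
  refine ⟨fun u => if 0 < u then besselJ m u * (Real.sqrt u : ℂ) else 0, ?_,
    fun u hu => if_pos hu⟩
  refine measurable_of_tendsto_metrizable (f := fun (N : ℕ) u => if 0 < u then
    ∑ n ∈ Finset.range N, besselTerm m n u else 0) (fun N => ?_) ?_
  · exact Measurable.ite measurableSet_Ioi
      (Finset.measurable_fun_sum _ fun n _ => measurable_besselTerm m n) measurable_const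
  · rw [tendsto_pi_nhds]
    intro u
    by_cases hu : 0 < u
    · simp only [if_pos hu]
      exact (hasSum_besselTerm hm hu).tendsto_sum_nat
    · simp only [if_neg hu]
      exact tendsto_const_nhds

/-- The abstract operator and the Bessel integral are tested against the Gaussians with `s ≥ s₀`.
Both tests give `∫ s^{-m-1} G_{1/s} f`: one by symmetry of the operator, the other by Fubini and the
Gaussian integral of the kernel. Gaussian moments then determine the function. -/
theorem hankelCLM_isHankel {m : ℂ} (hm : -1 < m.re) : IsHankel m (hankelCLM m) := by
  intro f ⟨R₀, hR₀⟩
  obtain ⟨C, D, hC, hD, h⟩ := exists_norm_besselCoeff_le hm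
  obtain ⟨B, hBm, hB⟩ := measurable_besselJ_sqrt hm
  set R := max R₀ 0 with hR
  have hfR : ∀ᵐ x ∂hμ, R < x → f x = 0 := by
    filter_upwards [hR₀] with x hx hRx using hx (lt_of_le_of_lt (le_max_left _ _) hRx)
  set s₀ := D * R ^ 2 / 2 + 1 with hs₀
  have hs₀0 : 0 < s₀ := by positivity
  have hprod : ∀ s, s₀ ≤ s → Integrable (fun p : ℝ × ℝ => B (p.1 * p.2) * f p.2 *
      gaussFun m s p.1) (hμ.prod hμ) := by
    intro s hs
    have hs0 : 0 < s := lt_of_lt_of_le hs₀0 hs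
    -- On the support of `f` one has `1 ≤ e^{R²/2} e^{-x²/2}`. Inserting this factor completes the
    -- power of `x` in the kernel bound to the square integrable function `gaussFun m 1`, so the
    -- majorant is a product of integrable functions of `k` and of `x`.
    have i1 := (integrable_rpow_gauss hm).const_mul (C * 2 ^ (-m.re) * Real.exp (R ^ 2 / 2))
    have i2 : Integrable (fun x => ‖f x * gaussFun m 1 x‖) hμ :=
      ((Lp.memLp f).integrable_mul (memLp_gaussFun hm one_pos)).norm
    refine (i1.mul_prod i2).mono' ?_ ?_
    · refine AEStronglyMeasurable.mul (AEStronglyMeasurable.mul ?_ ?_) ?_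
      · exact (hBm.comp (measurable_fst.mul measurable_snd)).aestronglyMeasurable
      · exact (Lp.aestronglyMeasurable f).comp_snd
      · exact ((measurable_gaussFun m s).comp measurable_fst).aestronglyMeasurable
    · have hfR' : ∀ᵐ p ∂(hμ.prod hμ), R < p.2 → f p.2 = 0 :=
        Measure.quasiMeasurePreserving_snd.ae hfR
      have h1 : ∀ᵐ p ∂(hμ.prod hμ), p.1 ∈ Ioi (0 : ℝ) :=
        Measure.quasiMeasurePreserving_fst.ae (ae_restrict_mem measurableSet_Ioi)
      have h2 : ∀ᵐ p ∂(hμ.prod hμ), p.2 ∈ Ioi (0 : ℝ) :=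
        Measure.quasiMeasurePreserving_snd.ae (ae_restrict_mem measurableSet_Ioi)
      filter_upwards [hfR', h1, h2] with p hp hk hx
      have hk' : 0 < p.1 := hk
      have hx' : 0 < p.2 := hx
      rcases lt_or_ge R p.2 with hlt | hle
      · rw [hp hlt]
        simp only [mul_zero, zero_mul, norm_zero]
        rfl
      · rw [hB _ (mul_pos hk hx), norm_mul _ (gaussFun m s p.1), norm_mul _ (f p.2),
          norm_mul (f p.2), norm_gaussFun m s hk, norm_gaussFun m 1 hx]
        have hb := norm_besselJ_le hm h (mul_pos hk' hx')
        have hkb := kernel_bound m.re hC hD hk' hx' hle hs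
        have he : 1 ≤ Real.exp (R ^ 2 / 2) * Real.exp (-(1 * p.2 ^ 2 / 2)) := by
          rw [← Real.exp_add]
          refine Real.one_le_exp ?_
          have := pow_le_pow_left₀ hx'.le hle 2
          linarith
        calc _ = ‖besselJ m (p.1 * p.2) * (Real.sqrt (p.1 * p.2) : ℂ)‖ *
              (p.1 ^ (m.re + 1 / 2) * Real.exp (-(s * p.1 ^ 2 / 2))) * ‖f p.2‖ := by ring
          _ ≤ C * (p.1 * p.2 / 2) ^ m.re * Real.sqrt (p.1 * p.2) *
              Real.exp (D * (p.1 * p.2) ^ 2 / 4) *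
              (p.1 ^ (m.re + 1 / 2) * Real.exp (-(s * p.1 ^ 2 / 2))) * ‖f p.2‖ := by
              gcongr
          _ ≤ C * 2 ^ (-m.re) * p.2 ^ (m.re + 1 / 2) *
              (p.1 ^ (2 * m.re + 1) * Real.exp (-(p.1 ^ 2 / 2))) * ‖f p.2‖ := by
              gcongr
          _ ≤ C * 2 ^ (-m.re) * p.2 ^ (m.re + 1 / 2) *
              (p.1 ^ (2 * m.re + 1) * Real.exp (-(p.1 ^ 2 / 2))) * ‖f p.2‖ *
              (Real.exp (R ^ 2 / 2) * Real.exp (-(1 * p.2 ^ 2 / 2))) :=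
              le_mul_of_one_le_right (by positivity) he
          _ = _ := by ring
  set K : ℝ → ℂ := fun k => ∫ x, B (k * x) * f x ∂hμ with hK
  have hKint : ∀ s, s₀ ≤ s → Integrable (fun k => K k * gaussFun m s k) hμ := by
    intro s hs
    have := (hprod s hs).integral_prod_left
    simpa only [integral_mul_const] using this
  have hKval : ∀ s, s₀ ≤ s → ∫ k, K k * gaussFun m s k ∂hμ
      = ∫ k, (hankelCLM m f) k * gaussFun m s k ∂hμ := by
    intro s hs
    have hs0 : 0 < s := lt_of_lt_of_le hs₀0 hs
    rw [← pairing_toL2_right _ (memLp_gaussFun hm hs0)]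
    change _ = pairing _ (gaussVec m s)
    rw [hankelCLM_symm hm, hankelCLM_gaussVec hm hs0, map_smul, gaussVec,
      pairing_toL2_right _ (memLp_gaussFun hm (inv_pos.mpr hs0)), smul_eq_mul,
      ← integral_const_mul]
    simp only [hK]
    simp_rw [← integral_mul_const]
    rw [integral_integral_swap (hprod s hs)]
    refine integral_congr_ae ?_
    filter_upwards [hfR, ae_restrict_mem measurableSet_Ioi] with x hfx hx
    rcases lt_or_ge R x with hlt | hle
    · simp [hfx hlt]
    · rw [← mul_assoc, mul_right_comm, ← integral_bessel_mul_gaussFun hm hC hD h hx hle hs,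
        ← integral_mul_const]
      refine setIntegral_congr_fun measurableSet_Ioi fun k hk => ?_
      rw [hB _ (mul_pos hk hx)]
      ring
  have hFint : ∀ s, 0 < s → Integrable (fun k => (hankelCLM m f) k * gaussFun m s k) hμ :=
    fun s hs => (Lp.memLp _).integrable_mul (memLp_gaussFun hm hs)
  have hsub : ∀ s, s₀ ≤ s →
      Integrable (fun k => ((hankelCLM m f) k - K k) * gaussFun m s k) hμ := by
    intro s hs
    simp_rw [sub_mul]
    exact (hFint s (lt_of_lt_of_le hs₀0 hs)).sub (hKint s hs)
  -- Multiplying the Gaussian of parameter `s₀` by `e^{-n k²/2}` gives the one of parameter `s₀ +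
  -- n`, which is again in the admissible range.
  have key := ae_eq_zero_of_gaussian_moments (hsub s₀ le_rfl) (fun n => by
    have hs : s₀ ≤ s₀ + n := by simp
    have e : ∀ k, ((hankelCLM m f) k - K k) * gaussFun m s₀ k *
        ((Real.exp (-(n * (k ^ 2 / 2))) : ℝ) : ℂ)
        = (hankelCLM m f) k * gaussFun m (s₀ + n) k - K k * gaussFun m (s₀ + n) k := by
      intro k
      simp only [gaussFun]
      rw [show -((s₀ + n) * k ^ 2 / 2) = -(s₀ * k ^ 2 / 2) + -(n * (k ^ 2 / 2)) by ring,
        Real.exp_add]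
      push_cast
      ring
    simp_rw [e]
    rw [integral_sub (hFint _ (by positivity)) (hKint _ hs), hKval _ hs, sub_self])
  filter_upwards [key, ae_restrict_mem measurableSet_Ioi] with k hk hk0
  have hg : gaussFun m s₀ k ≠ 0 := by
    rw [← norm_ne_zero_iff, norm_gaussFun m s₀ hk0]
    have hk0' : 0 < k := hk0
    positivity
  have h1 : (hankelCLM m f) k - K k = 0 := (mul_eq_zero.mp hk).resolve_right hg
  rw [sub_eq_zero.mp h1, hK]
  refine setIntegral_congr_fun measurableSet_Ioi fun x hx => ?_
  rw [hB _ (mul_pos hk0 hx)]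

/-! ### Dominated convergence in `L²` -/

theorem norm_sq_toL2 {f : ℝ → ℂ} (hf : MemLp f 2 hμ) :
    ‖toL2 f‖ ^ 2 = ∫ x, ‖f x‖ ^ 2 ∂hμ := by
  have h := inner_self_eq_norm_sq_to_K (𝕜 := ℂ) (toL2 f)
  rw [L2.inner_def] at h
  have h2 : ∫ x, inner ℂ (toL2 f x) (toL2 f x) ∂hμ = ((∫ x, ‖f x‖ ^ 2 ∂hμ : ℝ) : ℂ) := by
    rw [← integral_complex_ofReal]
    refine integral_congr_ae ?_
    filter_upwards [toL2_coe hf] with x hx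
    rw [inner_self_eq_norm_sq_to_K, hx]
    norm_num
  rw [h2] at h
  exact Complex.ofReal_injective (by simpa using h.symm)

theorem tendsto_toL2 {F : ℕ → ℝ → ℂ} {f : ℝ → ℂ} {G : ℝ → ℝ} (hF : ∀ n, MemLp (F n) 2 hμ)
    (hf : MemLp f 2 hμ) (hG : MemLp G 2 hμ) (hb : ∀ n, ∀ᵐ x ∂hμ, ‖F n x - f x‖ ≤ G x)
    (hlim : ∀ᵐ x ∂hμ, Tendsto (fun n => F n x) atTop (𝓝 (f x))) :
    Tendsto (fun n => toL2 (F n)) atTop (𝓝 (toL2 f)) := by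
  rw [tendsto_iff_norm_sub_tendsto_zero]
  have hsq : Tendsto (fun n => ‖toL2 (F n) - toL2 f‖ ^ 2) atTop (𝓝 0) := by
    have he : ∀ n, ‖toL2 (F n) - toL2 f‖ ^ 2 = ∫ x, ‖F n x - f x‖ ^ 2 ∂hμ := fun n => by
      rw [← toL2_sub (hF n) hf]
      exact norm_sq_toL2 ((hF n).sub hf)
    simp only [he]
    have := tendsto_integral_of_dominated_convergence (μ := hμ)
      (F := fun n x => ‖F n x - f x‖ ^ 2) (f := fun _ => 0) (fun x => G x ^ 2)
      (fun n => ((hF n).sub hf).1.norm.pow 2) hG.integrable_sq (fun n => by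
        filter_upwards [hb n] with x hx
        rw [Real.norm_of_nonneg (by positivity)]
        exact pow_le_pow_left₀ (norm_nonneg _) hx 2) (by
        filter_upwards [hlim] with x hx
        have := ((tendsto_sub_nhds_zero_iff.mpr hx).norm).pow 2
        simpa using this)
    simpa using this
  have := hsq.sqrt
  simpa [Real.sqrt_sq_eq_abs] using this

/-! ### Cutoffs in the logarithmic variable -/

/-- A complex valued bump function, equal to `1` on `[-1, 1]`. -/
def bump (t : ℝ) : ℂ := ((⟨1, 2, one_pos, one_lt_two⟩ : ContDiffBump (0 : ℝ)) t : ℝ)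

theorem bump_contDiff {n : ℕ∞} : ContDiff ℝ n bump :=
  Complex.ofRealCLM.contDiff.comp (ContDiffBump.contDiff _)

theorem bump_hasCompactSupport : HasCompactSupport bump :=
  (ContDiffBump.hasCompactSupport (⟨1, 2, one_pos, one_lt_two⟩ : ContDiffBump (0 : ℝ))).comp_left
    (g := fun x : ℝ => (x : ℂ)) rfl

theorem bump_eq_one {t : ℝ} (ht : |t| ≤ 1) : bump t = 1 := by
  rw [bump, ContDiffBump.one_of_mem_closedBall _ (by simpa using ht), Complex.ofReal_one]

theorem bump_eq_zero {t : ℝ} (ht : 2 ≤ |t|) : bump t = 0 := by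
  rw [bump, ContDiffBump.zero_of_le_dist _ (by simpa using ht), Complex.ofReal_zero]

theorem exists_bump_bound : ∃ A : ℝ, ∀ t, ‖bump t‖ ≤ A ∧ ‖deriv bump t‖ ≤ A ∧
    ‖deriv (deriv bump) t‖ ≤ A := by
  have h0 : ContDiff ℝ 2 bump := bump_contDiff (n := 2)
  have h1 : ContDiff ℝ 1 (deriv bump) := (contDiff_succ_iff_deriv.mp h0).2.2
  have h2 : Continuous (deriv (deriv bump)) := h1.continuous_deriv le_rfl
  obtain ⟨A, hA⟩ := bump_hasCompactSupport.exists_bound_of_continuous h0.continuous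
  obtain ⟨B, hB⟩ := bump_hasCompactSupport.deriv.exists_bound_of_continuous h1.continuous
  obtain ⟨C, hC⟩ := bump_hasCompactSupport.deriv.deriv.exists_bound_of_continuous h2
  exact ⟨max A (max B C), fun t => ⟨(hA t).trans (le_max_left _ _),
    (hB t).trans ((le_max_left _ _).trans (le_max_right _ _)),
    (hC t).trans ((le_max_right _ _).trans (le_max_right _ _))⟩⟩

/-- The cutoff function `θ(log x / N)` on the half-line. -/
def logCutoff (N x : ℝ) : ℂ := if 0 < x then bump (Real.log x / N) else 0

theorem logCutoff_eventuallyEq (N : ℝ) {x : ℝ} (hx : 0 < x) :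
    logCutoff N =ᶠ[𝓝 x] fun y => bump (Real.log y / N) := by
  filter_upwards [Ioi_mem_nhds hx] with y hy
  exact if_pos hy

theorem hasDerivAt_comp_log {g : ℝ → ℂ} (hg : Differentiable ℝ g) (N : ℝ) {x : ℝ} (hx : 0 < x) :
    HasDerivAt (fun y => g (Real.log y / N)) (((N * x)⁻¹ : ℝ) * deriv g (Real.log x / N)) x := by
  have h1 : HasDerivAt (fun y => Real.log y / N) ((N * x)⁻¹) x := by
    have := (Real.hasDerivAt_log hx.ne').div_const N
    rwa [div_eq_mul_inv, ← mul_inv, mul_comm] at this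
  have h2 : HasDerivAt g (deriv g (Real.log x / N)) (Real.log x / N) :=
    (hg (Real.log x / N)).hasDerivAt
  refine (HasDerivAt.scomp x h2 h1).congr_deriv ?_
  rw [Complex.real_smul]

theorem deriv_logCutoff (N : ℝ) {x : ℝ} (hx : 0 < x) :
    deriv (logCutoff N) x = ((N * x)⁻¹ : ℝ) * deriv bump (Real.log x / N) := by
  rw [(logCutoff_eventuallyEq N hx).deriv_eq]
  exact (hasDerivAt_comp_log ((bump_contDiff (n := 1)).differentiable one_ne_zero) N hx).deriv

theorem deriv_deriv_logCutoff (N : ℝ) {x : ℝ} (hx : 0 < x) :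
    deriv (deriv (logCutoff N)) x = ((N * x)⁻¹ : ℝ) * ((N * x)⁻¹ : ℝ) *
      deriv (deriv bump) (Real.log x / N) -
      ((N * x ^ 2)⁻¹ : ℝ) * deriv bump (Real.log x / N) := by
  have h : deriv (logCutoff N) =ᶠ[𝓝 x]
      fun y => ((N⁻¹ * y⁻¹ : ℝ) : ℂ) * deriv bump (Real.log y / N) := by
    filter_upwards [Ioi_mem_nhds hx] with y hy
    rw [deriv_logCutoff N hy, mul_inv]
  rw [h.deriv_eq]
  have hb : Differentiable ℝ (deriv bump) :=
    ((contDiff_succ_iff_deriv.mp (bump_contDiff (n := 2))).2.2).differentiable one_ne_zero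
  have h1 : HasDerivAt (fun y : ℝ => ((N⁻¹ * y⁻¹ : ℝ) : ℂ)) ((N⁻¹ * -(x ^ 2)⁻¹ : ℝ) : ℂ) x :=
    ((hasDerivAt_inv hx.ne').const_mul N⁻¹).ofReal_comp
  refine (h1.mul (hasDerivAt_comp_log hb N hx)).deriv.trans ?_
  push_cast
  ring

/-- In the variable `log x` the cutoffs are dilations of one bump, so `x ∂_x` and `x² ∂_x²` of them
are bounded uniformly in `N ≥ 1`. Truncation at `0` and at `∞` is thus done at once, with the
homogeneity of the operator. -/
theorem exists_logCutoff_bound : ∃ A : ℝ, 0 ≤ A ∧ ∀ N x : ℝ, 1 ≤ N → 0 < x →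
    ‖logCutoff N x‖ ≤ A ∧ ‖deriv (logCutoff N) x‖ ≤ A / x ∧
      ‖deriv (deriv (logCutoff N)) x‖ ≤ 2 * A / x ^ 2 := by
  obtain ⟨A, hA⟩ := exists_bump_bound
  have hA0 : 0 ≤ A := (norm_nonneg _).trans (hA 0).1
  refine ⟨A, hA0, fun N x hN hx => ?_⟩
  obtain ⟨h1, h2, h3⟩ := hA (Real.log x / N)
  have hN0 : 0 < N := by linarith
  have e1 : (N * x)⁻¹ ≤ x⁻¹ := inv_anti₀ hx (le_mul_of_one_le_left hx.le hN)
  have e2 : (N * x ^ 2)⁻¹ ≤ (x ^ 2)⁻¹ :=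
    inv_anti₀ (by positivity) (le_mul_of_one_le_left (by positivity) hN)
  refine ⟨?_, ?_, ?_⟩
  · rw [logCutoff, if_pos hx]
    exact h1
  · rw [deriv_logCutoff N hx, norm_mul, Complex.norm_real, Real.norm_of_nonneg (by positivity),
      div_eq_inv_mul A]
    exact mul_le_mul e1 h2 (norm_nonneg _) (by positivity)
  · rw [deriv_deriv_logCutoff N hx]
    refine (norm_sub_le _ _).trans ?_
    rw [norm_mul, norm_mul, norm_mul, Complex.norm_real, Complex.norm_real,
      Real.norm_of_nonneg (by positivity), Real.norm_of_nonneg (by positivity)]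
    calc _ ≤ x⁻¹ * x⁻¹ * A + (x ^ 2)⁻¹ * A := by gcongr
      _ = _ := by
        rw [div_eq_mul_inv, ← mul_inv, ← pow_two]
        ring

theorem tendsto_logCutoff {x : ℝ} (hx : 0 < x) :
    ∀ᶠ n : ℕ in atTop, logCutoff ((n : ℝ) + 1) =ᶠ[𝓝 x] fun _ => 1 := by
  filter_upwards [eventually_gt_atTop ⌈|Real.log x|⌉₊] with n hn
  have h1 : |Real.log x| < (n : ℝ) + 1 := by
    have h2 : |Real.log x| ≤ (⌈|Real.log x|⌉₊ : ℝ) := Nat.le_ceil _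
    have h3 : (⌈|Real.log x|⌉₊ : ℝ) < n := by exact_mod_cast hn
    linarith
  have hc : ContinuousAt (fun y => |Real.log y|) x := (Real.continuousAt_log hx.ne').abs
  filter_upwards [hc.eventually_lt continuousAt_const h1, Ioi_mem_nhds hx] with y hy hy0
  rw [logCutoff, if_pos (show 0 < y from hy0), bump_eq_one]
  have hn0 : (0 : ℝ) < n + 1 := by positivity
  rw [abs_div, abs_of_pos hn0, div_le_one hn0]
  exact hy.le

theorem logCutoff_eq_zero {N x : ℝ} (hN : 0 < N)
    (hx : x ∉ Icc (Real.exp (-(2 * N))) (Real.exp (2 * N))) : logCutoff N x = 0 := by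
  rw [logCutoff]
  split_ifs with h
  · apply bump_eq_zero
    rw [abs_div, abs_of_pos hN, le_div_iff₀ hN]
    rw [mem_Icc, not_and_or, not_le, not_le] at hx
    rcases hx with hx | hx
    · have := (Real.log_lt_log h hx).le
      rw [Real.log_exp] at this
      have := neg_abs_le (Real.log x)
      linarith
    · have := (Real.log_lt_log (Real.exp_pos _) hx).le
      rw [Real.log_exp] at this
      exact this.trans (le_abs_self _)
  · rfl

theorem isTest_logCutoff_mul {v : ℝ → ℂ} (hv : ContDiffOn ℝ (⊤ : ℕ∞) v (Ioi 0)) {N : ℝ}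
    (hN : 0 < N) : IsTest (fun x => logCutoff N x * v x) := by
  have hsupp : tsupport (fun x => logCutoff N x * v x) ⊆
      Icc (Real.exp (-(2 * N))) (Real.exp (2 * N)) := by
    refine closure_minimal (fun x hx => ?_) isClosed_Icc
    by_contra h
    exact hx (by simp only [logCutoff_eq_zero hN h, zero_mul])
  refine ⟨?_, HasCompactSupport.of_support_subset_isCompact isCompact_Icc
    (subset_closure.trans hsupp), fun x hx => lt_of_lt_of_le (Real.exp_pos _) (hsupp hx).1⟩
  rw [contDiff_iff_contDiffAt]
  intro x
  rcases lt_or_ge 0 x with hx | hx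
  · refine ContDiffAt.mul ?_ (hv.contDiffAt (Ioi_mem_nhds hx))
    refine ContDiffAt.congr_of_eventuallyEq ?_ (logCutoff_eventuallyEq N hx)
    exact bump_contDiff.contDiffAt.comp x ((Real.contDiffAt_log.mpr hx.ne').div_const N)
  · have : (fun x => logCutoff N x * v x) =ᶠ[𝓝 x] fun _ => 0 := by
      filter_upwards [Iio_mem_nhds (lt_of_le_of_lt hx (Real.exp_pos (-(2 * N))))] with y hy
      rw [logCutoff_eq_zero hN fun h => not_le.mpr hy h.1, zero_mul]
    exact contDiffAt_const.congr_of_eventuallyEq this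

/-! ### Smooth functions in the domains of the minimal and the maximal operator -/

theorem iteratedDeriv_two (f : ℝ → ℂ) (x : ℝ) : iteratedDeriv 2 f x = deriv (deriv f) x := by
  rw [iteratedDeriv_succ, iteratedDeriv_one]

theorem deriv_deriv_mul {f g : ℝ → ℂ} {x : ℝ} (hf : ContDiffAt ℝ 2 f x)
    (hg : ContDiffAt ℝ 2 g x) :
    deriv (deriv fun y => f y * g y) x
      = deriv (deriv f) x * g x + 2 * (deriv f x * deriv g x) + f x * deriv (deriv g) x := by
  have := iteratedDeriv_fun_mul (n := 2) hf hg
  rw [iteratedDeriv_two] at this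
  rw [this]
  simp [Finset.sum_range_succ, iteratedDeriv_two, iteratedDeriv_one]
  ring

theorem Lexpr_congr (α : ℂ) {f g : ℝ → ℂ} {x : ℝ} (h : f =ᶠ[𝓝 x] g) :
    Lexpr α f x = Lexpr α g x := by
  rw [Lexpr, Lexpr, h.iteratedDeriv_eq 2, h.eq_of_nhds]

theorem Lexpr_mul (α : ℂ) {f g : ℝ → ℂ} {x : ℝ} (hf : ContDiffAt ℝ 2 f x)
    (hg : ContDiffAt ℝ 2 g x) : Lexpr α (fun y => f y * g y) x
      = f x * Lexpr α g x - deriv (deriv f) x * g x - 2 * (deriv f x * deriv g x) := by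
  rw [Lexpr, Lexpr, iteratedDeriv_two, iteratedDeriv_two, deriv_deriv_mul hf hg]
  ring

/-- The graph of the minimal operator. -/
def graphMin (α : ℂ) : Submodule ℂ (L2 × L2) := (graphTest α).topologicalClosure

/-- With logarithmic cutoffs `χ_N`, the products `χ_N v` are test functions. The commutator terms
`χ_N'' v` and `2 χ_N' v'` are dominated by `v / x²` and `v' / x`, and vanish near any given point
for large `N`, so dominated convergence gives convergence in the graph norm. -/
theorem mem_graphMin_of_contDiffOn {α : ℂ} {v : ℝ → ℂ} (hv : ContDiffOn ℝ (⊤ : ℕ∞) v (Ioi 0))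
    (h0 : MemLp v 2 hμ) (h1 : MemLp (fun x : ℝ => deriv v x / x) 2 hμ)
    (h2 : MemLp (fun x : ℝ => v x / x ^ 2) 2 hμ) (hL : MemLp (Lexpr α v) 2 hμ) :
    (toL2 v, toL2 (Lexpr α v)) ∈ graphMin α := by
  obtain ⟨A, hA0, hA⟩ := exists_logCutoff_bound
  have hN : ∀ n : ℕ, (1 : ℝ) ≤ n + 1 := fun n => by
    have : (0 : ℝ) ≤ n := n.cast_nonneg
    linarith
  have htest : ∀ n : ℕ, IsTest (fun x => logCutoff (n + 1) x * v x) :=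
    fun n => isTest_logCutoff_mul hv (by linarith [hN n])
  have hmem : ∀ n : ℕ, (toL2 (fun x => logCutoff (n + 1) x * v x),
      toL2 (Lexpr α fun x => logCutoff (n + 1) x * v x)) ∈ (graphTest α : Set (L2 × L2)) :=
    fun n => ⟨_, htest n, toL2_coe (htest n).memLp, toL2_coe ((htest n).memLp_Lexpr α)⟩
  refine mem_closure_of_tendsto (b := atTop) (Tendsto.prodMk_nhds ?_ ?_) (Eventually.of_forall hmem)
  · refine tendsto_toL2 (G := fun x => (A + 1) * ‖v x‖) (fun n => (htest n).memLp) h0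
      (h0.norm.const_mul _) (fun n => ?_) ?_
    · filter_upwards [ae_restrict_mem measurableSet_Ioi] with x hx
      rw [show logCutoff (n + 1) x * v x - v x = (logCutoff (n + 1) x - 1) * v x by ring, norm_mul]
      refine mul_le_mul_of_nonneg_right ((norm_sub_le _ _).trans ?_) (norm_nonneg _)
      rw [norm_one]
      linarith [(hA _ x (hN n) hx).1]
    · filter_upwards [ae_restrict_mem measurableSet_Ioi] with x hx
      refine tendsto_const_nhds.congr' ?_
      filter_upwards [tendsto_logCutoff hx] with n hn
      rw [hn.eq_of_nhds, one_mul]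
  · refine tendsto_toL2 (G := fun x => (A + 1) * ‖Lexpr α v x‖ +
      (2 * A * ‖v x / (x : ℂ) ^ 2‖ + 2 * A * ‖deriv v x / (x : ℂ)‖))
      (fun n => (htest n).memLp_Lexpr α) hL
      ((hL.norm.const_mul _).add ((h2.norm.const_mul _).add (h1.norm.const_mul _)))
      (fun n => ?_) ?_
    · filter_upwards [ae_restrict_mem measurableSet_Ioi] with x hx
      have hx' : 0 < x := hx
      obtain ⟨b0, b1, b2⟩ := hA _ x (hN n) hx
      have hc : ContDiffAt ℝ 2 (logCutoff ((n : ℝ) + 1)) x := by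
        refine ContDiffAt.congr_of_eventuallyEq ?_ (logCutoff_eventuallyEq _ hx)
        exact (bump_contDiff (n := 2)).contDiffAt.comp x
          ((Real.contDiffAt_log.mpr hx'.ne').div_const _)
      rw [Lexpr_mul α hc ((hv.contDiffAt (Ioi_mem_nhds hx)).of_le two_le_smooth)]
      rw [show ∀ a b c d : ℂ, a * b - c - d - b = (a - 1) * b - c - d by intros; ring]
      refine (norm_sub_le _ _).trans ?_
      refine (add_le_add_left (norm_sub_le _ _) _).trans ?_
      rw [norm_mul, norm_mul, norm_mul, norm_mul, norm_div, norm_div, norm_pow, Complex.norm_real,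
        Real.norm_of_nonneg hx'.le, Complex.norm_ofNat, add_assoc]
      refine add_le_add ?_ (add_le_add ?_ ?_)
      · refine mul_le_mul_of_nonneg_right ((norm_sub_le _ _).trans ?_) (norm_nonneg _)
        rw [norm_one]
        linarith
      · calc _ ≤ 2 * A / x ^ 2 * ‖v x‖ := mul_le_mul_of_nonneg_right b2 (norm_nonneg _)
          _ = _ := by ring
      · calc _ ≤ 2 * (A / x * ‖deriv v x‖) := by gcongr
          _ = _ := by ring
    · filter_upwards [ae_restrict_mem measurableSet_Ioi] with x hx
      refine tendsto_const_nhds.congr' ?_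
      filter_upwards [tendsto_logCutoff hx] with n hn
      refine (Lexpr_congr α ?_).symm
      filter_upwards [hn] with y hy
      rw [hy, one_mul]

theorem continuous_mul_of_tsupport {φ w : ℝ → ℂ} (hφ : Continuous φ) (hs : tsupport φ ⊆ Ioi 0)
    (hw : ContinuousOn w (Ioi 0)) : Continuous fun x => φ x * w x := by
  rw [continuous_iff_continuousAt]
  intro x
  by_cases hx : x ∈ tsupport φ
  · exact hφ.continuousAt.mul (hw.continuousAt (Ioi_mem_nhds (hs hx)))
  · have : (fun x => φ x * w x) =ᶠ[𝓝 x] fun _ => 0 := by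
      filter_upwards [notMem_tsupport_iff_eventuallyEq.mp hx] with y hy
      rw [hy, Pi.zero_apply, zero_mul]
    exact continuousAt_const.congr this.symm

theorem integrable_mul_of_tsupport {φ w : ℝ → ℂ} (hφ : Continuous φ) (hc : HasCompactSupport φ)
    (hs : tsupport φ ⊆ Ioi 0) (hw : ContinuousOn w (Ioi 0)) :
    Integrable (fun x => φ x * w x) :=
  (continuous_mul_of_tsupport hφ hs hw).integrable_of_hasCompactSupport hc.mul_right

/-- The integrand is the derivative of the Wronskian `φ v' - φ' v`, which is integrable and
supported away from `0`. -/
theorem integral_test_wronskian {φ v : ℝ → ℂ} (hφ : IsTest φ)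
    (hv : ContDiffOn ℝ (⊤ : ℕ∞) v (Ioi 0)) :
    ∫ x, (φ x * deriv (deriv v) x - deriv (deriv φ) x * v x) = 0 := by
  have hv1 : ContDiffOn ℝ (⊤ : ℕ∞) (deriv v) (Ioi 0) :=
    (contDiffOn_infty_iff_deriv_of_isOpen isOpen_Ioi).mp hv |>.2
  have hv2 : ContDiffOn ℝ (⊤ : ℕ∞) (deriv (deriv v)) (Ioi 0) :=
    (contDiffOn_infty_iff_deriv_of_isOpen isOpen_Ioi).mp hv1 |>.2
  have hφ1 : ContDiff ℝ (⊤ : ℕ∞) (deriv φ) := (contDiff_infty_iff_deriv.mp hφ.smooth).2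
  have hφ2 : ContDiff ℝ (⊤ : ℕ∞) (deriv (deriv φ)) := (contDiff_infty_iff_deriv.mp hφ1).2
  have hs1 : tsupport (deriv φ) ⊆ Ioi 0 := (tsupport_deriv_subset).trans hφ.support
  have hs2 : tsupport (deriv (deriv φ)) ⊆ Ioi 0 := (tsupport_deriv_subset).trans hs1
  have hi1 := integrable_mul_of_tsupport hφ.smooth.continuous hφ.compact hφ.support
    hv2.continuousOn
  have hi2 := integrable_mul_of_tsupport hφ2.continuous hφ.compact.deriv.deriv hs2
    hv.continuousOn
  have hi3 := integrable_mul_of_tsupport hφ.smooth.continuous hφ.compact hφ.support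
    hv1.continuousOn
  have hi4 := integrable_mul_of_tsupport hφ1.continuous hφ.compact.deriv hs1
    hv.continuousOn
  refine integral_eq_zero_of_hasDerivAt_of_integrable
    (f := fun x => φ x * deriv v x - deriv φ x * v x) (fun x => ?_) (hi1.sub hi2) (hi3.sub hi4)
  by_cases hx : x ∈ tsupport φ
  · have hx0 : 0 < x := hφ.support hx
    have d0 : HasDerivAt v (deriv v x) x :=
      ((hv.contDiffAt (Ioi_mem_nhds hx0)).differentiableAt (by simp)).hasDerivAt
    have d1 : HasDerivAt (deriv v) (deriv (deriv v) x) x :=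
      ((hv1.contDiffAt (Ioi_mem_nhds hx0)).differentiableAt (by simp)).hasDerivAt
    have e0 : HasDerivAt φ (deriv φ x) x :=
      (hφ.smooth.contDiffAt.differentiableAt (by simp)).hasDerivAt
    have e1 : HasDerivAt (deriv φ) (deriv (deriv φ) x) x :=
      (hφ1.contDiffAt.differentiableAt (by simp)).hasDerivAt
    refine ((e0.mul d1).sub (e1.mul d0)).congr_deriv ?_
    ring
  · have h0 := notMem_tsupport_iff_eventuallyEq.mp hx
    have h1 : deriv φ =ᶠ[𝓝 x] 0 := notMem_tsupport_iff_eventuallyEq.mp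
      fun h => hx (tsupport_deriv_subset h)
    have h2 : deriv (deriv φ) x = 0 := (notMem_tsupport_iff_eventuallyEq.mp
      fun h => hx (tsupport_deriv_subset (tsupport_deriv_subset h))).eq_of_nhds
    have : (fun x => φ x * deriv v x - deriv φ x * v x) =ᶠ[𝓝 x] fun _ => 0 := by
      filter_upwards [h0, h1] with y hy hy1
      simp [hy, hy1]
    rw [h0.eq_of_nhds, h2]
    simpa using (hasDerivAt_const x (0 : ℂ)).congr_of_eventuallyEq this

/-- Smooth square integrable functions are in the domain of the maximal operator. -/
theorem mem_graphMax_of_contDiffOn {α : ℂ} {v : ℝ → ℂ} (hv : ContDiffOn ℝ (⊤ : ℕ∞) v (Ioi 0))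
    (h0 : MemLp v 2 hμ) (hL : MemLp (Lexpr α v) 2 hμ) :
    (toL2 v, toL2 (Lexpr α v)) ∈ graphMax α := by
  intro φ hφ
  rw [← sub_eq_zero]
  have i1 : Integrable (fun x => toL2 v x * Lexpr α φ x) hμ :=
    (Lp.memLp _).integrable_mul (hφ.memLp_Lexpr α)
  have i2 : Integrable (fun x => toL2 (Lexpr α v) x * φ x) hμ :=
    (Lp.memLp _).integrable_mul hφ.memLp
  rw [← integral_sub i1 i2]
  have hw := integral_test_wronskian hφ hv
  have hs : ∫ x, (φ x * deriv (deriv v) x - deriv (deriv φ) x * v x) =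
      ∫ x, (φ x * deriv (deriv v) x - deriv (deriv φ) x * v x) ∂hμ := by
    refine (setIntegral_eq_integral_of_forall_compl_eq_zero fun x hx => ?_).symm
    have hx' : x ∉ tsupport φ := fun h => hx (hφ.support h)
    rw [image_eq_zero_of_notMem_tsupport hx', image_eq_zero_of_notMem_tsupport
      fun h => hx' (tsupport_deriv_subset (tsupport_deriv_subset h))]
    ring
  rw [hs] at hw
  rw [← hw]
  refine integral_congr_ae ?_
  filter_upwards [toL2_coe h0, toL2_coe hL] with x e1 e2
  simp only [e1, e2, Lexpr, iteratedDeriv_two]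
  ring

/-! ### Solutions of the homogeneous equation and cutoff functions -/

/-- `u` is `O(x^(δ - 1/2))` at `0` with at most exponential growth, and likewise `x u'`. -/
def SolutionBound (δ : ℝ) (u : ℝ → ℂ) : Prop :=
  ∃ C : ℝ, 0 ≤ C ∧ ∀ x, 0 < x → ‖u x‖ ≤ C * (x ^ (δ - 1 / 2) * Real.exp (x / 2)) ∧
    ‖deriv u x‖ ≤ C * (x ^ (δ - 1 / 2) * Real.exp (x / 2)) / x

/-- A solution of `L_α u = 0` on the half-line that is square integrable near `0` together
with the usual bound on its derivative. -/
structure IsSolution (α : ℂ) (u : ℝ → ℂ) : Prop where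
  smooth : ContDiffOn ℝ (⊤ : ℕ∞) u (Ioi 0)
  eq : ∀ x, 0 < x → Lexpr α u x = 0
  bound : ∃ δ : ℝ, 0 < δ ∧ SolutionBound δ u

/-- Smooth functions that are even to first order at `0` and decay exponentially, with
derivatives. -/
structure IsCutoff (ζ : ℝ → ℂ) : Prop where
  smooth : ContDiff ℝ (⊤ : ℕ∞) ζ
  zero : deriv ζ 0 = 0
  bound : ∃ C : ℝ, 0 ≤ C ∧ ∀ x, 0 ≤ x → ‖ζ x‖ ≤ C * Real.exp (-x) ∧
    ‖deriv ζ x‖ ≤ C * Real.exp (-x) ∧ ‖deriv (deriv ζ) x‖ ≤ C * Real.exp (-x)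

theorem contDiff_deriv {ζ : ℝ → ℂ} (h : ContDiff ℝ (⊤ : ℕ∞) ζ) :
    ContDiff ℝ (⊤ : ℕ∞) (deriv ζ) := (contDiff_infty_iff_deriv.mp h).2

theorem differentiable_of_smooth {ζ : ℝ → ℂ} (h : ContDiff ℝ (⊤ : ℕ∞) ζ) : Differentiable ℝ ζ :=
  h.differentiable (by simp)

/-- A smooth function vanishing at `0` whose derivative is bounded by `C x^k` and which decays
exponentially is bounded by a multiple of `x^(k+1) e^(-x)`. -/
theorem exists_bound_of_deriv {ζ : ℝ → ℂ} (hζ : Differentiable ℝ ζ) (h0 : ζ 0 = 0) {C : ℝ}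
    (hC : 0 ≤ C) (k : ℕ) (h1 : ∀ x, 0 ≤ x → ‖ζ x‖ ≤ C * Real.exp (-x))
    (h2 : ∀ x, 0 ≤ x → ‖deriv ζ x‖ ≤ C * (x ^ k * Real.exp (-x))) :
    ∀ x, 0 ≤ x → ‖ζ x‖ ≤ (C * Real.exp 1) * (x ^ (k + 1) * Real.exp (-x)) := by
  intro x hx
  have he1 : (1 : ℝ) ≤ Real.exp 1 := Real.one_le_exp zero_le_one
  -- On `[0,1]` the mean value inequality gives `C x^{k+1}`, and `1 ≤ e · e^{-x}` restores the
  -- exponential. For `x > 1` the decay of `ζ` suffices, since `1 ≤ e x^{k+1}`.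
  rcases le_or_gt x 1 with hx1 | hx1
  · have hd : ∀ y ∈ Icc 0 x, ‖deriv ζ y‖ ≤ C * x ^ k := fun y hy => by
      refine (h2 y hy.1).trans (mul_le_mul_of_nonneg_left ?_ hC)
      have e : Real.exp (-y) ≤ 1 := Real.exp_le_one_iff.mpr (by linarith [hy.1])
      calc y ^ k * Real.exp (-y) ≤ y ^ k * 1 :=
            mul_le_mul_of_nonneg_left e (pow_nonneg hy.1 k)
        _ ≤ x ^ k := by
          rw [mul_one]
          exact pow_le_pow_left₀ hy.1 hy.2 k
    have := (convex_Icc 0 x).norm_image_sub_le_of_norm_deriv_le (f := ζ)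
      (fun y _ => hζ y) hd (left_mem_Icc.mpr hx) (right_mem_Icc.mpr hx)
    rw [h0, sub_zero, sub_zero, Real.norm_of_nonneg hx] at this
    refine this.trans ?_
    have e : 1 ≤ Real.exp 1 * Real.exp (-x) := by
      rw [← Real.exp_add]
      exact Real.one_le_exp (by linarith)
    calc C * x ^ k * x = C * x ^ (k + 1) * 1 := by ring
      _ ≤ C * x ^ (k + 1) * (Real.exp 1 * Real.exp (-x)) :=
        mul_le_mul_of_nonneg_left e (by positivity)
      _ = _ := by ring
  · refine (h1 x hx).trans ?_
    have e : 1 ≤ Real.exp 1 * x ^ (k + 1) := one_le_mul_of_one_le_of_one_le he1 (one_le_pow₀ hx1.le)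
    calc C * Real.exp (-x) = C * Real.exp (-x) * 1 := by ring
      _ ≤ C * Real.exp (-x) * (Real.exp 1 * x ^ (k + 1)) :=
        mul_le_mul_of_nonneg_left e (by positivity)
      _ = _ := by ring

/-- The condition `ζ' 0 = 0` gains a factor `x` in the bound for `ζ'`. It compensates the `1/x` in
the bound for `u'` in the commutator term `ζ' u'`. -/
theorem IsCutoff.deriv_bound {ζ : ℝ → ℂ} (hζ : IsCutoff ζ) : ∃ C : ℝ, 0 ≤ C ∧ ∀ x, 0 ≤ x →
    ‖ζ x‖ ≤ C * Real.exp (-x) ∧ ‖deriv ζ x‖ ≤ C * (x ^ 1 * Real.exp (-x)) ∧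
      ‖deriv (deriv ζ) x‖ ≤ C * Real.exp (-x) := by
  obtain ⟨C, hC, h⟩ := hζ.bound
  have he1 : (1 : ℝ) ≤ Real.exp 1 := Real.one_le_exp zero_le_one
  have hle : ∀ x, C * Real.exp (-x) ≤ C * Real.exp 1 * Real.exp (-x) := fun x =>
    mul_le_mul_of_nonneg_right (le_mul_of_one_le_right hC he1) (Real.exp_pos _).le
  refine ⟨C * Real.exp 1, by positivity, fun x hx => ⟨((h x hx).1).trans (hle x), ?_,
    ((h x hx).2.2).trans (hle x)⟩⟩
  exact exists_bound_of_deriv (differentiable_of_smooth (contDiff_deriv hζ.smooth)) hζ.zero hC 0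
    (fun x hx => (h x hx).2.1) (fun x hx => by simpa using (h x hx).2.2) x hx

/-- If also `ζ 0 = 0`, a second integration gains `x²`, which is what division by `x²` in the
criterion for the minimal graph costs. -/
theorem IsCutoff.vanish_bound {ζ : ℝ → ℂ} (hζ : IsCutoff ζ) (h0 : ζ 0 = 0) : ∃ C : ℝ, 0 ≤ C ∧
    ∀ x, 0 ≤ x → ‖ζ x‖ ≤ C * (x ^ 2 * Real.exp (-x)) := by
  obtain ⟨C, hC, h⟩ := hζ.deriv_bound
  exact ⟨C * Real.exp 1, by positivity, exists_bound_of_deriv (differentiable_of_smooth hζ.smooth)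
    h0 hC 1 (fun x hx => (h x hx).1) (fun x hx => (h x hx).2.1)⟩

theorem deriv_deriv_sub' {ζ η : ℝ → ℂ} (hζ : ContDiff ℝ (⊤ : ℕ∞) ζ) (hη : ContDiff ℝ (⊤ : ℕ∞) η) :
    deriv (fun x => ζ x - η x) = (fun x => deriv ζ x - deriv η x) := by
  funext x
  exact deriv_fun_sub (differentiable_of_smooth hζ x) (differentiable_of_smooth hη x)

theorem IsCutoff.sub {ζ η : ℝ → ℂ} (hζ : IsCutoff ζ) (hη : IsCutoff η) :
    IsCutoff fun x => ζ x - η x := by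
  obtain ⟨C, hC, h⟩ := hζ.bound
  obtain ⟨D, hD, k⟩ := hη.bound
  refine ⟨hζ.smooth.sub hη.smooth, ?_, C + D, by positivity, fun x hx => ?_⟩
  · rw [deriv_deriv_sub' hζ.smooth hη.smooth]
    simp only [hζ.zero, hη.zero, sub_zero]
  · rw [deriv_deriv_sub' hζ.smooth hη.smooth,
      deriv_deriv_sub' (contDiff_deriv hζ.smooth) (contDiff_deriv hη.smooth), add_mul]
    exact ⟨(norm_sub_le _ _).trans (add_le_add (h x hx).1 (k x hx).1),
      (norm_sub_le _ _).trans (add_le_add (h x hx).2.1 (k x hx).2.1),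
      (norm_sub_le _ _).trans (add_le_add (h x hx).2.2 (k x hx).2.2)⟩

theorem IsCutoff.mul {ζ η : ℝ → ℂ} (hζ : IsCutoff ζ) (hη : IsCutoff η) :
    IsCutoff fun x => ζ x * η x := by
  obtain ⟨C, hC, h⟩ := hζ.bound
  obtain ⟨D, hD, k⟩ := hη.bound
  have hd : ∀ x, deriv (fun x => ζ x * η x) x = deriv ζ x * η x + ζ x * deriv η x := fun x =>
    deriv_fun_mul (differentiable_of_smooth hζ.smooth x) (differentiable_of_smooth hη.smooth x)
  refine ⟨hζ.smooth.mul hη.smooth, ?_, 4 * (C * D), by positivity, fun x hx => ?_⟩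
  · rw [hd, hζ.zero, hη.zero, zero_mul, mul_zero, add_zero]
  · have hp : ∀ a b : ℂ, ‖a‖ ≤ C * Real.exp (-x) → ‖b‖ ≤ D * Real.exp (-x) →
        ‖a * b‖ ≤ C * D * Real.exp (-x) := fun a b ha hb => by
      rw [norm_mul]
      have hb' : ‖b‖ ≤ D := hb.trans (mul_le_of_le_one_right hD
        (Real.exp_le_one_iff.mpr (by linarith)))
      calc ‖a‖ * ‖b‖ ≤ (C * Real.exp (-x)) * D := by gcongr
        _ = _ := by ring
    obtain ⟨a0, a1, a2⟩ := h x hx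
    obtain ⟨b0, b1, b2⟩ := k x hx
    have hE := Real.exp_pos (-x)
    have hCD : 0 ≤ C * D * Real.exp (-x) := by positivity
    refine ⟨(hp _ _ a0 b0).trans (by linarith), ?_, ?_⟩
    · rw [hd]
      refine (norm_add_le _ _).trans ?_
      linarith [hp _ _ a1 b0, hp _ _ a0 b1]
    · rw [deriv_deriv_mul (hζ.smooth.contDiffAt.of_le two_le_smooth)
        (hη.smooth.contDiffAt.of_le two_le_smooth)]
      refine (norm_add₃_le).trans ?_
      rw [norm_mul 2, Complex.norm_ofNat]
      linarith [hp _ _ a2 b0, hp _ _ a1 b1, hp _ _ a0 b2]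

theorem isCutoff_of_compact {ζ : ℝ → ℂ} (hζ : ContDiff ℝ (⊤ : ℕ∞) ζ) (hc : HasCompactSupport ζ)
    (h0 : deriv ζ 0 = 0) : IsCutoff ζ := by
  refine ⟨hζ, h0, ?_⟩
  have hb : ∀ f : ℝ → ℂ, Continuous f → HasCompactSupport f → ∃ C : ℝ, ∀ x,
      ‖f x‖ ≤ C * Real.exp (-x) := fun f hf hcf => by
    have hE : Continuous fun x : ℝ => ((Real.exp x : ℝ) : ℂ) := by fun_prop
    obtain ⟨C, hC⟩ := (hcf.mul_right (f' := fun x : ℝ => ((Real.exp x : ℝ) : ℂ))).exists_bound_of_continuous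
      (hf.mul hE)
    refine ⟨C, fun x => ?_⟩
    have := hC x
    rw [Pi.mul_apply, norm_mul, Complex.norm_real, Real.norm_of_nonneg (Real.exp_pos x).le] at this
    rw [Real.exp_neg, ← div_eq_mul_inv, le_div_iff₀ (Real.exp_pos x)]
    exact this
  have s1 := contDiff_deriv hζ
  obtain ⟨A, hA⟩ := hb ζ hζ.continuous hc
  obtain ⟨B, hB⟩ := hb (deriv ζ) s1.continuous hc.deriv
  obtain ⟨D, hD⟩ := hb (deriv (deriv ζ)) (contDiff_deriv s1).continuous hc.deriv.deriv
  refine ⟨|A| + |B| + |D|, by positivity, fun x _ => ?_⟩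
  have hle : ∀ a b : ℝ, a ≤ b → a * Real.exp (-x) ≤ b * Real.exp (-x) := fun a b h =>
    mul_le_mul_of_nonneg_right h (Real.exp_pos _).le
  exact ⟨(hA x).trans (hle _ _ (by linarith [le_abs_self A, abs_nonneg B, abs_nonneg D])),
    (hB x).trans (hle _ _ (by linarith [le_abs_self B, abs_nonneg A, abs_nonneg D])),
    (hD x).trans (hle _ _ (by linarith [le_abs_self D, abs_nonneg B, abs_nonneg A]))⟩

/-! ### Compactly supported and Gaussian cutoffs. -/

/-- The bump function supported in `[-2δ, 2δ]` and equal to `1` on `[-δ, δ]`. -/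
def nearZero (δ x : ℝ) : ℂ := bump (x / δ)

theorem nearZero_eq_one {δ x : ℝ} (hδ : 0 < δ) (hx : |x| ≤ δ) : nearZero δ x = 1 :=
  bump_eq_one (by rwa [abs_div, abs_of_pos hδ, div_le_one hδ])

theorem nearZero_eq_zero {δ x : ℝ} (hδ : 0 < δ) (hx : 2 * δ ≤ |x|) : nearZero δ x = 0 :=
  bump_eq_zero (by rwa [abs_div, abs_of_pos hδ, le_div_iff₀ hδ])

theorem isCutoff_nearZero {δ : ℝ} (hδ : 0 < δ) : IsCutoff (nearZero δ) := by
  refine isCutoff_of_compact (bump_contDiff.comp (contDiff_id.div_const δ)) ?_ ?_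
  · refine HasCompactSupport.of_support_subset_isCompact
      (isCompact_Icc (a := -(2 * δ)) (b := 2 * δ)) fun x hx => ?_
    by_contra h
    refine hx (nearZero_eq_zero hδ ?_)
    rw [mem_Icc, ← abs_le, not_le] at h
    exact h.le
  · have : nearZero δ =ᶠ[𝓝 0] fun _ => 1 := by
      have hm : Icc (-δ) δ ∈ 𝓝 (0 : ℝ) := Icc_mem_nhds (by linarith) hδ
      filter_upwards [hm] with x hx
      exact nearZero_eq_one hδ (abs_le.mpr hx)
    rw [this.deriv_eq, deriv_const]

/-- The Gaussian `e^{-s x²/2}`. -/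
def gaussCut (s x : ℝ) : ℂ := (Real.exp (-(s * x ^ 2 / 2)) : ℝ)

theorem hasDerivAt_gaussCut (s x : ℝ) : HasDerivAt (gaussCut s) (-(s * x) * gaussCut s x) x := by
  have h1 : HasDerivAt (fun x : ℝ => -(s * x ^ 2 / 2)) (-(s * x)) x := by
    have := ((((hasDerivAt_id x).pow 2).const_mul s).div_const 2).neg
    refine this.congr_deriv ?_
    simp
    ring
  refine (h1.exp.ofReal_comp).congr_deriv ?_
  rw [gaussCut]
  push_cast
  ring

theorem deriv_gaussCut (s : ℝ) : deriv (gaussCut s) = fun x : ℝ => -(s * x) * gaussCut s x :=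
  funext fun x => (hasDerivAt_gaussCut s x).deriv

theorem deriv_deriv_gaussCut (s x : ℝ) :
    deriv (deriv (gaussCut s)) x = (s ^ 2 * x ^ 2 - s) * gaussCut s x := by
  rw [deriv_gaussCut]
  have h1 : HasDerivAt (fun x : ℝ => -((s : ℂ) * (x : ℂ))) (-(s : ℂ)) x := by
    refine (((hasDerivAt_id x).ofReal_comp.const_mul (s : ℂ)).neg).congr_deriv ?_
    simp
  refine (h1.mul (hasDerivAt_gaussCut s x)).deriv.trans ?_
  ring

theorem exists_gauss_bound {s : ℝ} (hs : 0 < s) : ∃ C : ℝ, 0 ≤ C ∧ ∀ x : ℝ, 0 ≤ x →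
    (1 + x + x ^ 2) * Real.exp (-(s * x ^ 2 / 2)) ≤ C * Real.exp (-x) := by
  -- The polynomial is at most `2 e^x`, and `2x - s x²/2 ≤ 2/s` by completing the square.
  refine ⟨2 * Real.exp (2 / s), by positivity, fun x hx => ?_⟩
  have h1 : 1 + x + x ^ 2 ≤ 2 * Real.exp x := by
    have := Real.quadratic_le_exp_of_nonneg hx
    nlinarith
  calc (1 + x + x ^ 2) * Real.exp (-(s * x ^ 2 / 2))
      ≤ 2 * Real.exp x * Real.exp (-(s * x ^ 2 / 2)) :=
        mul_le_mul_of_nonneg_right h1 (Real.exp_pos _).le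
    _ = 2 * Real.exp (x + -(s * x ^ 2 / 2)) := by rw [Real.exp_add]; ring
    _ ≤ 2 * Real.exp (2 / s + -x) := by
      refine mul_le_mul_of_nonneg_left (Real.exp_le_exp.mpr ?_) two_pos.le
      have : 2 / s + -x - (x + -(s * x ^ 2 / 2)) = (s * x - 2) ^ 2 / (2 * s) := by
        field_simp
        ring
      have h2 : 0 ≤ (s * x - 2) ^ 2 / (2 * s) := by positivity
      linarith
    _ = _ := by rw [Real.exp_add]; ring

theorem isCutoff_gaussCut {s : ℝ} (hs : 0 < s) : IsCutoff (gaussCut s) := by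
  obtain ⟨C, hC, h⟩ := exists_gauss_bound hs
  refine ⟨?_, by simp [deriv_gaussCut], (1 + s + s ^ 2) * C, by positivity, fun x hx => ?_⟩
  · have h : ContDiff ℝ (⊤ : ℕ∞) fun x : ℝ => Real.exp (-(s * x ^ 2 / 2)) :=
      Real.contDiff_exp.comp (by fun_prop)
    exact Complex.ofRealCLM.contDiff.comp h
  · have hn : ‖gaussCut s x‖ = Real.exp (-(s * x ^ 2 / 2)) := by
      rw [gaussCut, Complex.norm_real, Real.norm_of_nonneg (Real.exp_pos _).le]
    have hE := Real.exp_pos (-(s * x ^ 2 / 2))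
    have hk : ∀ a : ℂ, ‖a‖ ≤ (1 + s + s ^ 2) * (1 + x + x ^ 2) →
        ‖a * gaussCut s x‖ ≤ (1 + s + s ^ 2) * C * Real.exp (-x) := fun a ha => by
      rw [norm_mul, hn]
      calc _ ≤ (1 + s + s ^ 2) * (1 + x + x ^ 2) * Real.exp (-(s * x ^ 2 / 2)) := by gcongr
        _ ≤ _ := by
          rw [mul_assoc, mul_assoc]
          exact mul_le_mul_of_nonneg_left (h x hx) (by positivity)
    refine ⟨?_, ?_, ?_⟩
    · rw [← one_mul (gaussCut s x)]
      refine hk 1 ?_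
      rw [norm_one]
      nlinarith [mul_nonneg hs.le hx, sq_nonneg s, sq_nonneg x, mul_nonneg (sq_nonneg s) hx]
    · rw [deriv_gaussCut]
      refine hk _ ?_
      rw [norm_neg, norm_mul, Complex.norm_real, Complex.norm_real, Real.norm_of_nonneg hs.le,
        Real.norm_of_nonneg hx]
      have : 0 ≤ 1 + x + x ^ 2 + (1 + x ^ 2) * s + s ^ 2 * (1 + x + x ^ 2) := by positivity
      nlinarith
    · rw [deriv_deriv_gaussCut]
      refine hk _ ((norm_sub_le _ _).trans ?_)
      rw [norm_mul, norm_pow, norm_pow, Complex.norm_real, Complex.norm_real,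
        Real.norm_of_nonneg hs.le, Real.norm_of_nonneg hx]
      have : 0 ≤ 1 + x + x ^ 2 + (x + x ^ 2) * s + s ^ 2 * (1 + x) := by positivity
      nlinarith

/-! ### Cut off solutions in the maximal and minimal graphs. -/

/-- The pair `(ζ u, L_α (ζ u))`. -/
def cutPair (α : ℂ) (ζ u : ℝ → ℂ) : L2 × L2 :=
  (toL2 fun x => ζ x * u x, toL2 (Lexpr α fun x => ζ x * u x))

/-- The comparison function `x^{δ-1/2} e^{-x/2}` is square integrable because `δ > 0`. The rate
`1/2` is what remains of the decay `e^{-x}` of a cutoff after the growth `e^{x/2}` allowed to a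
solution. -/
theorem memLp_of_rpow_exp {f : ℝ → ℂ} (hf : ContinuousOn f (Ioi 0)) {δ C : ℝ} (hδ : 0 < δ)
    (h : ∀ x, 0 < x → ‖f x‖ ≤ C * (x ^ (δ - 1 / 2) * Real.exp (-(x / 2)))) : MemLp f 2 hμ := by
  have hg := memLp_cpow_exp (w := ((δ - 1 / 2 : ℝ) : ℂ)) (c := 1 / 2)
    (by rw [Complex.ofReal_re]; linarith) (by norm_num)
  refine hg.of_le_mul (c := C) (hf.aestronglyMeasurable measurableSet_Ioi) ?_
  filter_upwards [ae_restrict_mem measurableSet_Ioi] with x hx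
  have hx' : 0 < x := hx
  rw [norm_mul, Complex.norm_cpow_eq_rpow_re_of_pos hx', Complex.ofReal_re, Complex.norm_real,
    Real.norm_of_nonneg (Real.exp_pos _).le, show (1 / 2 : ℝ) * x = x / 2 by ring]
  exact h x hx'

section
variable {α : ℂ} {u ζ η : ℝ → ℂ}

theorem IsSolution.Lexpr_mul (hu : IsSolution α u) (hζ : IsCutoff ζ) {x : ℝ} (hx : 0 < x) :
    Lexpr α (fun y => ζ y * u y) x =
      -(deriv (deriv ζ) x * u x) - 2 * (deriv ζ x * deriv u x) := by
  rw [RankOneBessel.Lexpr_mul α (hζ.smooth.contDiffAt.of_le two_le_smooth)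
    ((hu.smooth.contDiffAt (Ioi_mem_nhds hx)).of_le two_le_smooth), hu.eq x hx]
  ring

theorem IsSolution.deriv_smooth (hu : IsSolution α u) : ContDiffOn ℝ (⊤ : ℕ∞) (deriv u) (Ioi 0) :=
  ((contDiffOn_infty_iff_deriv_of_isOpen isOpen_Ioi).mp hu.smooth).2

theorem exp_half (x : ℝ) : Real.exp (-x) * Real.exp (x / 2) = Real.exp (-(x / 2)) := by
  rw [← Real.exp_add]
  congr 1
  ring

theorem IsSolution.smooth_mul (hu : IsSolution α u) (hζ : IsCutoff ζ) :
    ContDiffOn ℝ (⊤ : ℕ∞) (fun x => ζ x * u x) (Ioi 0) := hζ.smooth.contDiffOn.mul hu.smooth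

theorem IsSolution.memLp_mul (hu : IsSolution α u) (hζ : IsCutoff ζ) :
    MemLp (fun x => ζ x * u x) 2 hμ := by
  obtain ⟨δ, hδ, C, hC, h⟩ := hu.bound
  obtain ⟨D, hD, k⟩ := hζ.bound
  refine memLp_of_rpow_exp (hu.smooth_mul hζ).continuousOn hδ (C := D * C) fun x hx => ?_
  rw [norm_mul, ← exp_half]
  calc _ ≤ (D * Real.exp (-x)) * (C * (x ^ (δ - 1 / 2) * Real.exp (x / 2))) :=
        mul_le_mul (k x hx.le).1 (h x hx).1 (norm_nonneg _) (by positivity)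
    _ = _ := by ring

theorem IsSolution.memLp_Lexpr (hu : IsSolution α u) (hζ : IsCutoff ζ) :
    MemLp (Lexpr α fun x => ζ x * u x) 2 hμ := by
  obtain ⟨δ, hδ, C, hC, h⟩ := hu.bound
  obtain ⟨D, hD, k⟩ := hζ.deriv_bound
  have hm : MemLp (fun x => -(deriv (deriv ζ) x * u x) - 2 * (deriv ζ x * deriv u x)) 2 hμ := by
    have s1 := contDiff_deriv hζ.smooth
    refine memLp_of_rpow_exp (((contDiff_deriv s1).continuous.continuousOn.mul
      hu.smooth.continuousOn).neg.sub (continuousOn_const.mul (s1.continuous.continuousOn.mul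
      hu.deriv_smooth.continuousOn))) hδ (C := 3 * (D * C)) fun x hx => ?_
    refine (norm_sub_le _ _).trans ?_
    rw [norm_neg, norm_mul, norm_mul, norm_mul, Complex.norm_ofNat, ← exp_half]
    obtain ⟨k0, k1, k2⟩ := k x hx.le
    have e1 : ‖deriv (deriv ζ) x‖ * ‖u x‖ ≤
        (D * Real.exp (-x)) * (C * (x ^ (δ - 1 / 2) * Real.exp (x / 2))) :=
      mul_le_mul k2 (h x hx).1 (norm_nonneg _) (by positivity)
    have e2 : ‖deriv ζ x‖ * ‖deriv u x‖ ≤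
        (D * (x ^ 1 * Real.exp (-x))) * (C * (x ^ (δ - 1 / 2) * Real.exp (x / 2)) / x) :=
      mul_le_mul k1 (h x hx).2 (norm_nonneg _) (by positivity)
    have e3 : (D * (x ^ 1 * Real.exp (-x))) * (C * (x ^ (δ - 1 / 2) * Real.exp (x / 2)) / x) =
        (D * Real.exp (-x)) * (C * (x ^ (δ - 1 / 2) * Real.exp (x / 2))) := by
      field_simp
    rw [e3] at e2
    linarith
  refine hm.ae_eq ?_
  filter_upwards [ae_restrict_mem measurableSet_Ioi] with x hx
  exact (hu.Lexpr_mul hζ hx).symm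

theorem IsSolution.cutPair_mem_graphMax (hu : IsSolution α u) (hζ : IsCutoff ζ) :
    cutPair α ζ u ∈ graphMax α :=
  mem_graphMax_of_contDiffOn (hu.smooth_mul hζ) (hu.memLp_mul hζ) (hu.memLp_Lexpr hζ)

/-- A cutoff with `ζ 0 = ζ' 0 = 0` is `O(x²)`, so `ζ u / x²` and `(ζ u)' / x` are still
`O(x^{δ-1/2})` and the criterion by logarithmic cutoffs applies. Consequently, modulo the minimal
graph, a cut off solution depends on its cutoff only through `ζ 0`; Gaussians of all widths and
compactly supported bumps become interchangeable. -/
theorem IsSolution.cutPair_mem_graphMin (hu : IsSolution α u) (hζ : IsCutoff ζ) (h0 : ζ 0 = 0) :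
    cutPair α ζ u ∈ graphMin α := by
  obtain ⟨δ, hδ, C, hC, h⟩ := hu.bound
  obtain ⟨D, hD, k⟩ := hζ.deriv_bound
  obtain ⟨B, hB, l⟩ := hζ.vanish_bound h0
  have hid : ContinuousOn (fun x : ℝ => (x : ℂ)) (Ioi 0) := Complex.continuous_ofReal.continuousOn
  have hne : ∀ x ∈ Ioi (0 : ℝ), (x : ℂ) ≠ 0 := fun x hx => Complex.ofReal_ne_zero.mpr (ne_of_gt hx)
  refine mem_graphMin_of_contDiffOn (hu.smooth_mul hζ) (hu.memLp_mul hζ) ?_ ?_ (hu.memLp_Lexpr hζ)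
  · refine memLp_of_rpow_exp ?_ hδ (C := (D + B) * C) fun x hx => ?_
    · exact ((contDiffOn_infty_iff_deriv_of_isOpen isOpen_Ioi).mp
        (hu.smooth_mul hζ)).2.continuousOn.div hid hne
    · have hd : deriv (fun x => ζ x * u x) x = deriv ζ x * u x + ζ x * deriv u x :=
        deriv_fun_mul (differentiable_of_smooth hζ.smooth x)
          ((hu.smooth.contDiffAt (Ioi_mem_nhds hx)).differentiableAt (by simp))
      rw [hd, norm_div, Complex.norm_real, Real.norm_of_nonneg hx.le, div_le_iff₀ hx, ← exp_half]
      refine (norm_add_le _ _).trans ?_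
      rw [norm_mul, norm_mul]
      have e1 : ‖deriv ζ x‖ * ‖u x‖ ≤
          (D * (x ^ 1 * Real.exp (-x))) * (C * (x ^ (δ - 1 / 2) * Real.exp (x / 2))) :=
        mul_le_mul (k x hx.le).2.1 (h x hx).1 (norm_nonneg _) (by positivity)
      have e2 : ‖ζ x‖ * ‖deriv u x‖ ≤
          (B * (x ^ 2 * Real.exp (-x))) * (C * (x ^ (δ - 1 / 2) * Real.exp (x / 2)) / x) :=
        mul_le_mul (l x hx.le) (h x hx).2 (norm_nonneg _) (by positivity)
      refine (add_le_add e1 e2).trans (le_of_eq ?_)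
      field_simp
  · refine memLp_of_rpow_exp ?_ hδ (C := B * C) fun x hx => ?_
    · exact (hu.smooth_mul hζ).continuousOn.div (hid.pow 2) fun x hx => pow_ne_zero 2 (hne x hx)
    · rw [norm_div, norm_mul, norm_pow, Complex.norm_real, Real.norm_of_nonneg hx.le,
        div_le_iff₀ (by positivity), ← exp_half]
      refine (mul_le_mul (l x hx.le) (h x hx).1 (norm_nonneg _) (by positivity)).trans
        (le_of_eq ?_)
      ring

theorem IsSolution.cutPair_sub (hu : IsSolution α u) (hζ : IsCutoff ζ) (hη : IsCutoff η) :
    cutPair α (fun x => ζ x - η x) u = cutPair α ζ u - cutPair α η u := by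
  rw [cutPair, cutPair, cutPair, Prod.mk_sub_mk, ← toL2_sub (hu.memLp_mul hζ) (hu.memLp_mul hη),
    ← toL2_sub (hu.memLp_Lexpr hζ) (hu.memLp_Lexpr hη)]
  refine Prod.ext (toL2_congr_pos fun x _ => ?_) (toL2_congr_pos fun x hx => ?_)
  · simp only [sub_mul]
  · rw [hu.Lexpr_mul hζ hx, hu.Lexpr_mul hη hx, hu.Lexpr_mul (hζ.sub hη) hx,
      deriv_deriv_sub' hζ.smooth hη.smooth,
      deriv_deriv_sub' (contDiff_deriv hζ.smooth) (contDiff_deriv hη.smooth)]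
    ring

end

/-! ### The explicit solutions -/

theorem hasDerivAt_cpow {w : ℂ} {x : ℝ} (hx : 0 < x) :
    HasDerivAt (fun y : ℝ => (y : ℂ) ^ w) (w * (x : ℂ) ^ (w - 1)) x := by
  have := (hasDerivAt_id (x : ℂ)).cpow_const (c := w) (Complex.ofReal_mem_slitPlane.mpr hx)
  simpa using this.comp_ofReal

theorem contDiffOn_cpow (w : ℂ) : ContDiffOn ℝ (⊤ : ℕ∞) (fun y : ℝ => (y : ℂ) ^ w) (Ioi 0) := by
  have h : ContDiffOn ℝ (⊤ : ℕ∞) (fun y : ℝ => Complex.exp ((Real.log y : ℝ) * w)) (Ioi 0) := by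
    intro x hx
    have hl : ContDiffAt ℝ (⊤ : ℕ∞) Real.log x := Real.contDiffAt_log.mpr (ne_of_gt hx)
    have h2 : ContDiffAt ℝ (⊤ : ℕ∞) (fun y : ℝ => ((Real.log y : ℝ) : ℂ)) x :=
      Complex.ofRealCLM.contDiff.contDiffAt.comp x hl
    exact ((h2.mul contDiffAt_const).cexp).contDiffWithinAt
  refine h.congr fun x hx => ?_
  have hx' : 0 < x := hx
  rw [Complex.cpow_def_of_ne_zero (Complex.ofReal_ne_zero.mpr hx'.ne'), Complex.ofReal_log hx'.le]

theorem cpow_sub_one_eq {w : ℂ} {x : ℝ} (hx : 0 < x) :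
    (x : ℂ) ^ (w - 1) = (x : ℂ) ^ w / x := by
  rw [Complex.cpow_sub _ _ (Complex.ofReal_ne_zero.mpr hx.ne'), Complex.cpow_one]

theorem exists_rpow_le_exp {k : ℝ} (hk : 0 ≤ k) :
    ∃ C : ℝ, 0 ≤ C ∧ ∀ x : ℝ, 0 < x → x ^ k ≤ C * Real.exp (x / 2) := by
  refine ⟨(2 * (k + 1)) ^ k, by positivity, fun x hx => ?_⟩
  have h1 : x ≤ 2 * (k + 1) * Real.exp (x / (2 * (k + 1))) := by
    have := Real.add_one_le_exp (x / (2 * (k + 1)))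
    calc x = 2 * (k + 1) * (x / (2 * (k + 1))) := by field_simp
      _ ≤ _ := by gcongr; linarith
  refine (Real.rpow_le_rpow hx.le h1 hk).trans ?_
  rw [Real.mul_rpow (by positivity) (Real.exp_pos _).le, ← Real.exp_mul]
  gcongr
  rw [div_mul_eq_mul_div, div_le_div_iff₀ (by positivity) two_pos]
  nlinarith

theorem deriv_cpow {w : ℂ} {x : ℝ} (hx : 0 < x) :
    deriv (fun x : ℝ => (x : ℂ) ^ w) x = w * (x : ℂ) ^ (w - 1) := (hasDerivAt_cpow hx).deriv

theorem solutionBound_cpow {m : ℂ} {δ : ℝ} (hδ : δ ≤ 1 + m.re) :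
    SolutionBound δ fun x : ℝ => (x : ℂ) ^ (1 / 2 + m) := by
  obtain ⟨C, hC, h⟩ := exists_rpow_le_exp (sub_nonneg.mpr hδ)
  have hn : ∀ x : ℝ, 0 < x →
      ‖(x : ℂ) ^ (1 / 2 + m)‖ ≤ C * (x ^ (δ - 1 / 2) * Real.exp (x / 2)) := fun x hx => by
    have e : (1 / 2 + m).re = (δ - 1 / 2) + (1 + m.re - δ) := by
      simp
      ring
    rw [Complex.norm_cpow_eq_rpow_re_of_pos hx, e, Real.rpow_add hx, mul_left_comm]
    exact mul_le_mul_of_nonneg_left (h x hx) (Real.rpow_pos_of_pos hx _).le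
  refine ⟨(1 + ‖1 / 2 + m‖) * C, by positivity, fun x hx => ?_⟩
  have h0 := norm_nonneg (1 / 2 + m)
  have h1 := hn x hx
  have h2 := norm_nonneg ((x : ℂ) ^ (1 / 2 + m))
  constructor
  · nlinarith
  · rw [deriv_cpow hx, cpow_sub_one_eq hx, norm_mul, norm_div, Complex.norm_real,
      Real.norm_of_nonneg hx.le, ← mul_div_assoc]
    refine div_le_div_of_nonneg_right ?_ hx.le
    nlinarith

theorem isSolution_cpow {m : ℂ} (hm : -1 < m.re) :
    IsSolution (m ^ 2) fun x : ℝ => (x : ℂ) ^ (1 / 2 + m) := by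
  refine ⟨contDiffOn_cpow _, fun x hx => ?_, 1 + m.re, by linarith, solutionBound_cpow le_rfl⟩
  have h2 : deriv (fun x : ℝ => (x : ℂ) ^ (1 / 2 + m)) =ᶠ[𝓝 x]
      fun x : ℝ => (1 / 2 + m) * (x : ℂ) ^ (1 / 2 + m - 1) := by
    filter_upwards [Ioi_mem_nhds hx] with y hy
    exact deriv_cpow hy
  have hx0 : (x : ℂ) ≠ 0 := Complex.ofReal_ne_zero.mpr hx.ne'
  rw [Lexpr, iteratedDeriv_two, h2.deriv_eq, ((hasDerivAt_cpow hx).const_mul _).deriv,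
    cpow_sub_one_eq hx, cpow_sub_one_eq hx]
  field_simp
  ring

/-- The second solution for `m = 0`. -/
def logSol (x : ℝ) : ℂ := (x : ℂ) ^ (1 / 2 : ℂ) * Real.log x

theorem hasDerivAt_logSol {x : ℝ} (hx : 0 < x) :
    HasDerivAt logSol ((1 / 2 * Real.log x + 1) * (x : ℂ) ^ (1 / 2 - 1 : ℂ)) x := by
  have h := (hasDerivAt_cpow (w := 1 / 2) hx).mul (Real.hasDerivAt_log hx.ne').ofReal_comp
  refine h.congr_deriv ?_
  have hx0 : (x : ℂ) ≠ 0 := Complex.ofReal_ne_zero.mpr hx.ne'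
  rw [cpow_sub_one_eq hx]
  push_cast
  field_simp

theorem solutionBound_logSol : SolutionBound (1 / 2) logSol := by
  -- The bounds `√x |ln x| ≤ 4 e^{x/2}` and `√x ≤ 2 e^{x/2}` proved here need only the constant `4`;
  -- no sharpness is intended.
  refine ⟨10, by norm_num, fun x hx => ?_⟩
  have hs : 0 < Real.sqrt x := Real.sqrt_pos.mpr hx
  have hn : ‖(x : ℂ) ^ (1 / 2 : ℂ)‖ = Real.sqrt x := by
    rw [Complex.norm_cpow_eq_rpow_re_of_pos hx, Real.sqrt_eq_rpow]
    congr 1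
    simp
  have hx2 : x ≤ 2 * Real.exp (x / 2) := by
    have := Real.add_one_le_exp (x / 2)
    linarith
  have he : 1 ≤ Real.exp (x / 2) := Real.one_le_exp (by positivity)
  have h1 : Real.sqrt x * |Real.log x| ≤ 4 * Real.exp (x / 2) := by
    rcases le_or_gt x 1 with hx1 | hx1
    · have := (Real.abs_log_mul_self_rpow_lt x (1 / 2) hx hx1 (by norm_num)).le
      rw [abs_mul, ← Real.sqrt_eq_rpow, abs_of_pos hs] at this
      norm_num at this
      linarith
    · have hl : Real.log x ≤ 2 * Real.sqrt x := by
        have := Real.log_le_rpow_div hx.le (ε := 1 / 2) (by norm_num)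
        rw [← Real.sqrt_eq_rpow] at this
        linarith
      rw [abs_of_nonneg (Real.log_nonneg hx1.le)]
      have := Real.mul_self_sqrt hx.le
      nlinarith
  have h2 : Real.sqrt x ≤ 2 * Real.exp (x / 2) := by
    have := Real.sq_sqrt hx.le
    nlinarith [sq_nonneg (Real.sqrt x - 1)]
  rw [show (1 / 2 - 1 / 2 : ℝ) = 0 by norm_num, Real.rpow_zero, one_mul]
  constructor
  · rw [logSol, norm_mul, hn, Complex.norm_real, Real.norm_eq_abs]
    linarith
  · rw [(hasDerivAt_logSol hx).deriv, cpow_sub_one_eq hx, norm_mul, norm_div, hn,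
      Complex.norm_real, Real.norm_of_nonneg hx.le, ← mul_div_assoc]
    refine div_le_div_of_nonneg_right ?_ hx.le
    have h3 : ‖(1 / 2 * (Real.log x : ℂ) + 1)‖ ≤ 1 / 2 * |Real.log x| + 1 := by
      refine (norm_add_le _ _).trans ?_
      rw [norm_mul, norm_one, Complex.norm_real, Real.norm_eq_abs]
      norm_num
    calc _ ≤ (1 / 2 * |Real.log x| + 1) * Real.sqrt x := by gcongr
      _ ≤ _ := by nlinarith

theorem isSolution_logSol : IsSolution 0 logSol := by
  refine ⟨?_, fun x hx => ?_, 1 / 2, by norm_num, solutionBound_logSol⟩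
  · refine (contDiffOn_cpow _).mul fun x hx => ?_
    have hl : ContDiffAt ℝ (⊤ : ℕ∞) Real.log x := Real.contDiffAt_log.mpr (ne_of_gt hx)
    exact (Complex.ofRealCLM.contDiff.contDiffAt.comp x hl).contDiffWithinAt
  · have h2 : deriv logSol =ᶠ[𝓝 x]
        fun x : ℝ => (1 / 2 * Real.log x + 1) * (x : ℂ) ^ (1 / 2 - 1 : ℂ) := by
      filter_upwards [Ioi_mem_nhds hx] with y hy
      exact (hasDerivAt_logSol hy).deriv
    have hx0 : (x : ℂ) ≠ 0 := Complex.ofReal_ne_zero.mpr hx.ne'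
    have h3 : HasDerivAt (fun x : ℝ => (1 / 2 * Real.log x + 1) * (x : ℂ) ^ (1 / 2 - 1 : ℂ))
        ((1 / 2 * ((x⁻¹ : ℝ) : ℂ)) * (x : ℂ) ^ (1 / 2 - 1 : ℂ) + (1 / 2 * Real.log x + 1) *
        ((1 / 2 - 1) * (x : ℂ) ^ (1 / 2 - 1 - 1 : ℂ))) x :=
      (((Real.hasDerivAt_log hx.ne').ofReal_comp.const_mul (1 / 2 : ℂ)).add_const 1).mul
        (hasDerivAt_cpow hx)
    rw [Lexpr, iteratedDeriv_two, h2.deriv_eq, h3.deriv, cpow_sub_one_eq (w := 1 / 2 - 1) hx,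
      cpow_sub_one_eq (w := 1 / 2) hx, logSol]
    push_cast
    field_simp
    ring

/-! ### The boundary form -/

/-- The boundary form `⟨p₁, q₂⟩ - ⟨p₂, q₁⟩` of two pairs. -/
def bdryForm (p q : L2 × L2) : ℂ := pairing p.1 q.2 - pairing p.2 q.1

theorem bdryForm_neg_comm (p q : L2 × L2) : bdryForm p q = -bdryForm q p := by
  rw [bdryForm, bdryForm, pairing_comm p.1, pairing_comm p.2]
  ring

theorem bdryForm_self (p : L2 × L2) : bdryForm p p = 0 := by
  rw [bdryForm, pairing_comm, sub_self]

theorem bdryForm_add_right (p q r : L2 × L2) :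
    bdryForm p (q + r) = bdryForm p q + bdryForm p r := by
  simp only [bdryForm, Prod.fst_add, Prod.snd_add, map_add]
  ring

theorem bdryForm_sub_right (p q r : L2 × L2) :
    bdryForm p (q - r) = bdryForm p q - bdryForm p r := by
  simp only [bdryForm, Prod.fst_sub, Prod.snd_sub, map_sub]
  ring

theorem bdryForm_smul_right (c : ℂ) (p q : L2 × L2) :
    bdryForm p (c • q) = c * bdryForm p q := by
  simp only [bdryForm, Prod.smul_fst, Prod.smul_snd, map_smul, smul_eq_mul]
  ring

theorem bdryForm_add_left (p q r : L2 × L2) :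
    bdryForm (p + q) r = bdryForm p r + bdryForm q r := by
  rw [bdryForm_neg_comm, bdryForm_add_right, bdryForm_neg_comm p, bdryForm_neg_comm q]
  ring

theorem bdryForm_sub_left (p q r : L2 × L2) :
    bdryForm (p - q) r = bdryForm p r - bdryForm q r := by
  rw [bdryForm_neg_comm, bdryForm_sub_right, bdryForm_neg_comm p, bdryForm_neg_comm q]
  ring

theorem bdryForm_smul_left (c : ℂ) (p q : L2 × L2) :
    bdryForm (c • p) q = c * bdryForm p q := by
  rw [bdryForm_neg_comm, bdryForm_smul_right, bdryForm_neg_comm p]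
  ring

theorem continuous_bdryForm_right (p : L2 × L2) : Continuous fun q => bdryForm p q :=
  ((pairing p.1).continuous.comp continuous_snd).sub ((pairing p.2).continuous.comp continuous_fst)

theorem continuous_bdryForm_left (q : L2 × L2) : Continuous fun p => bdryForm p q := by
  simp_rw [fun p => bdryForm_neg_comm p q]
  exact (continuous_bdryForm_right q).neg

/-- The maximal graph is the annihilator of the test functions for the boundary form. -/
theorem mem_graphMax_iff {α : ℂ} {p : L2 × L2} :
    p ∈ graphMax α ↔ ∀ φ, IsTest φ → bdryForm p (toL2 φ, toL2 (Lexpr α φ)) = 0 := by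
  refine forall₂_congr fun φ hφ => ?_
  rw [bdryForm, pairing_toL2_right _ (hφ.memLp_Lexpr α), pairing_toL2_right _ hφ.memLp,
    sub_eq_zero]

theorem graphTest_eq {α : ℂ} {q : L2 × L2} (hq : q ∈ graphTest α) :
    ∃ φ, IsTest φ ∧ q = (toL2 φ, toL2 (Lexpr α φ)) := by
  obtain ⟨φ, hφ, h1, h2⟩ := hq
  exact ⟨φ, hφ, Prod.ext (eq_toL2 h1) (eq_toL2 h2)⟩

theorem bdryForm_graphTest {α : ℂ} {p q : L2 × L2} (hp : p ∈ graphMax α) (hq : q ∈ graphTest α) :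
    bdryForm p q = 0 := by
  obtain ⟨φ, hφ, rfl⟩ := graphTest_eq hq
  exact mem_graphMax_iff.mp hp φ hφ

theorem bdryForm_graphMin {α : ℂ} {p q : L2 × L2} (hp : p ∈ graphMax α) (hq : q ∈ graphMin α) :
    bdryForm p q = 0 := by
  have hc : IsClosed {q | bdryForm p q = 0} :=
    isClosed_eq (continuous_bdryForm_right p) continuous_const
  exact closure_minimal (fun q hq => bdryForm_graphTest hp hq) hc hq

theorem isTest_pair_mem (α : ℂ) {φ : ℝ → ℂ} (hφ : IsTest φ) :
    (toL2 φ, toL2 (Lexpr α φ)) ∈ graphTest α :=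
  ⟨φ, hφ, toL2_coe hφ.memLp, toL2_coe (hφ.memLp_Lexpr α)⟩

theorem graphMin_le_graphMax (α : ℂ) : graphMin α ≤ graphMax α := by
  intro q hq
  rw [mem_graphMax_iff]
  intro φ hφ
  have hc : IsClosed {q | bdryForm q (toL2 φ, toL2 (Lexpr α φ)) = 0} :=
    isClosed_eq (continuous_bdryForm_left _) continuous_const
  refine closure_minimal (fun q hq => ?_) hc hq
  obtain ⟨ψ, hψ, rfl⟩ := graphTest_eq hq
  exact bdryForm_graphTest (mem_graphMax_of_contDiffOn hψ.smooth.contDiffOn hψ.memLp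
    (hψ.memLp_Lexpr α)) (isTest_pair_mem α hφ)

/-- This is the bipolar theorem for the nondegenerate boundary form. The maximal graph is the
annihilator of the test graph, so what annihilates the maximal graph lies in the closed span of the
test graph, which is the minimal graph. -/
theorem mem_graphMin_of_bdryForm {α : ℂ} {p : L2 × L2}
    (h : ∀ q ∈ graphMax α, bdryForm p q = 0) : p ∈ graphMin α := by
  by_contra hp
  have hcl : IsClosed (graphMin α : Set (L2 × L2)) := Submodule.isClosed_topologicalClosure _
  have hne : (graphMin α).mkQ p ≠ 0 := by
    rwa [Ne, Submodule.mkQ_apply, Submodule.Quotient.mk_eq_zero]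
  -- A functional on the quotient by the minimal graph that is nonzero at the class of `p` separates
  -- `p` from that graph.
  obtain ⟨g, -, hg⟩ := exists_dual_vector ℂ ((graphMin α).mkQ p) (norm_ne_zero_iff.mpr hne)
  let ψ : L2 × L2 →L[ℂ] ℂ := g.comp (graphMin α).mkQL
  have hψp : ψ p ≠ 0 := by
    change g ((graphMin α).mkQ p) ≠ 0
    rw [hg]
    simpa using hne
  have hψ0 : ∀ q ∈ graphMin α, ψ q = 0 := fun q hq => by
    change g ((graphMin α).mkQ q) = 0
    rw [Submodule.mkQ_apply, (Submodule.Quotient.mk_eq_zero _).mpr hq, map_zero]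
  obtain ⟨a, ha⟩ := exists_eq_pairing (ψ.comp (ContinuousLinearMap.inl ℂ L2 L2))
  obtain ⟨b, hb⟩ := exists_eq_pairing (ψ.comp (ContinuousLinearMap.inr ℂ L2 L2))
  have hψ : ∀ q, ψ q = pairing a q.1 + pairing b q.2 := fun q => by
    rw [← ha, ← hb]
    change ψ q = ψ (ContinuousLinearMap.inl ℂ L2 L2 q.1) + ψ (ContinuousLinearMap.inr ℂ L2 L2 q.2)
    rw [← map_add]
    exact congrArg ψ (by simp)
  -- The separating functional is itself a boundary form. Its representing pair annihilates all test
  -- pairs and hence lies in the maximal graph, which contradicts the hypothesis on `p`.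
  have hform : ∀ q, bdryForm (b, -a) q = ψ q := fun q => by
    have : pairing (-a) q.1 = -pairing a q.1 := by
      rw [← neg_one_smul ℂ a, pairing_smul_left]
      ring
    rw [hψ, bdryForm, this]
    ring
  refine hψp ?_
  rw [← hform, bdryForm_neg_comm, h, neg_zero]
  rw [mem_graphMax_iff]
  intro φ hφ
  rw [hform]
  exact hψ0 _ (subset_closure (isTest_pair_mem α hφ))

/-- Elements of the graph of the maximal operator are local. -/
theorem graphMax_local {α : ℂ} {p : L2 × L2} (hp : p ∈ graphMax α) {ε : ℝ}
    (h : ∀ᵐ x ∂hμ, x < ε → p.1 x = 0) : ∀ᵐ x ∂hμ, x < ε → p.2 x = 0 := by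
  have hU : IsOpen (Ioo 0 ε) := isOpen_Ioo
  have hl : LocallyIntegrableOn (fun x => p.2 x) (Ioo 0 ε) hμ :=
    ((Lp.memLp p.2).locallyIntegrable (by norm_num)).locallyIntegrableOn _
  have key := hU.ae_eq_zero_of_integral_contDiff_smul_eq_zero hl (fun g hg hc hs => by
    have hsup : tsupport (fun x => (g x : ℂ)) ⊆ tsupport g := by
      refine closure_mono fun x hx hgx => hx ?_
      simp only [hgx, Complex.ofReal_zero]
    have hφ : IsTest fun x => (g x : ℂ) := ⟨Complex.ofRealCLM.contDiff.comp hg,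
      hc.of_isClosed_subset (isClosed_tsupport _) hsup,
      hsup.trans (hs.trans Ioo_subset_Ioi_self)⟩
    have h1 : ∫ x, p.2 x * (g x : ℂ) ∂hμ = ∫ x, p.1 x * Lexpr α (fun x => (g x : ℂ)) x ∂hμ :=
      (hp _ hφ).symm
    have h2 : ∫ x, p.1 x * Lexpr α (fun x => (g x : ℂ)) x ∂hμ = 0 := by
      refine integral_eq_zero_of_ae ?_
      filter_upwards [h] with x hx
      rcases lt_or_ge x ε with hxε | hxε
      · rw [hx hxε, zero_mul, Pi.zero_apply]
      · have hn : x ∉ tsupport fun x => (g x : ℂ) := fun hm => not_lt.mpr hxε (hs (hsup hm)).2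
        rw [Lexpr_congr α (notMem_tsupport_iff_eventuallyEq.mp hn), Pi.zero_apply]
        have := Lexpr_smul α 0 isTest_zero
        rw [zero_smul, zero_smul] at this
        rw [this, Pi.zero_apply, mul_zero]
    rw [← h1.trans h2]
    refine integral_congr_ae (Eventually.of_forall fun x => ?_)
    simp only [Complex.real_smul]
    ring)
  filter_upwards [key, ae_restrict_mem measurableSet_Ioi] with x hx hx0 hxε
  exact hx ⟨hx0, hxε⟩

theorem graphMax_functional {α : ℂ} {p : L2 × L2} (hp : p ∈ graphMax α) (h : p.1 = 0) :
    p.2 = 0 := by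
  have h1 : ∀ n : ℕ, ∀ᵐ x ∂hμ, x < (n : ℝ) → p.2 x = 0 := fun n => by
    refine graphMax_local hp ?_
    rw [h]
    filter_upwards [Lp.coeFn_zero ℂ 2 hμ] with x hx _ using hx
  refine Lp.eq_zero_iff_ae_eq_zero.mpr ?_
  filter_upwards [ae_all_iff.mpr h1] with x hx
  obtain ⟨n, hn⟩ := exists_nat_gt x
  exact hx n hn

/-- Passing from a subspace to an operator returns the same graph only if the subspace is single
valued, which here follows from locality. -/
theorem Lmax_graph (α : ℂ) : (Lmax α).graph = graphMax α :=
  Submodule.toLinearPMap_graph_eq _ fun _ hx h => graphMax_functional hx h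

theorem Lmin_graph (α : ℂ) : (Lmin α).graph = graphMin α :=
  Submodule.toLinearPMap_graph_eq _ fun _ hx h => graphMax_functional (graphMin_le_graphMax α hx) h

/-! ### The Hankel transformation diagonalizes the Bessel operator -/

/-- The operator `I 𝓕_m`. -/
def opW (m : ℂ) : L2 →L[ℂ] L2 :=
  (unitaryI.toContinuousLinearEquiv : L2 →L[ℂ] L2) ∘L hankelCLM m

theorem opW_apply (m : ℂ) (f : L2) : opW m f = unitaryI (hankelCLM m f) := rfl

theorem pairing_opW {m : ℂ} (hm : -1 < m.re) (f g : L2) :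
    pairing (opW m f) (opW m g) = pairing f g := by
  rw [opW_apply, opW_apply, unitaryI_hankelCLM, unitaryI_hankelCLM, pairing_opPhi_opPhi hm,
    pairing_unitaryI]

theorem opW_gaussVec {m : ℂ} (hm : -1 < m.re) {s : ℝ} (hs : 0 < s) :
    opW m (gaussVec m s) = ((s : ℂ) ^ (-(m + 1)) * (2 : ℂ) ^ (m + 1 / 2)) • expVec m s⁻¹ := by
  rw [opW_apply, hankelCLM_gaussVec hm hs, map_smul, unitaryI_gaussVec hm (inv_pos.mpr hs),
    smul_smul]

/-- The pair `(G, L G)` for the Gaussian `G = x^{m+1/2} e^{-s x²/2}`. -/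
def gaussPair (m : ℂ) (s : ℝ) : L2 × L2 :=
  cutPair (m ^ 2) (gaussCut s) fun x => (x : ℂ) ^ (1 / 2 + m)

theorem gaussPair_fst (m : ℂ) (s : ℝ) : (gaussPair m s).1 = gaussVec m s :=
  toL2_congr_pos fun x _ => by
    rw [gaussFun, gaussCut, add_comm m]
    ring

theorem Lexpr_gauss {m : ℂ} (hm : -1 < m.re) {s x : ℝ} (hs : 0 < s) (hx : 0 < x) :
    Lexpr (m ^ 2) (fun x => gaussCut s x * (x : ℂ) ^ (1 / 2 + m)) x =
      (2 * (1 + m) * s - s ^ 2 * x ^ 2) * gaussFun m s x := by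
  have hx0 : (x : ℂ) ≠ 0 := Complex.ofReal_ne_zero.mpr hx.ne'
  rw [(isSolution_cpow hm).Lexpr_mul (isCutoff_gaussCut hs) hx, deriv_deriv_gaussCut,
    deriv_gaussCut, (hasDerivAt_cpow hx).deriv, cpow_sub_one_eq hx, gaussFun, ← gaussCut,
    add_comm m]
  field_simp
  ring

theorem gaussPair_snd {m : ℂ} (hm : -1 < m.re) {s : ℝ} (hs : 0 < s) :
    (gaussPair m s).2 = toL2 fun x => (2 * (1 + m) * s - s ^ 2 * x ^ 2) * gaussFun m s x :=
  toL2_congr_pos fun _ hx => Lexpr_gauss hm hs hx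

theorem memLp_Lgauss {m : ℂ} (hm : -1 < m.re) {s : ℝ} (hs : 0 < s) :
    MemLp (fun x : ℝ => (2 * (1 + m) * s - s ^ 2 * x ^ 2) * gaussFun m s x) 2 hμ := by
  refine ((isSolution_cpow hm).memLp_Lexpr (isCutoff_gaussCut hs)).ae_eq ?_
  filter_upwards [ae_restrict_mem measurableSet_Ioi] with x hx
  exact Lexpr_gauss hm hs hx

theorem memLp_mul_expFun {m : ℂ} (hm : -1 < m.re) {s : ℝ} (hs : 0 < s) :
    MemLp (fun x : ℝ => 4 * (x : ℂ) * expFun m s x) 2 hμ := by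
  have h := (memLp_cpow_exp (w := m / 2 + 1) (c := 2 * s) (by simp; linarith)
    (by linarith)).const_mul 4
  refine h.ae_eq ?_
  filter_upwards [ae_restrict_mem measurableSet_Ioi] with x hx
  have hx0 : (x : ℂ) ≠ 0 := Complex.ofReal_ne_zero.mpr (ne_of_gt hx)
  rw [Complex.cpow_add _ _ hx0, Complex.cpow_one, expFun]
  ring

theorem gaussFun_mul {m : ℂ} {s t x : ℝ} (hx : 0 < x) :
    gaussFun m s x * gaussFun m t x =
      (x : ℂ) ^ (2 * m + 1) * (Real.exp (-((s + t) * x ^ 2 / 2)) : ℝ) := by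
  have hx0 : (x : ℂ) ≠ 0 := Complex.ofReal_ne_zero.mpr hx.ne'
  rw [gaussFun, gaussFun, show -((s + t) * x ^ 2 / 2) = -(s * x ^ 2 / 2) + -(t * x ^ 2 / 2) by ring,
    Real.exp_add, show 2 * m + 1 = (m + 1 / 2) + (m + 1 / 2) by ring,
    Complex.cpow_add (m + 1 / 2) (m + 1 / 2) hx0]
  push_cast
  ring

theorem pairing_gaussPair {m : ℂ} (hm : -1 < m.re) {s t : ℝ} (hs : 0 < s) (ht : 0 < t) :
    pairing (gaussPair m s).2 (gaussVec m t) = (2 : ℂ) ^ m * Complex.Gamma (m + 1) *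
      ((s + t : ℝ) : ℂ) ^ (-(m + 1)) * (2 * (m + 1) * (s * t / (s + t))) := by
  have hst : 0 < s + t := add_pos hs ht
  have hm1 : m + 1 ≠ 0 := fun h => by
    have := congrArg Complex.re h
    simp at this
    linarith
  have hS : ((s : ℂ) + t) ≠ 0 := by exact_mod_cast hst.ne'
  rw [gaussPair_snd hm hs, gaussVec, pairing_toL2 (memLp_Lgauss hm hs) (memLp_gaussFun hm ht)]
  have h1 := (integrable_gauss hm hst).const_mul (2 * (1 + m) * s)
  have h2 := (integrable_gauss (w := m + 1) (by simp; linarith) hst).const_mul (s ^ 2 : ℂ)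
  have h3 := integral_sub h1 h2
  rw [integral_const_mul, integral_const_mul, integral_gauss hm hst,
    integral_gauss (by simp; linarith) hst, Complex.Gamma_add_one _ hm1] at h3
  rw [show ∀ g : ℝ → ℂ, ∫ x, g x ∂hμ = ∫ x in Ioi 0, g x from fun _ => rfl] at h3 ⊢
  rw [setIntegral_congr_fun measurableSet_Ioi (g := fun x : ℝ => 2 * (1 + m) * s *
    ((x : ℂ) ^ (2 * m + 1) * (Real.exp (-((s + t) * x ^ 2 / 2)) : ℝ)) - (s ^ 2 : ℂ) *
    ((x : ℂ) ^ (2 * (m + 1) + 1) * (Real.exp (-((s + t) * x ^ 2 / 2)) : ℝ))) ?_, h3,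
    show -(m + 1 + 1) = -(m + 1) - 1 by ring, cpow_sub_one_eq hst,
    Complex.cpow_add _ _ two_ne_zero, Complex.cpow_one]
  · push_cast
    field_simp
    ring
  · intro x hx
    have hx0 : (x : ℂ) ≠ 0 := Complex.ofReal_ne_zero.mpr (ne_of_gt hx)
    simp only
    rw [mul_assoc, gaussFun_mul hx, show 2 * (m + 1) + 1 = (2 * m + 1) + 2 by ring,
      Complex.cpow_add (2 * m + 1) 2 hx0, Complex.cpow_ofNat]
    ring

theorem pairing_mul_expFun {m : ℂ} (hm : -1 < m.re) {s t : ℝ} (hs : 0 < s) (ht : 0 < t) :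
    pairing (toL2 fun x => 4 * (x : ℂ) * expFun m s x) (expVec m t) =
      4 * (((2 * (s + t) : ℝ) : ℂ) ^ (-(m + 1 + 1)) * Complex.Gamma (m + 1 + 1)) := by
  have hst : 0 < 2 * (s + t) := by positivity
  rw [expVec, pairing_toL2 (memLp_mul_expFun hm hs) (memLp_expFun hm ht),
    ← integral_cpow_exp (w := m + 1) (by simp; linarith) hst, ← integral_const_mul]
  refine setIntegral_congr_fun measurableSet_Ioi fun x hx => ?_
  have hx0 : (x : ℂ) ≠ 0 := Complex.ofReal_ne_zero.mpr (ne_of_gt hx)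
  rw [mul_assoc, expFun_mul hx, Complex.cpow_add _ _ hx0, Complex.cpow_one]
  ring

/-- `I 𝓕_m` maps `L G` to `4 x` times the image of `G`, for Gaussians `G`. -/
theorem opW_gaussPair {m : ℂ} (hm : -1 < m.re) {s : ℝ} (hs : 0 < s) :
    opW m (gaussPair m s).2 = ((s : ℂ) ^ (-(m + 1)) * (2 : ℂ) ^ (m + 1 / 2)) •
      toL2 fun x => 4 * (x : ℂ) * expFun m s⁻¹ x := by
  rw [← sub_eq_zero]
  refine eq_zero_of_pairing_expVec hm fun r hr => ?_
  -- The exponential of parameter `1/t` is up to a factor the image of the Gaussian of parameter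
  -- `t`. As `W` preserves the pairing, the claim becomes an identity between the matrix elements of
  -- `L` on Gaussians and those of `4x` on exponentials.
  obtain ⟨t, ht, rfl⟩ : ∃ t : ℝ, 0 < t ∧ r = t⁻¹ := ⟨r⁻¹, inv_pos.mpr hr, (inv_inv r).symm⟩
  have ht0 : (t : ℂ) ≠ 0 := Complex.ofReal_ne_zero.mpr ht.ne'
  have hs0 : (s : ℂ) ≠ 0 := Complex.ofReal_ne_zero.mpr hs.ne'
  have hst : 0 < s + t := add_pos hs ht
  have hS : ((s : ℂ) + t) ≠ 0 := by exact_mod_cast hst.ne'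
  have hm1 : m + 1 ≠ 0 := fun h => by
    have := congrArg Complex.re h
    simp at this
    linarith
  have hc : ((t : ℂ) ^ (-(m + 1)) * (2 : ℂ) ^ (m + 1 / 2)) ≠ 0 := by
    simp [Complex.cpow_eq_zero_iff, ht0]
  rw [pairing_sub_left, sub_eq_zero]
  refine mul_left_cancel₀ hc ?_
  rw [← smul_eq_mul, ← map_smul, ← opW_gaussVec hm ht, pairing_opW hm, pairing_gaussPair hm hs ht,
    pairing_smul_left, pairing_mul_expFun hm (inv_pos.mpr hs) (inv_pos.mpr ht),
    Complex.Gamma_add_one _ hm1]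
  have e1 : ((2 * (s⁻¹ + t⁻¹) : ℝ) : ℂ) = ((2 * (s + t) : ℝ) : ℂ) / ((s * t : ℝ) : ℂ) := by
    push_cast
    field_simp
    ring
  have e2 : ∀ w : ℂ, ((2 * (s⁻¹ + t⁻¹) : ℝ) : ℂ) ^ w * ((s : ℂ) ^ w * (t : ℂ) ^ w) =
      (2 : ℂ) ^ w * ((s + t : ℝ) : ℂ) ^ w := fun w => by
    rw [← Complex.mul_cpow_ofReal_nonneg hs.le ht.le, ← Complex.ofReal_mul,
      ← Complex.mul_cpow_ofReal_nonneg (by positivity) (by positivity), ← two_mul_ofReal_cpow hst,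
      ← Complex.ofReal_mul]
    congr 2
    field_simp
    ring
  have e3 := e2 (-(m + 1))
  rw [show -(m + 1 + 1) = -(m + 1) - 1 by ring, cpow_sub_one_eq (by positivity)]
  have e4 : (2 : ℂ) ^ (m + 1 / 2) * (2 : ℂ) ^ (m + 1 / 2) * (2 : ℂ) ^ (-(m + 1)) = 2 ^ m := by
    rw [← Complex.cpow_add _ _ two_ne_zero, ← Complex.cpow_add _ _ two_ne_zero]
    congr 1
    ring
  have e5 : ((2 * (s⁻¹ + t⁻¹) : ℝ) : ℂ) = 2 * (s + t) / (s * t) := by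
    push_cast
    field_simp
    ring
  rw [← e4]
  rw [e5] at e3 ⊢
  rw [show ∀ a b c d e g h : ℂ, a * b * (c * b * (4 * (e / d * (g * h)))) =
    (b * b) * (e * (c * a)) * (4 * (g * h) / d) by intros; ring, e3]
  field_simp
  ring

/-! ### The defect of a pair in the maximal graph. -/

/-- The function `4 x (W f) - W g` for a pair `(f, g)`, where `W = I 𝓕_m`. -/
def defect (m : ℂ) (p : L2 × L2) (x : ℝ) : ℂ := 4 * (x : ℂ) * opW m p.1 x - opW m p.2 x

theorem integrable_defect_mul {m : ℂ} (hm : -1 < m.re) (p : L2 × L2) {s : ℝ} (hs : 0 < s) :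
    Integrable (fun x => defect m p x * expFun m s x) hμ := by
  have h1 := (Lp.memLp (opW m p.1)).integrable_mul (memLp_mul_expFun hm hs)
  have h2 := (Lp.memLp (opW m p.2)).integrable_mul (memLp_expFun hm hs)
  refine (h1.sub h2).congr (Eventually.of_forall fun x => ?_)
  simp only [defect, Pi.sub_apply, Pi.mul_apply]
  ring

/-- On Gaussians `W` intertwines `L` with `4x`, and `W` preserves the pairing. Testing the defect on
the image of a Gaussian therefore transports it back to a boundary form with that Gaussian. -/
theorem integral_defect {m : ℂ} (hm : -1 < m.re) (p : L2 × L2) {t : ℝ} (ht : 0 < t) :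
    ((t : ℂ) ^ (-(m + 1)) * (2 : ℂ) ^ (m + 1 / 2)) * ∫ x, defect m p x * expFun m t⁻¹ x ∂hμ =
      bdryForm p (gaussPair m t) := by
  have hti := inv_pos.mpr ht
  have h1 := (Lp.memLp (opW m p.1)).integrable_mul (memLp_mul_expFun hm hti)
  have h2 := (Lp.memLp (opW m p.2)).integrable_mul (memLp_expFun hm hti)
  have h3 : ∫ x, defect m p x * expFun m t⁻¹ x ∂hμ =
      pairing (opW m p.1) (toL2 fun x => 4 * (x : ℂ) * expFun m t⁻¹ x) -
        pairing (opW m p.2) (expVec m t⁻¹) := by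
    rw [expVec, pairing_toL2_right _ (memLp_mul_expFun hm hti),
      pairing_toL2_right _ (memLp_expFun hm hti)]
    refine Eq.trans (integral_congr_ae (Eventually.of_forall fun x => ?_)) (integral_sub h1 h2)
    simp only [defect]
    ring
  rw [h3, mul_sub, ← smul_eq_mul, ← map_smul, ← opW_gaussPair hm ht, ← smul_eq_mul, ← map_smul,
    ← opW_gaussVec hm ht, pairing_opW hm, pairing_opW hm, bdryForm, gaussPair_fst]

theorem gaussPair_mem {m : ℂ} (hm : -1 < m.re) {s : ℝ} (hs : 0 < s) :
    gaussPair m s ∈ graphMax (m ^ 2) :=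
  (isSolution_cpow hm).cutPair_mem_graphMax (isCutoff_gaussCut hs)

/-- All Gaussian cutoffs have the value `1` at `0`, so the pairs differ by an element of the minimal
graph, which the boundary form does not see. -/
theorem bdryForm_gaussPair {m : ℂ} (hm : -1 < m.re) {p : L2 × L2} (hp : p ∈ graphMax (m ^ 2))
    {t : ℝ} (ht : 0 < t) : bdryForm p (gaussPair m t) = bdryForm p (gaussPair m 1) := by
  have hu := isSolution_cpow hm
  have h1 := isCutoff_gaussCut ht
  have h2 := isCutoff_gaussCut one_pos
  rw [← sub_eq_zero, ← bdryForm_sub_right, gaussPair, gaussPair, ← hu.cutPair_sub h1 h2]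
  exact bdryForm_graphMin hp (hu.cutPair_mem_graphMin (h1.sub h2) (by simp [gaussCut]))

/-- The coefficient of `x^{m/2}` in the defect. -/
def bdryCoef (m : ℂ) (p : L2 × L2) : ℂ :=
  (2 : ℂ) ^ (1 / 2 : ℂ) * bdryForm p (gaussPair m 1) / Complex.Gamma (m + 1)

theorem Gamma_add_one_ne_zero {m : ℂ} (hm : -1 < m.re) : Complex.Gamma (m + 1) ≠ 0 :=
  Complex.Gamma_ne_zero_of_re_pos (by simp; linarith)

/-- Since the boundary form with a Gaussian is independent of its width, the integrals of the defect
against `x^{m/2} e^{-2sx}` depend on `s` through the power `s^{-(m+1)}` alone. A multiple of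
`x^{m/2}` has the same integrals, and these determine the function. The result is not square
integrable unless the coefficient vanishes. -/
theorem defect_eq {m : ℂ} (hm : -1 < m.re) {p : L2 × L2} (hp : p ∈ graphMax (m ^ 2)) :
    ∀ᵐ x ∂hμ, defect m p x = bdryCoef m p * (x : ℂ) ^ (m / 2) := by
  have hsplit : ∀ s x : ℝ, 0 < x → (x : ℂ) ^ (m / 2) * expFun m s x =
      (x : ℂ) ^ m * (Real.exp (-(2 * s * x)) : ℝ) := fun s x hx => by
    rw [expFun, ← mul_assoc, ← Complex.cpow_add _ _ (Complex.ofReal_ne_zero.mpr hx.ne'),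
      add_halves]
  have hint : ∀ s, 0 < s → Integrable (fun x : ℝ => (x : ℂ) ^ (m / 2) * expFun m s x) hμ :=
    fun s hs => by
      refine (integrable_cpow_exp hm (c := 2 * s) (by linarith)).congr ?_
      filter_upwards [ae_restrict_mem measurableSet_Ioi] with x hx
      exact (hsplit s x hx).symm
  have hd : ∀ (s x : ℝ), (defect m p x - bdryCoef m p * (x : ℂ) ^ (m / 2)) * expFun m s x =
      defect m p x * expFun m s x - bdryCoef m p * ((x : ℂ) ^ (m / 2) * expFun m s x) :=
    fun s x => by ring
  have key := ae_eq_zero_of_integral_expFun (m := m)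
    (h := fun x => defect m p x - bdryCoef m p * (x : ℂ) ^ (m / 2)) (by
      simp only [hd]
      exact (integrable_defect_mul hm p one_pos).sub ((hint 1 one_pos).const_mul _)) (by
      intro r hr
      obtain ⟨t, ht, rfl⟩ : ∃ t : ℝ, 0 < t ∧ r = t⁻¹ := ⟨r⁻¹, inv_pos.mpr hr, (inv_inv r).symm⟩
      simp only [hd]
      rw [integral_sub (integrable_defect_mul hm p hr) ((hint _ hr).const_mul _),
        integral_const_mul]
      have hc : ((t : ℂ) ^ (-(m + 1)) * (2 : ℂ) ^ (m + 1 / 2)) ≠ 0 := by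
        simp [Complex.cpow_eq_zero_iff, ht.ne']
      refine (mul_eq_zero.mp ?_).resolve_left hc
      rw [mul_sub, integral_defect hm p ht, bdryForm_gaussPair hm hp ht, bdryCoef]
      have h1 : ∫ x : ℝ, (x : ℂ) ^ (m / 2) * expFun m t⁻¹ x ∂hμ =
          ((2 * t⁻¹ : ℝ) : ℂ) ^ (-(m + 1)) * Complex.Gamma (m + 1) := by
        rw [← integral_cpow_exp hm (by positivity)]
        exact setIntegral_congr_fun measurableSet_Ioi fun x hx => hsplit _ x hx
      have h2 : (t : ℂ) ^ (-(m + 1)) * ((t⁻¹ : ℝ) : ℂ) ^ (-(m + 1)) = 1 := by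
        rw [← Complex.mul_cpow_ofReal_nonneg ht.le hr.le, ← Complex.ofReal_mul,
          mul_inv_cancel₀ ht.ne', Complex.ofReal_one, Complex.one_cpow]
      have h3 : (2 : ℂ) ^ (m + 1 / 2) * (2 : ℂ) ^ (1 / 2 : ℂ) * (2 : ℂ) ^ (-(m + 1)) = 1 := by
        rw [← Complex.cpow_add _ _ two_ne_zero, ← Complex.cpow_add _ _ two_ne_zero]
        convert Complex.cpow_zero (2 : ℂ) using 2
        ring
      rw [h1, two_mul_ofReal_cpow hr]
      have hG := Gamma_add_one_ne_zero hm
      generalize (2 : ℂ) ^ (m + 1 / 2) = A at h3 ⊢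
      generalize (2 : ℂ) ^ (1 / 2 : ℂ) = B at h3 ⊢
      generalize (2 : ℂ) ^ (-(m + 1)) = C at h3 ⊢
      generalize ((t⁻¹ : ℝ) : ℂ) ^ (-(m + 1)) = D at h2 ⊢
      field_simp
      linear_combination (-bdryForm p (gaussPair m 1)) * h2 +
        (-bdryForm p (gaussPair m 1)) * (t : ℂ) ^ (-(m + 1)) * D * h3)
  filter_upwards [key] with x hx
  exact sub_eq_zero.mp hx

theorem bdryCoef_graphMin {m : ℂ} (hm : -1 < m.re) {q : L2 × L2} (hq : q ∈ graphMin (m ^ 2)) :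
    bdryCoef m q = 0 := by
  rw [bdryCoef, bdryForm_neg_comm, bdryForm_graphMin (gaussPair_mem hm one_pos) hq]
  simp

theorem defect_eq_zero {m : ℂ} (hm : -1 < m.re) {p : L2 × L2} (hp : p ∈ graphMax (m ^ 2))
    (h : bdryForm p (gaussPair m 1) = 0) : ∀ᵐ x ∂hμ, defect m p x = 0 := by
  filter_upwards [defect_eq hm hp] with x hx
  rw [hx, bdryCoef, h]
  simp

/-- If the second pair has no defect, `W q.2` may be replaced by `4x W q.1`, and the difference of
pairings collapses to one integral of the defect of the first pair. -/
theorem bdryForm_eq_integral {m : ℂ} (hm : -1 < m.re) (p : L2 × L2) {q : L2 × L2}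
    (hq : ∀ᵐ x ∂hμ, defect m q x = 0) :
    bdryForm p q = ∫ x, defect m p x * opW m q.1 x ∂hμ := by
  rw [bdryForm, ← pairing_opW hm, ← pairing_opW hm p.2, pairing_apply, pairing_apply,
    ← integral_sub (integrable_mul_L2 _ _) (integrable_mul_L2 _ _)]
  refine integral_congr_ae ?_
  filter_upwards [hq] with x hx
  rw [defect, sub_eq_zero] at hx
  rw [← hx, defect]
  ring

/-! ### The maximal graph modulo the minimal graph. -/

section
variable {m : ℂ} {p₂ : L2 × L2}

/-- This is the converse of `defect_eq`. Test pairs have no defect, so the form of any pair with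
defect `d x^{m/2}` against a test pair is `d` times one integral. For `p₂`, which lies in the
maximal graph and has a nonzero defect, the form vanishes; hence so does the integral. -/
theorem mem_graphMax_of_defect (hm : -1 < m.re) (h₂ : p₂ ∈ graphMax (m ^ 2))
    (hne : bdryForm p₂ (gaussPair m 1) ≠ 0) {p : L2 × L2} {c : ℂ}
    (h : ∀ᵐ x ∂hμ, defect m p x = c * (x : ℂ) ^ (m / 2)) : p ∈ graphMax (m ^ 2) := by
  rw [mem_graphMax_iff]
  intro φ hφ
  have hq := isTest_pair_mem (m ^ 2) hφ
  set q := (toL2 φ, toL2 (Lexpr (m ^ 2) φ))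
  have hq0 : ∀ᵐ x ∂hμ, defect m q x = 0 := by
    refine defect_eq_zero hm (graphMin_le_graphMax _ (subset_closure hq)) ?_
    rw [bdryForm_neg_comm, bdryForm_graphTest (gaussPair_mem hm one_pos) hq, neg_zero]
  have hval : ∀ (r : L2 × L2) (d : ℂ), (∀ᵐ x ∂hμ, defect m r x = d * (x : ℂ) ^ (m / 2)) →
      bdryForm r q = d * ∫ x : ℝ, (x : ℂ) ^ (m / 2) * opW m q.1 x ∂hμ := fun r d hr => by
    rw [bdryForm_eq_integral hm r hq0, ← integral_const_mul]
    refine integral_congr_ae ?_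
    filter_upwards [hr] with x hx
    rw [hx, mul_assoc]
  have h0 := hval p₂ _ (defect_eq hm h₂)
  rw [bdryForm_graphTest h₂ hq] at h0
  have hc : bdryCoef m p₂ ≠ 0 := by
    rw [bdryCoef]
    refine div_ne_zero (mul_ne_zero ?_ hne) (Gamma_add_one_ne_zero hm)
    simp [Complex.cpow_eq_zero_iff]
  rw [hval p c h, (mul_eq_zero.mp h0.symm).resolve_left hc, mul_zero]

/-- Any `q` in the maximal graph becomes free of defect after subtraction of a multiple of `p₂`, and
the boundary form of two pairs without defect is zero. So `p` annihilates the whole maximal graph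
once it annihilates `p₂` and the Gaussian: two boundary values suffice. -/
theorem mem_graphMin_of_two (hm : -1 < m.re) (h₂ : p₂ ∈ graphMax (m ^ 2))
    (hne : bdryForm p₂ (gaussPair m 1) ≠ 0) {p : L2 × L2} (hp : p ∈ graphMax (m ^ 2))
    (hp1 : bdryForm p (gaussPair m 1) = 0) (hp2 : bdryForm p p₂ = 0) : p ∈ graphMin (m ^ 2) := by
  refine mem_graphMin_of_bdryForm fun q hq => ?_
  set a := bdryForm q (gaussPair m 1) / bdryForm p₂ (gaussPair m 1)
  have hq' : q - a • p₂ ∈ graphMax (m ^ 2) := sub_mem hq (Submodule.smul_mem _ _ h₂)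
  have h0 : bdryForm (q - a • p₂) (gaussPair m 1) = 0 := by
    rw [bdryForm_sub_left, bdryForm_smul_left, div_mul_cancel₀ _ hne, sub_self]
  have h1 : bdryForm p (q - a • p₂) = 0 := by
    rw [bdryForm_eq_integral hm p (defect_eq_zero hm hq' h0)]
    refine integral_eq_zero_of_ae ?_
    filter_upwards [defect_eq_zero hm hp hp1] with x hx
    rw [hx, zero_mul, Pi.zero_apply]
  rwa [bdryForm_sub_right, bdryForm_smul_right, hp2, mul_zero, sub_zero] at h1

end

/-! ### Boundary conditions -/

/-- The boundary form sees only germs at `0`. Replacing `ζ` by a cutoff supported near `0` changes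
the pair by an element of the minimal graph, and afterwards the supports are disjoint. -/
theorem bdryForm_cutPair_of_local {α : ℂ} {u : ℝ → ℂ} (hu : IsSolution α u) {p : L2 × L2}
    (hp : p ∈ graphMax α) {ε : ℝ} (hε : 0 < ε) (h : ∀ᵐ x ∂hμ, x < ε → p.1 x = 0) {ζ : ℝ → ℂ}
    (hζ : IsCutoff ζ) : bdryForm p (cutPair α ζ u) = 0 := by
  have hδ : 0 < ε / 2 := half_pos hε
  have hn := isCutoff_nearZero hδ
  have hnζ := hn.mul hζ
  have h1 : bdryForm p (cutPair α (fun x => ζ x - nearZero (ε / 2) x * ζ x) u) = 0 :=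
    bdryForm_graphMin hp (hu.cutPair_mem_graphMin (hζ.sub hnζ)
      (by rw [nearZero_eq_one hδ (by simpa using hδ.le), one_mul, sub_self]))
  rw [hu.cutPair_sub hζ hnζ, bdryForm_sub_right, sub_eq_zero] at h1
  rw [h1, bdryForm, cutPair, pairing_toL2_right _ (hu.memLp_Lexpr hnζ),
    pairing_toL2_right _ (hu.memLp_mul hnζ)]
  have hz : ∀ x, ε ≤ x → (nearZero (ε / 2) x * ζ x) * u x = 0 := fun x hx => by
    rw [nearZero_eq_zero hδ (by rw [mul_div_cancel₀ _ two_ne_zero]; exact hx.trans (le_abs_self x)),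
      zero_mul, zero_mul]
  have e1 : ∫ x, p.2 x * (nearZero (ε / 2) x * ζ x * u x) ∂hμ = 0 := by
    refine integral_eq_zero_of_ae ?_
    filter_upwards [graphMax_local hp h] with x hx
    rcases lt_or_ge x ε with hx' | hx'
    · rw [hx hx', zero_mul, Pi.zero_apply]
    · rw [hz x hx', mul_zero, Pi.zero_apply]
  have e2 : ∫ x, p.1 x * Lexpr α (fun x => nearZero (ε / 2) x * ζ x * u x) x ∂hμ = 0 := by
    -- At `x = ε` the cut off function need not vanish on a neighbourhood, so the pointwise argument
    -- for the differential expression has to exclude this null set.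
    have hne : ∀ᵐ x ∂hμ, x ≠ ε := by
      refine ae_restrict_of_ae ?_
      simp [ae_iff]
    refine integral_eq_zero_of_ae ?_
    filter_upwards [h, hne] with x hx hxε
    rcases lt_or_gt_of_ne hxε with hx' | hx'
    · rw [hx hx', zero_mul, Pi.zero_apply]
    · have : (fun x => nearZero (ε / 2) x * ζ x * u x) =ᶠ[𝓝 x] 0 := by
        filter_upwards [Ioi_mem_nhds hx'] with y hy
        exact hz y (le_of_lt hy)
      have h0 := Lexpr_smul α 0 isTest_zero
      rw [zero_smul, zero_smul] at h0
      rw [Lexpr_congr α this, h0, Pi.zero_apply, mul_zero]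
  rw [e1, e2, sub_zero]

theorem mem_domRestrict_graph {f : L2 →ₗ.[ℂ] L2} {S : Submodule ℂ L2} {p : L2 × L2} :
    p ∈ (f.domRestrict S).graph ↔ p ∈ f.graph ∧ p.1 ∈ S := by
  rw [LinearPMap.mem_graph_iff, LinearPMap.mem_graph_iff]
  constructor
  · rintro ⟨y, hy, hy2⟩
    refine ⟨⟨⟨y, y.2.2⟩, hy, ?_⟩, hy ▸ y.2.1⟩
    rw [← hy2]
    exact (LinearPMap.domRestrict_apply rfl).symm
  · rintro ⟨⟨y, hy, hy2⟩, hS⟩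
    refine ⟨⟨y, ⟨hy ▸ hS, y.2⟩⟩, hy, ?_⟩
    rw [← hy2]
    exact LinearPMap.domRestrict_apply rfl

/-- The graph of the restriction of the maximal operator given by a boundary condition. -/
theorem graph_boundaryCondition {m : ℂ} (hm : -1 < m.re) {u₂ u : ℝ → ℂ}
    (hu₂ : IsSolution (m ^ 2) u₂)
    (hne : bdryForm (cutPair (m ^ 2) (gaussCut 1) u₂) (gaussPair m 1) ≠ 0)
    (hu : IsSolution (m ^ 2) u) (p : L2 × L2) :
    p ∈ ((Lmax (m ^ 2)).domRestrict (boundaryCondition (m ^ 2) u)).graph ↔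
      ∃ c : ℂ, p - c • cutPair (m ^ 2) (gaussCut 1) u ∈ graphMin (m ^ 2) := by
  set α := m ^ 2
  have hG := isCutoff_gaussCut one_pos
  have hζ : ∀ δ : ℝ, 0 < δ → IsCutoff fun x => nearZero δ x - nearZero δ x * gaussCut 1 x :=
    fun δ hδ => (isCutoff_nearZero hδ).sub ((isCutoff_nearZero hδ).mul hG)
  have hζmin : ∀ δ : ℝ, 0 < δ →
      cutPair α (fun x => nearZero δ x - nearZero δ x * gaussCut 1 x) u ∈ graphMin α :=
    fun δ hδ => hu.cutPair_mem_graphMin (hζ δ hδ) (by simp [gaussCut])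
  rw [mem_domRestrict_graph, Lmax_graph]
  constructor
  · rintro ⟨hp, c, h, hh, ε, hε, hfu⟩
    have hhmin : (h, Lmin α ⟨h, hh⟩) ∈ graphMin α := by
      rw [← Lmin_graph]
      exact LinearPMap.mem_graph (Lmin α) ⟨h, hh⟩
    refine ⟨c, ?_⟩
    -- Near `0` the two cut off solutions add up to `c u`, because there `nearZero` is `1` and the
    -- Gaussian cancels. So `r.1` vanishes near `0`, both of its boundary values are zero, and `r`
    -- is in the minimal graph.
    set r := p - c • cutPair α (gaussCut 1) u - (h, Lmin α ⟨h, hh⟩) -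
      c • cutPair α (fun x => nearZero ε x - nearZero ε x * gaussCut 1 x) u with hr
    have hrmax : r ∈ graphMax α := by
      refine sub_mem (sub_mem (sub_mem hp (Submodule.smul_mem _ _ ?_))
        (graphMin_le_graphMax _ hhmin)) (Submodule.smul_mem _ _ (graphMin_le_graphMax _ ?_))
      · exact hu.cutPair_mem_graphMax hG
      · exact hζmin ε hε
    have hr1 : ∀ᵐ x ∂hμ, x < ε → r.1 x = 0 := by
      have e : r.1 = p.1 - c • (toL2 fun x => gaussCut 1 x * u x) - h -
        c • (toL2 fun x => (nearZero ε x - nearZero ε x * gaussCut 1 x) * u x) := rfl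
      rw [e]
      filter_upwards [hfu, Lp.coeFn_sub (p.1 - c • (toL2 fun x => gaussCut 1 x * u x) - h)
          (c • (toL2 fun x => (nearZero ε x - nearZero ε x * gaussCut 1 x) * u x)),
        Lp.coeFn_sub (p.1 - c • (toL2 fun x => gaussCut 1 x * u x)) h,
        Lp.coeFn_sub p.1 (c • (toL2 fun x => gaussCut 1 x * u x)),
        Lp.coeFn_smul c (toL2 fun x => gaussCut 1 x * u x),
        Lp.coeFn_smul c (toL2 fun x => (nearZero ε x - nearZero ε x * gaussCut 1 x) * u x),
        toL2_coe (hu.memLp_mul hG), toL2_coe (hu.memLp_mul (hζ ε hε)),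
        ae_restrict_mem measurableSet_Ioi] with x a1 a2 a3 a4 a5 a6 a7 a8 hx hxε
      have hx0 : 0 < x := hx
      rw [a2, Pi.sub_apply, a3, Pi.sub_apply, a4, Pi.sub_apply, a5, a6, Pi.smul_apply,
        Pi.smul_apply, a7, a8, ← a1 hxε,
        nearZero_eq_one hε (by rw [abs_of_pos hx0]; exact hxε.le), smul_eq_mul, smul_eq_mul]
      ring
    have hrmin : r ∈ graphMin α := mem_graphMin_of_two hm (hu₂.cutPair_mem_graphMax hG) hne hrmax
      (bdryForm_cutPair_of_local (isSolution_cpow hm) hrmax hε hr1 hG)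
      (bdryForm_cutPair_of_local hu₂ hrmax hε hr1 hG)
    have : p - c • cutPair α (gaussCut 1) u = r + c • cutPair α
        (fun x => nearZero ε x - nearZero ε x * gaussCut 1 x) u + (h, Lmin α ⟨h, hh⟩) := by
      rw [hr]
      abel
    rw [this]
    exact add_mem (add_mem hrmin (Submodule.smul_mem _ _ (hζmin ε hε))) hhmin
  · rintro ⟨c, hc⟩
    have hmin : ∀ q ∈ graphMin α, q ∈ graphMax α ∧ q.1 ∈ boundaryCondition α u := fun q hq => by
      refine ⟨graphMin_le_graphMax _ hq, 0, q.1, ?_, 1, one_pos, Eventually.of_forall fun x _ => ?_⟩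
      · rw [← Lmin_graph] at hq
        exact LinearPMap.mem_domain_of_mem_graph hq
      · rw [zero_mul, sub_zero]
    have hU : cutPair α (gaussCut 1) u ∈ graphMax α ∧
        (cutPair α (gaussCut 1) u).1 ∈ boundaryCondition α u := by
      -- Near `0` the difference between the Gaussian times `u` and `u` is minus the solution cut
      -- off by `nearZero` times one minus the Gaussian, a cutoff that vanishes at `0`.
      refine ⟨hu.cutPair_mem_graphMax hG, 1,
        -(cutPair α (fun x => nearZero 1 x - nearZero 1 x * gaussCut 1 x) u).1, ?_, 1, one_pos, ?_⟩
      · have := hζmin 1 one_pos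
        rw [← Lmin_graph] at this
        exact neg_mem (LinearPMap.mem_domain_of_mem_graph this)
      · filter_upwards [Lp.coeFn_neg
          (cutPair α (fun x => nearZero 1 x - nearZero 1 x * gaussCut 1 x) u).1,
          toL2_coe (hu.memLp_mul hG), toL2_coe (hu.memLp_mul (hζ 1 one_pos)),
          ae_restrict_mem measurableSet_Ioi] with x a1 a2 a3 hx hx1
        have hx0 : 0 < x := hx
        rw [a1, Pi.neg_apply, cutPair, cutPair, a2, a3,
          nearZero_eq_one one_pos (by rw [abs_of_pos hx0]; exact hx1.le)]
        ring
    have e : p = (p - c • cutPair α (gaussCut 1) u) + c • cutPair α (gaussCut 1) u := by abel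
    rw [e]
    exact ⟨add_mem (hmin _ hc).1 (Submodule.smul_mem _ _ hU.1),
      add_mem (hmin _ hc).2 (Submodule.smul_mem _ _ hU.2)⟩

/-! ### The resolvents -/

theorem sub_ofReal_ne_zero {z : ℂ} (hz : -z ∈ Complex.slitPlane) {x : ℝ} (hx : 0 < x) :
    z - x ≠ 0 := by
  intro h
  rw [sub_eq_zero.mp h, ← Complex.ofReal_neg, Complex.ofReal_mem_slitPlane] at hz
  linarith

theorem resolventX_coe {z : ℂ} (hz : -z ∈ Complex.slitPlane) (f : L2) :
    resolventX z hz f =ᵐ[hμ] fun x => (z - x)⁻¹ * f x := by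
  have h := (ContinuousLinearMap.mul ℂ ℂ).coeFn_holder (r := 2)
    ((memLp_top_resolvent hz).toLp _) f
  refine h.trans ?_
  filter_upwards [(memLp_top_resolvent hz).coeFn_toLp] with x hx
  rw [hx]
  rfl

theorem profile_coe {m z : ℂ} (hm : |m.re| < 1) (hz : -z ∈ Complex.slitPlane) :
    profile m z hm hz =ᵐ[hμ] fun x => (x : ℂ) ^ (m / 2) / (z - x) :=
  (memLp_two_profile hm hz).coeFn_toLp

theorem resolventX_symm {z : ℂ} (hz : -z ∈ Complex.slitPlane) (f g : L2) :
    pairing (resolventX z hz f) g = pairing f (resolventX z hz g) := by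
  rw [pairing_apply, pairing_apply]
  refine integral_congr_ae ?_
  filter_upwards [resolventX_coe hz f, resolventX_coe hz g] with x h1 h2
  rw [h1, h2]
  ring

theorem rankOneResolvent_apply {m z : ℂ} (hm : |m.re| < 1) (hz : -z ∈ Complex.slitPlane) (c : ℂ)
    (f : L2) : rankOneResolvent m z hm hz c f =
      resolventX z hz f + (c * pairing (profile m z hm hz) f) • profile m z hm hz := by
  simp [rankOneResolvent, smul_smul]

theorem rankOneResolvent_symm {m z : ℂ} (hm : |m.re| < 1) (hz : -z ∈ Complex.slitPlane) (c : ℂ)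
    (f g : L2) : pairing (rankOneResolvent m z hm hz c f) g =
      pairing f (rankOneResolvent m z hm hz c g) := by
  rw [rankOneResolvent_apply, rankOneResolvent_apply, pairing_add_left, map_add, resolventX_symm,
    pairing_smul_left, map_smul, pairing_comm f (profile m z hm hz), smul_eq_mul]
  ring

/-- The image of `(z - L / 4) f` under `W = I 𝓕_m`, for a pair `(f, L f)`. -/
def shifted (m z : ℂ) (p : L2 × L2) : L2 := z • opW m p.1 - (1 / 4 : ℂ) • opW m p.2

theorem shifted_add (m z : ℂ) (p q : L2 × L2) :
    shifted m z (p + q) = shifted m z p + shifted m z q := by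
  simp only [shifted, Prod.fst_add, Prod.snd_add, map_add, smul_add]
  abel

theorem shifted_smul (m z c : ℂ) (p : L2 × L2) : shifted m z (c • p) = c • shifted m z p := by
  simp only [shifted, Prod.smul_fst, Prod.smul_snd, map_smul, smul_sub, smul_comm c]

theorem shifted_coe (m z : ℂ) (p : L2 × L2) : shifted m z p =ᵐ[hμ]
    fun x => (z - x) * opW m p.1 x + 1 / 4 * defect m p x := by
  filter_upwards [Lp.coeFn_sub (z • opW m p.1) ((1 / 4 : ℂ) • opW m p.2),
    Lp.coeFn_smul z (opW m p.1), Lp.coeFn_smul (1 / 4 : ℂ) (opW m p.2)] with x h1 h2 h3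
  rw [shifted, h1, Pi.sub_apply, h2, h3, Pi.smul_apply, Pi.smul_apply, smul_eq_mul, smul_eq_mul,
    defect]
  ring

/-- The pairing of `(z - X)⁻¹ x^{m/2}` with the image of `(z - L / 4) f`. -/
def profileValue (m z : ℂ) (hm : |m.re| < 1) (hz : -z ∈ Complex.slitPlane) (p : L2 × L2) : ℂ :=
  pairing (profile m z hm hz) (shifted m z p)

theorem bdryCoef_add (m : ℂ) (p q : L2 × L2) : bdryCoef m (p + q) = bdryCoef m p + bdryCoef m q := by
  rw [bdryCoef, bdryForm_add_left, bdryCoef, bdryCoef]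
  ring

theorem bdryCoef_smul (m c : ℂ) (p : L2 × L2) : bdryCoef m (c • p) = c * bdryCoef m p := by
  rw [bdryCoef, bdryForm_smul_left, bdryCoef]
  ring

theorem neg_one_lt_re {m : ℂ} (hm : |m.re| < 1) : -1 < m.re := (abs_lt.mp hm).1

section
variable {m z : ℂ} (hm : |m.re| < 1) (hz : -z ∈ Complex.slitPlane)

theorem profileValue_add (p q : L2 × L2) :
    profileValue m z hm hz (p + q) = profileValue m z hm hz p + profileValue m z hm hz q := by
  rw [profileValue, shifted_add, map_add, profileValue, profileValue]

theorem profileValue_smul (c : ℂ) (p : L2 × L2) :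
    profileValue m z hm hz (c • p) = c * profileValue m z hm hz p := by
  rw [profileValue, shifted_smul, map_smul, smul_eq_mul, profileValue]

/-- The image of `(z - L/4) f` is `(z - x) W f` plus a quarter of the defect, and the defect is a
multiple of `x^{m/2}`; division by `z - x` turns it into the profile. -/
theorem resolventX_shifted {p : L2 × L2} (hp : p ∈ graphMax (m ^ 2)) :
    resolventX z hz (shifted m z p) = opW m p.1 + (bdryCoef m p / 4) • profile m z hm hz := by
  apply Lp.ext
  filter_upwards [resolventX_coe hz (shifted m z p), shifted_coe m z p, profile_coe hm hz,
    Lp.coeFn_add (opW m p.1) ((bdryCoef m p / 4) • profile m z hm hz),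
    Lp.coeFn_smul (bdryCoef m p / 4) (profile m z hm hz), defect_eq (neg_one_lt_re hm) hp,
    ae_restrict_mem measurableSet_Ioi] with x h1 h2 h3 h4 h5 h6 hx
  have hne := sub_ofReal_ne_zero hz hx
  rw [h1, h2, h4, Pi.add_apply, h5, Pi.smul_apply, h3, h6, smul_eq_mul]
  field_simp

/-- The bracket in front of the profile is the obstruction to inverting `z - L/4`. Its vanishing is
the boundary condition in spectral form. -/
theorem rankOneResolvent_shifted (c : ℂ) {p : L2 × L2} (hp : p ∈ graphMax (m ^ 2)) :
    rankOneResolvent m z hm hz c (shifted m z p) = opW m p.1 +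
      (bdryCoef m p / 4 + c * profileValue m z hm hz p) • profile m z hm hz := by
  rw [rankOneResolvent_apply, resolventX_shifted hm hz hp, profileValue, add_smul, add_assoc]

/-- If the defect vanishes, the profile value is `∫ x^{m/2} W f`. -/
theorem profileValue_eq_integral {p : L2 × L2} (h : ∀ᵐ x ∂hμ, defect m p x = 0) :
    profileValue m z hm hz p = ∫ x : ℝ, (x : ℂ) ^ (m / 2) * opW m p.1 x ∂hμ := by
  rw [profileValue, pairing_apply]
  refine integral_congr_ae ?_
  filter_upwards [shifted_coe m z p, profile_coe hm hz, h, ae_restrict_mem measurableSet_Ioi]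
    with x h1 h2 h3 hx
  have hne := sub_ofReal_ne_zero hz hx
  rw [h1, h2, h3]
  field_simp
  ring

/-- The Gaussian with `x^{1/2+m}` has no defect, so `z` drops out and a Gamma integral remains. -/
theorem profileValue_gaussPair : profileValue m z hm hz (gaussPair m 1) =
    (2 : ℂ) ^ (-(1 / 2) : ℂ) * Complex.Gamma (m + 1) := by
  have hm1 := neg_one_lt_re hm
  rw [profileValue_eq_integral hm hz (defect_eq_zero hm1 (gaussPair_mem hm1 one_pos)
    (bdryForm_self _)), gaussPair_fst, opW_gaussVec hm1 one_pos, inv_one]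
  have h : ∀ᵐ x : ℝ ∂hμ, (x : ℂ) ^ (m / 2) *
      ((((1 : ℝ) : ℂ) ^ (-(m + 1)) * (2 : ℂ) ^ (m + 1 / 2)) • expVec m 1 : L2) x =
      (2 : ℂ) ^ (m + 1 / 2) * ((x : ℂ) ^ m * (Real.exp (-(2 * x)) : ℝ)) := by
    filter_upwards [Lp.coeFn_smul (((1 : ℝ) : ℂ) ^ (-(m + 1)) * (2 : ℂ) ^ (m + 1 / 2))
      (expVec m 1), expVec_coe hm1 one_pos, ae_restrict_mem measurableSet_Ioi] with x h1 h2 hx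
    have hx0 : (x : ℂ) ≠ 0 := Complex.ofReal_ne_zero.mpr (ne_of_gt hx)
    have h3 : (x : ℂ) ^ m = (x : ℂ) ^ (m / 2) * (x : ℂ) ^ (m / 2) := by
      rw [← Complex.cpow_add _ _ hx0, add_halves]
    rw [h1, Pi.smul_apply, h2, expFun, h3, Complex.ofReal_one, Complex.one_cpow, smul_eq_mul,
      mul_one]
    ring
  rw [integral_congr_ae h, integral_const_mul, integral_cpow_exp hm1 two_pos, ← mul_assoc,
    Complex.ofReal_ofNat, ← Complex.cpow_add _ _ two_ne_zero]
  congr 2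
  ring

/-- For a pair in the minimal graph the value is `∫ x^{m/2} W f`. Multiplied by the nonzero defect
coefficient of `p₂` it equals the boundary form with `p₂`, which vanishes. -/
theorem profileValue_graphMin {p₂ : L2 × L2} (h₂ : p₂ ∈ graphMax (m ^ 2))
    (hne : bdryForm p₂ (gaussPair m 1) ≠ 0) {p : L2 × L2} (hp : p ∈ graphMin (m ^ 2)) :
    profileValue m z hm hz p = 0 := by
  have hm1 := neg_one_lt_re hm
  have hd : ∀ᵐ x ∂hμ, defect m p x = 0 := by
    refine defect_eq_zero hm1 (graphMin_le_graphMax _ hp) ?_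
    rw [bdryForm_neg_comm, bdryForm_graphMin (gaussPair_mem hm1 one_pos) hp, neg_zero]
  have h0 := bdryForm_eq_integral hm1 p₂ hd
  have h1 : ∫ x, defect m p₂ x * opW m p.1 x ∂hμ =
      bdryCoef m p₂ * ∫ x : ℝ, (x : ℂ) ^ (m / 2) * opW m p.1 x ∂hμ := by
    rw [← integral_const_mul]
    refine integral_congr_ae ?_
    filter_upwards [defect_eq hm1 h₂] with x hx
    rw [hx, mul_assoc]
  rw [bdryForm_graphMin h₂ hp, h1] at h0
  have hc : bdryCoef m p₂ ≠ 0 := by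
    rw [bdryCoef]
    refine div_ne_zero (mul_ne_zero ?_ hne) (Gamma_add_one_ne_zero hm1)
    simp [Complex.cpow_eq_zero_iff]
  rw [profileValue_eq_integral hm hz hd]
  exact (mul_eq_zero.mp h0.symm).resolve_left hc

end

/-! ### From a boundary condition to the resolvent. -/

/-- The operator `I 𝓕_m` as an invertible operator. -/
def opWEquiv (m : ℂ) (hm : -1 < m.re) : L2 ≃L[ℂ] L2 :=
  (hankelEquiv m hm).trans unitaryI.toContinuousLinearEquiv

theorem opWEquiv_apply (m : ℂ) (hm : -1 < m.re) (f : L2) : opWEquiv m hm f = opW m f := rfl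

theorem hasResolvents_iff {Ω : Set ℂ} {R : Ω → L2 →L[ℂ] L2} {H : L2 →ₗ.[ℂ] L2} :
    HasResolvents Ω R H ↔ ∀ z : Ω, (∀ p ∈ H.graph, R z ((z : ℂ) • p.1 - p.2) = p.1) ∧
      ∀ g, (R z g, (z : ℂ) • R z g - g) ∈ H.graph := by
  refine forall_congr' fun z => and_congr ⟨fun h p hp => ?_, fun h f => ?_⟩
    (forall_congr' fun g => ⟨fun ⟨h, e⟩ => ?_, fun h => ?_⟩)
  · obtain ⟨y, hy1, hy2⟩ := (LinearPMap.mem_graph_iff _).mp hp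
    rw [← hy1, ← hy2]
    exact h y
  · exact h _ (LinearPMap.mem_graph H f)
  · rw [LinearPMap.mem_graph_iff]
    refine ⟨⟨_, h⟩, rfl, ?_⟩
    exact eq_sub_of_add_eq' (sub_eq_iff_eq_add.mp e).symm
  · obtain ⟨y, hy1, hy2⟩ := (LinearPMap.mem_graph_iff _).mp h
    simp only at hy1 hy2
    refine ⟨hy1 ▸ y.2, ?_⟩
    have : y = ⟨R z g, hy1 ▸ y.2⟩ := Subtype.ext hy1
    rw [← this, hy2, sub_sub_cancel]

/-- The operator with graph `{(W f, W g / 4)}`, where `(f, g)` runs over the graph of an extension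
of the minimal operator by one element, has the resolvents given by the rank one formula. -/
theorem hasResolvents_rankOne {m : ℂ} (hm : |m.re| < 1) {p₂ U : L2 × L2}
    (h₂ : p₂ ∈ graphMax (m ^ 2)) (hne : bdryForm p₂ (gaussPair m 1) ≠ 0) {a b : ℂ}
    (hab : a ≠ 0 ∨ b ≠ 0) (hU : U = a • p₂ + b • gaussPair m 1) {Ω : Set ℂ}
    (hΩ : ∀ z ∈ Ω, -z ∈ Complex.slitPlane) (c : Ω → ℂ)
    (hc : ∀ z : Ω, bdryCoef m U / 4 + c z * profileValue m z hm (hΩ z z.2) U = 0)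
    {H : L2 →ₗ.[ℂ] L2} (hH : ∀ p : L2 × L2, (opW m p.1, (1 / 4 : ℂ) • opW m p.2) ∈ H.graph ↔
      ∃ k : ℂ, p - k • U ∈ graphMin (m ^ 2)) :
    HasResolvents Ω (fun z => rankOneResolvent m z hm (hΩ z z.2) (c z)) H := by
  have hm1 := neg_one_lt_re hm
  have hG := gaussPair_mem hm1 one_pos
  have hUm : U ∈ graphMax (m ^ 2) := by
    rw [hU]
    exact add_mem (Submodule.smul_mem _ _ h₂) (Submodule.smul_mem _ _ hG)
  have hsurj : ∀ p : L2 × L2, ∃ q : L2 × L2, p = (opW m q.1, (1 / 4 : ℂ) • opW m q.2) := fun p => by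
    refine ⟨((opWEquiv m hm1).symm p.1, (opWEquiv m hm1).symm ((4 : ℂ) • p.2)), ?_⟩
    rw [← opWEquiv_apply m hm1, ← opWEquiv_apply m hm1, ContinuousLinearEquiv.apply_symm_apply,
      ContinuousLinearEquiv.apply_symm_apply, smul_smul]
    norm_num
  rw [hasResolvents_iff]
  intro z
  have hz := hΩ z z.2
  -- Left inverse: modulo the minimal graph `q` is a multiple of `U`, so the obstruction is the same
  -- multiple of the expression that `hc` makes zero.
  have hres : ∀ q : L2 × L2, (∃ k : ℂ, q - k • U ∈ graphMin (m ^ 2)) →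
      rankOneResolvent m z hm hz (c z) (shifted m z q) = opW m q.1 := by
    rintro q ⟨k, hk⟩
    have hq : q = (q - k • U) + k • U := by abel
    have hqm : q ∈ graphMax (m ^ 2) := by
      rw [hq]
      exact add_mem (graphMin_le_graphMax _ hk) (Submodule.smul_mem _ _ hUm)
    rw [rankOneResolvent_shifted hm hz _ hqm]
    have e1 : bdryCoef m q = k * bdryCoef m U := by
      rw [hq, bdryCoef_add, bdryCoef_graphMin hm1 hk, zero_add, bdryCoef_smul]
    have e2 : profileValue m z hm hz q = k * profileValue m z hm hz U := by
      rw [hq, profileValue_add, profileValue_graphMin hm hz h₂ hne hk, zero_add, profileValue_smul]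
    rw [e1, e2, show k * bdryCoef m U / 4 + c z * (k * profileValue m z hm hz U) =
      k * (bdryCoef m U / 4 + c z * profileValue m z hm hz U) by ring, hc z, mul_zero, zero_smul,
      add_zero]
  refine ⟨fun p hp => ?_, fun g => ?_⟩
  · obtain ⟨q, rfl⟩ := hsurj p
    exact hres q ((hH q).mp hp)
  · set R := rankOneResolvent m z hm hz (c z) with hR
    obtain ⟨q, hq⟩ := hsurj (R g, (z : ℂ) • R g - g)
    have hq1 : R g = opW m q.1 := congrArg Prod.fst hq
    have hq2 : (z : ℂ) • R g - g = (1 / 4 : ℂ) • opW m q.2 := congrArg Prod.snd hq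
    have hq3 : opW m q.2 = (4 : ℂ) • ((z : ℂ) • R g - g) := by
      rw [hq2, smul_smul]
      norm_num
    change (R g, (z : ℂ) • R g - g) ∈ H.graph
    rw [hq, hH]
    -- From `(z - x) R g = g + c ⟨profile, g⟩ x^{m/2}` one reads off that the preimage of `(R g, z R
    -- g - g)` has the defect `-4 c ⟨profile, g⟩ x^{m/2}`, which is of the form admitted in the
    -- maximal graph.
    have hqm : q ∈ graphMax (m ^ 2) := by
      refine mem_graphMax_of_defect hm1 h₂ hne
        (c := -(4 * (c z * pairing (profile m z hm hz) g))) ?_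
      have hRg : R g = resolventX z hz g + (c z * pairing (profile m z hm hz) g) • profile m z hm hz :=
        rankOneResolvent_apply hm hz (c z) g
      filter_upwards [resolventX_coe hz g, profile_coe hm hz,
        Lp.coeFn_add (resolventX z hz g) ((c z * pairing (profile m z hm hz) g) • profile m z hm hz),
        Lp.coeFn_smul (c z * pairing (profile m z hm hz) g) (profile m z hm hz),
        Lp.coeFn_smul (4 : ℂ) ((z : ℂ) • R g - g), Lp.coeFn_sub ((z : ℂ) • R g) g,
        Lp.coeFn_smul (z : ℂ) (R g), ae_restrict_mem measurableSet_Ioi]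
        with x a1 a2 a3 a4 a5 a6 a7 hx
      have hne := sub_ofReal_ne_zero hz hx
      rw [defect, ← hq1, hq3, a5, Pi.smul_apply, a6, Pi.sub_apply, a7, Pi.smul_apply, hRg, a3,
        Pi.add_apply, a1, a4, Pi.smul_apply, a2]
      simp only [smul_eq_mul]
      field_simp
      ring
    -- Both `q` and `U` come from the graph `(R g, z R g - g)` of one bounded operator that is
    -- symmetric for the bilinear pairing, so their boundary form vanishes.
    have hqU : bdryForm q U = 0 := by
      have hRU : R (shifted m z U) = opW m U.1 := hres U ⟨1, by
        rw [one_smul, sub_self]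
        exact zero_mem _⟩
      have hU2 : opW m U.2 = (4 : ℂ) • ((z : ℂ) • opW m U.1 - shifted m z U) := by
        rw [shifted, sub_sub_cancel, smul_smul]
        norm_num
      rw [bdryForm, ← pairing_opW hm1, ← pairing_opW hm1 q.2, hU2, hq3, ← hq1, ← hRU,
        map_smul, map_sub, map_smul, pairing_smul_left, pairing_sub_left, pairing_smul_left,
        hR, rankOneResolvent_symm, rankOneResolvent_symm, smul_eq_mul, smul_eq_mul,
        ← rankOneResolvent_symm hm hz (c z) g (shifted m z U)]
      ring
    have hself := bdryForm_self (gaussPair m 1)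
    have hself2 := bdryForm_self p₂
    have hanti := bdryForm_neg_comm (gaussPair m 1) p₂
    have hforms : ∀ k : ℂ, bdryForm (q - k • U) (gaussPair m 1) =
        bdryForm q (gaussPair m 1) - k * a * bdryForm p₂ (gaussPair m 1) ∧
        bdryForm (q - k • U) p₂ = bdryForm q p₂ + k * b * bdryForm p₂ (gaussPair m 1) := fun k => by
      rw [bdryForm_sub_left, bdryForm_smul_left, bdryForm_sub_left, bdryForm_smul_left, hU,
        bdryForm_add_left, bdryForm_smul_left, bdryForm_smul_left, bdryForm_add_left,
        bdryForm_smul_left, bdryForm_smul_left, hself, hself2, hanti]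
      constructor <;> ring
    have hlin : a * bdryForm q p₂ + b * bdryForm q (gaussPair m 1) = 0 := by
      rw [← hqU, hU, bdryForm_add_right, bdryForm_smul_right, bdryForm_smul_right]
    -- The relation `hlin` says that the two boundary values of `q` are proportional to those of
    -- `U`. The factor `k` is read off from whichever of `a`, `b` is nonzero.
    obtain ⟨k, hk1, hk2⟩ : ∃ k : ℂ,
        bdryForm q (gaussPair m 1) - k * a * bdryForm p₂ (gaussPair m 1) = 0 ∧
        bdryForm q p₂ + k * b * bdryForm p₂ (gaussPair m 1) = 0 := by
      rcases hab with ha | hb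
      · refine ⟨bdryForm q (gaussPair m 1) / (a * bdryForm p₂ (gaussPair m 1)), ?_, ?_⟩
        · field_simp
          ring
        · field_simp
          linear_combination hlin
      · refine ⟨-bdryForm q p₂ / (b * bdryForm p₂ (gaussPair m 1)), ?_, ?_⟩
        · field_simp
          linear_combination hlin
        · field_simp
          ring
    refine ⟨k, mem_graphMin_of_two hm1 h₂ hne (sub_mem hqm (Submodule.smul_mem _ _ hUm)) ?_ ?_⟩
    · rw [(hforms k).1, hk1]
    · rw [(hforms k).2, hk2]

/-! ### Conjugation -/

theorem mem_conjugate_graph {W : L2 ≃L[ℂ] L2} {H : L2 →ₗ.[ℂ] L2} {p : L2 × L2} :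
    p ∈ (conjugate W H).graph ↔ (W p.1, W p.2) ∈ H.graph := by
  rw [LinearPMap.mem_graph_iff, LinearPMap.mem_graph_iff]
  constructor
  · rintro ⟨y, hy, hy2⟩
    refine ⟨⟨W y, y.2⟩, by rw [← hy], ?_⟩
    rw [← hy2]
    change _ = W (W.symm (H ⟨W y, y.2⟩))
    rw [ContinuousLinearEquiv.apply_symm_apply]
  · rintro ⟨y, hy, hy2⟩
    simp only at hy hy2
    have hmem : W p.1 ∈ H.domain := hy ▸ y.2
    refine ⟨⟨p.1, hmem⟩, rfl, ?_⟩
    change W.symm (H ⟨W p.1, hmem⟩) = p.2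
    have : y = ⟨W p.1, hmem⟩ := Subtype.ext hy
    rw [← this, hy2, ContinuousLinearEquiv.symm_apply_apply]

theorem mem_smul_graph {H : L2 →ₗ.[ℂ] L2} {c : ℂ} {f g : L2} (h : (f, g) ∈ H.graph) :
    (f, c • g) ∈ (c • H).graph := by
  rw [LinearPMap.mem_graph_iff] at h ⊢
  obtain ⟨y, hy1, hy2⟩ := h
  simp only at hy1 hy2
  refine ⟨⟨y, y.2⟩, hy1, ?_⟩
  rw [← hy2]
  rfl

theorem mem_smul_graph_iff {H : L2 →ₗ.[ℂ] L2} {c : ℂ} (hc : c ≠ 0) {f g : L2} :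
    (f, c • g) ∈ (c • H).graph ↔ (f, g) ∈ H.graph := by
  refine ⟨fun h => ?_, mem_smul_graph⟩
  rw [LinearPMap.mem_graph_iff] at h ⊢
  obtain ⟨y, hy1, hy2⟩ := h
  simp only at hy1 hy2
  refine ⟨⟨y, y.2⟩, hy1, ?_⟩
  have : c • H ⟨y, y.2⟩ = c • g := hy2
  exact smul_right_injective _ hc this

/-- If the inverse conjugate of `H̃ / 4` has the resolvents `R z`, it is the operator given by these
resolvents. -/
theorem conjugate_ofResolvents {W : L2 ≃L[ℂ] L2} {Ω : Set ℂ} {R : Ω → L2 →L[ℂ] L2}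
    {H : L2 →ₗ.[ℂ] L2} (h : HasResolvents Ω R (conjugate W.symm H)) (hΩ : Ω.Nonempty) :
    HasResolvents Ω R (ofResolvents Ω R) ∧ conjugate W (ofResolvents Ω R) = H := by
  rw [h.ofResolvents_eq hΩ]
  refine ⟨h, LinearPMap.eq_of_eq_graph ?_⟩
  ext p
  rw [mem_conjugate_graph, mem_conjugate_graph, ContinuousLinearEquiv.symm_apply_apply,
    ContinuousLinearEquiv.symm_apply_apply]

/-! ### Analyticity of the profile values -/

/-- The bilinear pairing of `h` with `x^{m/2} / (z - x)`. -/
def cauchyInt (m : ℂ) (h : L2) (z : ℂ) : ℂ := ∫ x : ℝ, (x : ℂ) ^ (m / 2) / (z - x) * h x ∂hμ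

theorem pairing_profile {m z : ℂ} (hm : |m.re| < 1) (hz : -z ∈ Complex.slitPlane) (h : L2) :
    pairing (profile m z hm hz) h = cauchyInt m h z := by
  rw [pairing_apply]
  refine integral_congr_ae ?_
  filter_upwards [profile_coe hm hz] with x hx
  rw [hx]

theorem integrable_cauchyInt {m z : ℂ} (hm : |m.re| < 1) (hz : -z ∈ Complex.slitPlane) (h : L2) :
    Integrable (fun x : ℝ => (x : ℂ) ^ (m / 2) / (z - x) * h x) hμ :=
  (memLp_two_profile hm hz).integrable_mul (Lp.memLp h)

theorem differentiableAt_cauchyInt {m z : ℂ} (hm : |m.re| < 1) (hz : -z ∈ Complex.slitPlane)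
    (h : L2) : DifferentiableAt ℂ (cauchyInt m h) z := by
  obtain ⟨C, hC, hx⟩ := exists_one_add_le hz
  have hpow : Measurable fun x : ℝ => (x : ℂ) ^ (m / 2) := Complex.measurable_ofReal.pow_const _
  -- The distance of `z` to the half-line is at least `1/C`, so the radius `1/(2C)` keeps `|w - x|`
  -- above half of `|z - x|` uniformly in `x`. This dominates the derivative of the kernel by a
  -- multiple of the kernel at `z`.
  have hhalf : ∀ w ∈ Metric.ball z (1 / (2 * C)), ∀ x : ℝ, 0 < x →
      ‖z - x‖ / 2 ≤ ‖w - x‖ ∧ 1 ≤ C * ‖z - x‖ := fun w hw x hx0 => by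
    have h1 := hx x hx0
    have h2 : 1 ≤ C * ‖z - x‖ := by linarith
    have h3 : ‖z - x‖ ≤ ‖w - x‖ + ‖w - z‖ := by
      have := norm_sub_le (w - x) (w - z)
      rwa [sub_sub_sub_cancel_left] at this
    have h4 : ‖w - z‖ < 1 / (2 * C) := by rwa [← dist_eq_norm]
    have h5 : 1 / (2 * C) ≤ ‖z - x‖ / 2 := by
      rw [div_le_div_iff₀ (by positivity) two_pos]
      linarith
    exact ⟨by linarith, h2⟩
  refine (hasDerivAt_integral_of_dominated_loc_of_deriv_le (μ := hμ)
    (F := fun (w : ℂ) (x : ℝ) => (x : ℂ) ^ (m / 2) / (w - x) * h x)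
    (F' := fun (w : ℂ) (x : ℝ) => -((x : ℂ) ^ (m / 2)) / (w - x) ^ 2 * h x)
    (bound := fun x : ℝ => 4 * C * ‖(x : ℂ) ^ (m / 2) / (z - x) * h x‖)
    (Metric.ball_mem_nhds z (ε := 1 / (2 * C)) (by positivity))
    (Eventually.of_forall fun w => ?_) (integrable_cauchyInt hm hz h) ?_ ?_
    ((integrable_cauchyInt hm hz h).norm.const_mul _) ?_).2.differentiableAt
  · exact (hpow.div (by fun_prop)).aestronglyMeasurable.mul (Lp.aestronglyMeasurable h)
  · exact (hpow.neg.div (by fun_prop)).aestronglyMeasurable.mul (Lp.aestronglyMeasurable h)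
  · filter_upwards [ae_restrict_mem measurableSet_Ioi] with x hx0 w hw
    obtain ⟨h1, h2⟩ := hhalf w hw x hx0
    have hzx : 0 < ‖z - x‖ := by
      by_contra hn
      have : ‖z - x‖ = 0 := le_antisymm (not_lt.mp hn) (norm_nonneg _)
      rw [this] at h2
      linarith
    have hwx : 0 < ‖w - x‖ := lt_of_lt_of_le (by positivity) h1
    rw [norm_mul, norm_mul, norm_div, norm_div, norm_neg, norm_pow, ← mul_assoc]
    refine mul_le_mul_of_nonneg_right ?_ (norm_nonneg _)
    rw [← mul_div_assoc, div_le_div_iff₀ (by positivity) hzx]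
    have h3 : ‖z - x‖ ^ 2 / 4 ≤ ‖w - x‖ ^ 2 := by
      have := pow_le_pow_left₀ (by positivity) h1 2
      rw [div_pow] at this
      linarith
    have h4 : ‖z - x‖ ≤ 4 * C * ‖w - x‖ ^ 2 := by nlinarith
    calc ‖(x : ℂ) ^ (m / 2)‖ * ‖z - x‖ ≤ ‖(x : ℂ) ^ (m / 2)‖ * (4 * C * ‖w - x‖ ^ 2) := by gcongr
      _ = _ := by ring
  · filter_upwards [ae_restrict_mem measurableSet_Ioi] with x hx0 w hw
    obtain ⟨h1, h2⟩ := hhalf w hw x hx0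
    have hne : w - x ≠ 0 := by
      intro h0
      rw [h0, norm_zero] at h1
      nlinarith
    have hd : HasDerivAt (fun w : ℂ => (w - x)⁻¹) (-1 / (w - x) ^ 2) w :=
      ((hasDerivAt_id w).sub_const _).inv hne
    have hd2 := (hd.const_mul ((x : ℂ) ^ (m / 2))).mul_const (h x)
    refine hd2.congr_deriv ?_
    ring

/-- By the identity theorem on the connected slit plane, agreement on the positive reals is enough;
the points `1 + 1/(n+1)` accumulate at `1`. -/
theorem eqOn_slitPlane {f g : ℂ → ℂ} (hf : DifferentiableOn ℂ f Complex.slitPlane)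
    (hg : DifferentiableOn ℂ g Complex.slitPlane) (h : ∀ t : ℝ, 0 < t → f t = g t) :
    EqOn f g Complex.slitPlane := by
  have hc : IsPreconnected Complex.slitPlane :=
    (Complex.starConvex_one_slitPlane.isPathConnected
      Complex.one_mem_slitPlane).isConnected.isPreconnected
  refine (hf.analyticOnNhd Complex.isOpen_slitPlane).eqOn_of_preconnected_of_frequently_eq
    (hg.analyticOnNhd Complex.isOpen_slitPlane) hc Complex.one_mem_slitPlane ?_
  have ht : Tendsto (fun n : ℕ => ((1 + 1 / ((n : ℝ) + 1) : ℝ) : ℂ)) atTop (𝓝[≠] 1) := by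
    refine tendsto_nhdsWithin_iff.mpr ⟨?_, Eventually.of_forall fun n => ?_⟩
    · have h1 := (tendsto_one_div_add_atTop_nhds_zero_nat (𝕜 := ℝ)).const_add 1
      rw [add_zero] at h1
      have := (Complex.continuous_ofReal.tendsto 1).comp h1
      simpa [Function.comp_def] using this
    · have hn : (0 : ℝ) < 1 / ((n : ℝ) + 1) := by positivity
      rw [mem_compl_iff, mem_singleton_iff]
      intro h0
      have h1 : (1 + 1 / ((n : ℝ) + 1) : ℝ) = 1 := by exact_mod_cast h0
      linarith
  exact ht.frequently (Frequently.of_forall fun n => h _ (by positivity))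

theorem profileValue_eq {m z : ℂ} (hm : |m.re| < 1) (hz : -z ∈ Complex.slitPlane) (p : L2 × L2) :
    profileValue m z hm hz p =
      z * cauchyInt m (opW m p.1) z - 1 / 4 * cauchyInt m (opW m p.2) z := by
  rw [profileValue, shifted, map_sub, map_smul, map_smul, pairing_profile, pairing_profile,
    smul_eq_mul, smul_eq_mul]

theorem ofReal_neg_neg_mem {t : ℝ} (ht : 0 < t) : -(-(t : ℂ)) ∈ Complex.slitPlane := by
  rw [neg_neg]
  exact Complex.ofReal_mem_slitPlane.mpr ht

/-- A profile value is determined by its values on the negative half-line. -/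
theorem profileValue_of_pos {m : ℂ} (hm : |m.re| < 1) {p : L2 × L2} {g : ℂ → ℂ}
    (hg : DifferentiableOn ℂ g Complex.slitPlane)
    (h : ∀ (t : ℝ) (ht : 0 < t), profileValue m (-t) hm (ofReal_neg_neg_mem ht) p = g t) (z : ℂ)
    (hz : -z ∈ Complex.slitPlane) : profileValue m z hm hz p = g (-z) := by
  have hd : ∀ f : L2, DifferentiableOn ℂ (fun w => cauchyInt m f (-w)) Complex.slitPlane :=
    fun f w hw => by
      have h1 : DifferentiableAt ℂ (cauchyInt m f) (-w) :=
        differentiableAt_cauchyInt hm (by rwa [neg_neg]) f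
      exact (h1.comp w differentiableAt_id.neg).differentiableWithinAt
  have := eqOn_slitPlane (f := fun w => -w * cauchyInt m (opW m p.1) (-w) -
    1 / 4 * cauchyInt m (opW m p.2) (-w))
    ((differentiableOn_id.neg.mul (hd _)).sub ((hd _).const_mul _)) hg
    (fun t ht => by rw [← h t ht, profileValue_eq]) hz
  rw [profileValue_eq, ← this]
  simp only [neg_neg]

/-! ### The Laplace representation on the negative half-line -/

theorem integral_exp_neg_mul {c : ℝ} (hc : 0 < c) : ∫ τ, Real.exp (-(c * τ)) ∂hμ = c⁻¹ := by
  have := integral_exp_mul_Ioi (a := -c) (by linarith) 0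
  simpa [neg_mul] using this

theorem integrable_exp_neg_mul {c : ℝ} (hc : 0 < c) :
    Integrable (fun τ => Real.exp (-(c * τ))) hμ := by
  have := integrableOn_exp_mul_Ioi (a := -c) (by linarith) 0
  simpa [neg_mul, IntegrableOn] using this

/-- Integrating the modulus first in `τ` gives `|x^{m/2} h(x)| / (t + x)`, which is integrable as a
product of two square integrable functions. -/
theorem integrable_laplace {m : ℂ} (hm : |m.re| < 1) {t : ℝ} (ht : 0 < t) (h : L2) :
    Integrable (Function.uncurry fun (τ x : ℝ) =>
      (Real.exp (-((t + x) * τ)) : ℂ) * ((x : ℂ) ^ (m / 2) * h x)) (hμ.prod hμ) := by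
  have hpow : Measurable fun x : ℝ => (x : ℂ) ^ (m / 2) := Complex.measurable_ofReal.pow_const _
  have hmeas : AEStronglyMeasurable (Function.uncurry fun (τ x : ℝ) =>
      (Real.exp (-((t + x) * τ)) : ℂ) * ((x : ℂ) ^ (m / 2) * h x)) (hμ.prod hμ) := by
    refine AEStronglyMeasurable.mul ?_ ?_
    · refine Measurable.aestronglyMeasurable ?_
      fun_prop
    · exact (hpow.aestronglyMeasurable.mul (Lp.aestronglyMeasurable h)).comp_snd
  rw [integrable_prod_iff' hmeas]
  constructor
  · filter_upwards [ae_restrict_mem measurableSet_Ioi] with x hx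
    have hx0 : 0 < x := hx
    exact (Integrable.ofReal (𝕜 := ℂ) (integrable_exp_neg_mul (add_pos ht hx0))).mul_const
      ((x : ℂ) ^ (m / 2) * h x)
  · refine (integrable_cauchyInt hm (ofReal_neg_neg_mem ht) h).norm.congr ?_
    filter_upwards [ae_restrict_mem measurableSet_Ioi] with x hx
    have hx0 : 0 < x := hx
    have htx : 0 < t + x := add_pos ht hx0
    simp only [Function.uncurry_apply_pair]
    rw [integral_congr_ae (g := fun τ => Real.exp (-((t + x) * τ)) * ‖(x : ℂ) ^ (m / 2) * h x‖)
      (Eventually.of_forall fun τ => by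
        simp only
        rw [norm_mul, Complex.norm_real, Real.norm_of_nonneg (Real.exp_pos _).le]),
      integral_mul_const, integral_exp_neg_mul htx, norm_mul, norm_mul, norm_div,
      show -(t : ℂ) - x = -((t + x : ℝ) : ℂ) by push_cast; ring, norm_neg, Complex.norm_real,
      Real.norm_of_nonneg htx.le]
    field_simp

theorem pairing_expVec_left {m : ℂ} (hm : -1 < m.re) {r : ℝ} (hr : 0 < r) (h : L2) :
    pairing (expVec m r) h = ∫ x, expFun m r x * h x ∂hμ := by
  rw [pairing_apply]
  refine integral_congr_ae ?_
  filter_upwards [expVec_coe hm hr] with x hx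
  rw [hx]

theorem laplace_inner {m : ℂ} (hm : -1 < m.re) {t τ : ℝ} (hτ : 0 < τ) (h : L2) :
    ∫ x, (Real.exp (-((t + x) * τ)) : ℂ) * ((x : ℂ) ^ (m / 2) * h x) ∂hμ =
      (Real.exp (-(t * τ)) : ℂ) * pairing (expVec m (τ / 2)) h := by
  rw [pairing_expVec_left hm (half_pos hτ), ← integral_const_mul]
  refine integral_congr_ae (Eventually.of_forall fun x => ?_)
  simp only [expFun]
  rw [show -((t + x) * τ) = -(t * τ) + -(2 * (τ / 2) * x) by ring, Real.exp_add]
  push_cast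
  ring

theorem integrable_laplace_left {m : ℂ} (hm : |m.re| < 1) {t : ℝ} (ht : 0 < t) (h : L2) :
    Integrable (fun τ => (Real.exp (-(t * τ)) : ℂ) * pairing (expVec m (τ / 2)) h) hμ := by
  refine (integrable_laplace hm ht h).integral_prod_left.congr ?_
  filter_upwards [ae_restrict_mem measurableSet_Ioi] with τ hτ
  exact laplace_inner (neg_one_lt_re hm) hτ h

/-- Writing `1/(t + x) = ∫ e^{-(t+x)τ} dτ` and exchanging the integrals expresses the Cauchy
integral through pairings with `x^{m/2} e^{-τx}`. These are exactly the vectors whose preimages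
under `W` are Gaussians, so no transform of a second solution has to be computed. -/
theorem cauchyInt_neg {m : ℂ} (hm : |m.re| < 1) {t : ℝ} (ht : 0 < t) (h : L2) :
    cauchyInt m h (-t) =
      -∫ τ, (Real.exp (-(t * τ)) : ℂ) * pairing (expVec m (τ / 2)) h ∂hμ := by
  have h1 := integral_integral_swap (integrable_laplace hm ht h)
  have h2 : ∫ τ, (Real.exp (-(t * τ)) : ℂ) * pairing (expVec m (τ / 2)) h ∂hμ =
      ∫ τ, ∫ x, (Real.exp (-((t + x) * τ)) : ℂ) * ((x : ℂ) ^ (m / 2) * h x) ∂hμ ∂hμ :=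
    setIntegral_congr_fun measurableSet_Ioi fun τ hτ => (laplace_inner (neg_one_lt_re hm) hτ h).symm
  rw [h2, h1, cauchyInt, ← integral_neg]
  refine setIntegral_congr_fun measurableSet_Ioi fun x hx => ?_
  have hx0 : 0 < x := hx
  have htx : 0 < t + x := add_pos ht hx0
  have htx' : ((t + x : ℝ) : ℂ) ≠ 0 := Complex.ofReal_ne_zero.mpr htx.ne'
  rw [integral_mul_const, integral_complex_ofReal, integral_exp_neg_mul htx,
    show -(t : ℂ) - x = -((t + x : ℝ) : ℂ) by push_cast; ring, div_neg, Complex.ofReal_inv]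
  field_simp

theorem pairing_expVec_opW {m : ℂ} (hm : -1 < m.re) {τ : ℝ} (hτ : 0 < τ) (f : L2) :
    pairing (expVec m (τ / 2)) (opW m f) =
      (2 : ℂ) ^ (1 / 2 : ℂ) * (τ : ℂ) ^ (-(m + 1)) * pairing (gaussVec m (2 / τ)) f := by
  have hs : 0 < 2 / τ := by positivity
  have hi : (2 / τ)⁻¹ = τ / 2 := inv_div _ _
  rw [← pairing_opW hm (gaussVec m (2 / τ)) f, opW_gaussVec hm hs, pairing_smul_left, hi]
  have h1 : (τ : ℂ) ^ (-(m + 1)) * ((2 / τ : ℝ) : ℂ) ^ (-(m + 1)) = (2 : ℂ) ^ (-(m + 1)) := by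
    rw [← Complex.mul_cpow_ofReal_nonneg hτ.le hs.le, ← Complex.ofReal_mul,
      mul_div_cancel₀ _ hτ.ne', Complex.ofReal_ofNat]
  have h2 : (2 : ℂ) ^ (1 / 2 : ℂ) * (2 : ℂ) ^ (-(m + 1)) * (2 : ℂ) ^ (m + 1 / 2) = 1 := by
    rw [← Complex.cpow_add _ _ two_ne_zero, ← Complex.cpow_add _ _ two_ne_zero]
    convert Complex.cpow_zero (2 : ℂ) using 2
    ring
  rw [← h1] at h2
  linear_combination (-pairing (expVec m (τ / 2)) (opW m f)) * h2

/-- The integrand of the Laplace representation of the profile value. -/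
def laplaceFun (m : ℂ) (t : ℝ) (p : L2 × L2) (τ : ℝ) : ℂ :=
  (Real.exp (-(t * τ)) : ℂ) * (τ : ℂ) ^ (-(m + 1)) *
    (t * pairing (gaussVec m (2 / τ)) p.1 + 1 / 4 * pairing (gaussVec m (2 / τ)) p.2)

theorem laplaceFun_eq {m : ℂ} (hm : -1 < m.re) {t τ : ℝ} (hτ : 0 < τ) (p : L2 × L2) :
    (2 : ℂ) ^ (1 / 2 : ℂ) * laplaceFun m t p τ =
      -((Real.exp (-(t * τ)) : ℂ) * pairing (expVec m (τ / 2)) (shifted m (-t) p)) := by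
  rw [shifted, map_sub, map_smul, map_smul, pairing_expVec_opW hm hτ, pairing_expVec_opW hm hτ,
    laplaceFun, smul_eq_mul, smul_eq_mul]
  ring

theorem integrable_laplaceFun {m : ℂ} (hm : |m.re| < 1) {t : ℝ} (ht : 0 < t) (p : L2 × L2) :
    Integrable (laplaceFun m t p) hμ := by
  have h2 : (2 : ℂ) ^ (1 / 2 : ℂ) ≠ 0 := by simp [Complex.cpow_eq_zero_iff]
  refine ((integrable_laplace_left hm ht (shifted m (-t) p)).neg.const_mul
    ((2 : ℂ) ^ (1 / 2 : ℂ))⁻¹).congr ?_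
  filter_upwards [ae_restrict_mem measurableSet_Ioi] with τ hτ
  rw [Pi.neg_apply, ← laplaceFun_eq (neg_one_lt_re hm) hτ, inv_mul_cancel_left₀ h2]

theorem profileValue_neg {m : ℂ} (hm : |m.re| < 1) {t : ℝ} (ht : 0 < t) (p : L2 × L2) :
    profileValue m (-t) hm (ofReal_neg_neg_mem ht) p =
      (2 : ℂ) ^ (1 / 2 : ℂ) * ∫ τ, laplaceFun m t p τ ∂hμ := by
  rw [profileValue, pairing_profile, cauchyInt_neg hm ht, ← integral_const_mul, ← integral_neg]
  exact setIntegral_congr_fun measurableSet_Ioi fun τ hτ =>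
    (laplaceFun_eq (neg_one_lt_re hm) hτ p).symm

/-! ### The second solution for `m ≠ 0` -/

theorem integrable_mul_gauss {σ : ℝ} (hσ : 0 < σ) :
    Integrable (fun x : ℝ => (x : ℂ) * (Real.exp (-(σ * x ^ 2 / 2)) : ℝ)) hμ := by
  simpa using integrable_gauss (w := 0) (by simp) hσ

theorem integral_mul_gauss {σ : ℝ} (hσ : 0 < σ) :
    ∫ x : ℝ, (x : ℂ) * (Real.exp (-(σ * x ^ 2 / 2)) : ℝ) ∂hμ = (σ : ℂ)⁻¹ := by
  have h := integral_gauss (w := 0) (by simp) hσ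
  simpa [Complex.cpow_neg_one] using h

theorem cube_eq (x : ℝ) : (x : ℂ) ^ (2 * 1 + 1 : ℂ) = (x : ℂ) ^ 3 := by
  rw [show (2 * 1 + 1 : ℂ) = ((3 : ℕ) : ℂ) by norm_num, Complex.cpow_natCast]

theorem integrable_cube_mul_gauss {σ : ℝ} (hσ : 0 < σ) :
    Integrable (fun x : ℝ => (x : ℂ) ^ 3 * (Real.exp (-(σ * x ^ 2 / 2)) : ℝ)) hμ := by
  have h := integrable_gauss (w := 1) (by simp) hσ
  simpa only [cube_eq] using h

theorem integral_cube_mul_gauss {σ : ℝ} (hσ : 0 < σ) :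
    ∫ x : ℝ, (x : ℂ) ^ 3 * (Real.exp (-(σ * x ^ 2 / 2)) : ℝ) ∂hμ = 2 / (σ : ℂ) ^ 2 := by
  have h := integral_gauss (w := 1) (by simp) hσ
  simp only [cube_eq] at h
  have hG : Complex.Gamma (1 + 1) = 1 := by
    rw [Complex.Gamma_add_one 1 one_ne_zero, Complex.Gamma_one, mul_one]
  have hs : (σ : ℂ) ^ (-(1 + 1) : ℂ) = ((σ : ℂ) ^ 2)⁻¹ := by
    rw [Complex.cpow_neg, show (1 + 1 : ℂ) = ((2 : ℕ) : ℂ) by norm_num, Complex.cpow_natCast]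
  rw [h, hG, hs, Complex.cpow_one]
  ring

section
variable {m : ℂ}

theorem gaussFun_mul_neg {s t x : ℝ} (hx : 0 < x) : gaussFun m s x * gaussFun (-m) t x =
    (x : ℂ) * (Real.exp (-((s + t) * x ^ 2 / 2)) : ℝ) := by
  have hx0 : (x : ℂ) ≠ 0 := Complex.ofReal_ne_zero.mpr hx.ne'
  have h1 : (x : ℂ) ^ (m + 1 / 2) * (x : ℂ) ^ (-m + 1 / 2) = x := by
    rw [← Complex.cpow_add _ _ hx0, show m + 1 / 2 + (-m + 1 / 2) = 1 by ring, Complex.cpow_one]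
  rw [gaussFun, gaussFun, show -((s + t) * x ^ 2 / 2) = -(s * x ^ 2 / 2) + -(t * x ^ 2 / 2) by ring,
    Real.exp_add, Complex.ofReal_mul]
  linear_combination ((Real.exp (-(s * x ^ 2 / 2)) : ℝ) : ℂ) * (Real.exp (-(t * x ^ 2 / 2)) : ℝ) * h1

theorem neg_re_bounds (hm : |m.re| < 1) : -1 < m.re ∧ -1 < (-m).re := by
  obtain ⟨h1, h2⟩ := abs_lt.mp hm
  exact ⟨h1, by rw [Complex.neg_re]; linarith⟩

theorem pairing_gauss_second_fst (hm : |m.re| < 1) {s : ℝ} (hs : 0 < s) :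
    pairing (gaussVec m s) (gaussPair (-m) 1).1 = ((s + 1 : ℝ) : ℂ)⁻¹ := by
  obtain ⟨h1, h2⟩ := neg_re_bounds hm
  rw [gaussPair_fst, gaussVec, gaussVec, pairing_toL2 (memLp_gaussFun h1 hs)
    (memLp_gaussFun h2 one_pos), ← integral_mul_gauss (by linarith)]
  exact setIntegral_congr_fun measurableSet_Ioi fun x hx => gaussFun_mul_neg hx

theorem pairing_gauss_second_snd (hm : |m.re| < 1) {s : ℝ} (hs : 0 < s) :
    pairing (gaussVec m s) (gaussPair (-m) 1).2 =
      2 * (1 - m) / ((s + 1 : ℝ) : ℂ) - 2 / ((s + 1 : ℝ) : ℂ) ^ 2 := by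
  obtain ⟨h1, h2⟩ := neg_re_bounds hm
  have hs1 : 0 < s + 1 := by linarith
  rw [gaussPair_snd h2 one_pos, gaussVec, pairing_toL2 (memLp_gaussFun h1 hs)
    (memLp_Lgauss h2 one_pos), div_eq_mul_inv, ← integral_mul_gauss hs1,
    ← integral_cube_mul_gauss hs1, ← integral_const_mul,
    ← integral_sub ((integrable_mul_gauss hs1).const_mul _) (integrable_cube_mul_gauss hs1)]
  refine setIntegral_congr_fun measurableSet_Ioi fun x hx => ?_
  have := gaussFun_mul_neg (m := m) (s := s) (t := 1) hx
  rw [mul_left_comm, this, Complex.ofReal_one]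
  ring

/-- The value is the Wronskian of `x^{1/2-m}` and `x^{1/2+m}`, computed here from explicit
integrals. It is nonzero exactly because `m ≠ 0`; the logarithmic solution is needed otherwise. -/
theorem bdryForm_second (hm : |m.re| < 1) :
    bdryForm (gaussPair (-m) 1) (gaussPair m 1) = 2 * m := by
  have h1 := pairing_gauss_second_snd hm one_pos
  have h2 := pairing_gauss_second_snd (m := -m) (by simpa using hm) one_pos
  rw [neg_neg] at h2
  rw [bdryForm, pairing_comm (gaussPair (-m) 1).2, gaussPair_fst, gaussPair_fst, h1, h2]
  push_cast
  ring

theorem tendsto_second_boundary {t : ℝ} (ht : 0 < t) :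
    Tendsto (fun τ : ℝ => (Real.exp (-(t * τ)) : ℂ) * ((τ : ℂ) ^ (1 - m) / (τ + 2))) atTop
      (𝓝 0) := by
  rw [tendsto_zero_iff_norm_tendsto_zero]
  have h := tendsto_rpow_mul_exp_neg_mul_atTop_nhds_zero (1 - m).re t ht
  refine squeeze_zero' (Eventually.of_forall fun _ => norm_nonneg _) ?_ h
  filter_upwards [eventually_gt_atTop 0] with τ hτ
  have h2 : ‖(τ : ℂ) + 2‖ = τ + 2 := by
    rw [show (τ : ℂ) + 2 = ((τ + 2 : ℝ) : ℂ) by push_cast; ring, Complex.norm_real,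
      Real.norm_of_nonneg (by positivity)]
  rw [norm_mul, norm_div, Complex.norm_real, Real.norm_of_nonneg (Real.exp_pos _).le,
    Complex.norm_cpow_eq_rpow_re_of_pos hτ, h2, mul_comm, neg_mul]
  refine mul_le_mul_of_nonneg_right (div_le_self (by positivity) (by linarith)) (Real.exp_pos _).le

/-- The integrand is the derivative of `e^{-tτ} τ^{1-m} / (τ + 2)`, which vanishes at `∞`, and at
`0` because `Re m < 1`. -/
theorem integral_second_boundary (hm : |m.re| < 1) {t : ℝ} (ht : 0 < t) {g : ℝ → ℂ}
    (hg : Integrable g hμ) (h : ∀ τ : ℝ, 0 < τ → g τ = (Real.exp (-(t * τ)) : ℂ) *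
      (τ : ℂ) ^ (-(m + 1)) * (-t * τ * (τ / (τ + 2)) - m * (τ / (τ + 2)) + τ / (τ + 2) -
        (τ / (τ + 2)) ^ 2)) : ∫ τ, g τ ∂hμ = 0 := by
  obtain ⟨h1, h2⟩ := abs_lt.mp hm
  have hne : (1 - m) ≠ 0 := fun h0 => by
    have := congrArg Complex.re h0
    simp at this
    linarith
  have hcont : ContinuousWithinAt (fun τ : ℝ => (Real.exp (-(t * τ)) : ℂ) *
      ((τ : ℂ) ^ (1 - m) / (τ + 2))) (Ici 0) 0 := by
    refine ContinuousAt.continuousWithinAt ?_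
    refine ContinuousAt.mul (by fun_prop) (ContinuousAt.div ?_ (by fun_prop) (by simp))
    exact Complex.continuousAt_ofReal_cpow_const 0 (1 - m) (Or.inl (by simp; linarith))
  have := integral_Ioi_of_hasDerivAt_of_tendsto hcont (f' := g) (fun τ hτ => ?_) hg
    (tendsto_second_boundary (m := m) ht)
  · rw [this, Complex.ofReal_zero, Complex.zero_cpow hne]
    simp
  · have hτ0 : 0 < τ := hτ
    have hτ' : (τ : ℂ) ≠ 0 := Complex.ofReal_ne_zero.mpr hτ0.ne'
    have hτ2 : (τ : ℂ) + 2 ≠ 0 := by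
      rw [show (τ : ℂ) + 2 = ((τ + 2 : ℝ) : ℂ) by push_cast; ring]
      exact Complex.ofReal_ne_zero.mpr (by positivity)
    have d1 : HasDerivAt (fun τ : ℝ => (Real.exp (-(t * τ)) : ℂ))
        ((Real.exp (-(t * τ)) * -(t * 1) : ℝ) : ℂ) τ :=
      (((hasDerivAt_id τ).const_mul t).neg.exp).ofReal_comp
    have d2 : HasDerivAt (fun τ : ℝ => (τ : ℂ) + 2) 1 τ :=
      ((hasDerivAt_id τ).ofReal_comp).add_const 2
    have d3 := d1.mul ((hasDerivAt_cpow (w := 1 - m) hτ0).div d2 hτ2)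
    rw [h τ hτ0]
    refine d3.congr_deriv ?_
    have e1 : (τ : ℂ) ^ (1 - m - 1) = (τ : ℂ) ^ (-(m + 1)) * τ := by
      rw [show 1 - m - 1 = -(m + 1) + 1 by ring, Complex.cpow_add _ _ hτ', Complex.cpow_one]
    have e2 : (τ : ℂ) ^ (1 - m) = (τ : ℂ) ^ (-(m + 1)) * τ ^ 2 := by
      rw [show 1 - m = -(m + 1) + 2 by ring, Complex.cpow_add _ _ hτ', Complex.cpow_ofNat]
    simp only [Pi.div_apply]
    rw [e1, e2]
    push_cast
    field_simp
    ring

theorem laplaceFun_second (hm : |m.re| < 1) {t τ : ℝ} (hτ : 0 < τ) :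
    laplaceFun m t (gaussPair (-m) 1) τ = (Real.exp (-(t * τ)) : ℂ) * (τ : ℂ) ^ (-(m + 1)) *
      (t * (τ / (τ + 2)) + (1 - m) / 2 * (τ / (τ + 2)) - 1 / 2 * (τ / (τ + 2)) ^ 2) := by
  have hs : 0 < 2 / τ := by positivity
  have hτ' : (τ : ℂ) ≠ 0 := Complex.ofReal_ne_zero.mpr hτ.ne'
  have hτ2 : (τ : ℂ) + 2 ≠ 0 := by
    rw [show (τ : ℂ) + 2 = ((τ + 2 : ℝ) : ℂ) by push_cast; ring]
    exact Complex.ofReal_ne_zero.mpr (by positivity)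
  have e : ((2 / τ + 1 : ℝ) : ℂ) = (τ + 2) / τ := by
    push_cast
    field_simp
    ring
  rw [laplaceFun, pairing_gauss_second_fst hm hs, pairing_gauss_second_snd hm hs, e]
  field_simp
  ring

/-- Twice the integrand differs from `t τ^{-m} e^{-tτ}` by an exact derivative without boundary
contribution, so only a Gamma integral is left. -/
theorem integral_laplaceFun_second (hm : |m.re| < 1) {t : ℝ} (ht : 0 < t) :
    ∫ τ, laplaceFun m t (gaussPair (-m) 1) τ ∂hμ =
      1 / 2 * ((t : ℂ) ^ m * Complex.Gamma (1 - m)) := by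
  have hi := integrable_laplaceFun hm ht (gaussPair (-m) 1)
  have hm2 := (neg_re_bounds hm).2
  have hj := (integrable_cpow_exp hm2 ht).const_mul (t : ℂ)
  have ht' : (t : ℂ) ≠ 0 := Complex.ofReal_ne_zero.mpr ht.ne'
  have h0 := integral_second_boundary hm ht ((hi.const_mul 2).sub hj) (fun τ hτ => by
    have hτ' : (τ : ℂ) ≠ 0 := Complex.ofReal_ne_zero.mpr hτ.ne'
    have hτ2 : (τ : ℂ) + 2 ≠ 0 := by
      rw [show (τ : ℂ) + 2 = ((τ + 2 : ℝ) : ℂ) by push_cast; ring]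
      exact Complex.ofReal_ne_zero.mpr (by positivity)
    have e1 : (τ : ℂ) ^ (-m) = (τ : ℂ) ^ (-(m + 1)) * τ := by
      rw [show -m = -(m + 1) + 1 by ring, Complex.cpow_add _ _ hτ', Complex.cpow_one]
    rw [Pi.sub_apply, laplaceFun_second hm hτ, e1]
    field_simp
    ring)
  have h1 := integral_sub (hi.const_mul 2) hj
  rw [integral_const_mul, integral_const_mul, integral_cpow_exp hm2 ht] at h1
  have h2 : ∫ τ, ((fun τ => 2 * laplaceFun m t (gaussPair (-m) 1) τ) -
      fun τ : ℝ => (t : ℂ) * ((τ : ℂ) ^ (-m) * (Real.exp (-(t * τ)) : ℝ))) τ ∂hμ = _ := h1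
  rw [h0, show -(-m + 1) = m - 1 by ring, cpow_sub_one_eq ht, show -m + 1 = 1 - m by ring] at h2
  field_simp at h2 ⊢
  linear_combination -h2

theorem profileValue_second {z : ℂ} (hm : |m.re| < 1) (hz : -z ∈ Complex.slitPlane) :
    profileValue m z hm hz (gaussPair (-m) 1) =
      (2 : ℂ) ^ (-(1 / 2) : ℂ) * ((-z) ^ m * Complex.Gamma (1 - m)) := by
  refine profileValue_of_pos hm
    (g := fun w => (2 : ℂ) ^ (-(1 / 2) : ℂ) * (w ^ m * Complex.Gamma (1 - m))) ?_
    (fun t ht => ?_) z hz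
  · intro w hw
    exact (((differentiableAt_id.cpow_const hw).mul_const _).const_mul _).differentiableWithinAt
  · rw [profileValue_neg hm ht, integral_laplaceFun_second hm ht, ← mul_assoc]
    congr 1
    rw [show (-(1 / 2) : ℂ) = 1 / 2 - 1 by ring, Complex.cpow_sub _ _ two_ne_zero,
      Complex.cpow_one]
    ring

end

/-! ### Integrals with logarithms -/

/-- A factor `log x` arises from differentiating the Mellin transform in its exponent, so a closed
form of the transform near `s` yields the logarithmic integral. -/
theorem integral_log_of_mellin {f : ℝ → ℂ} {C c : ℝ} (hf : Continuous f) (hc : 0 < c)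
    (hb : ∀ x, 0 < x → ‖f x‖ ≤ C * Real.exp (-(c * x))) {s : ℂ} (hs : 0 < s.re) {g : ℂ → ℂ} {g' : ℂ}
    (hg : ∀ w : ℂ, 0 < w.re → ∫ x : ℝ, (x : ℂ) ^ (w - 1) * f x ∂hμ = g w)
    (hg' : HasDerivAt g g' s) :
    Integrable (fun x : ℝ => (x : ℂ) ^ (s - 1) * (Real.log x * f x)) hμ ∧
      ∫ x : ℝ, (x : ℂ) ^ (s - 1) * (Real.log x * f x) ∂hμ = g' := by
  have htop : f =O[atTop] fun x : ℝ => x ^ (-(s.re + 1)) := by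
    have h1 : f =O[atTop] fun x : ℝ => Real.exp (-c * x) := by
      refine Asymptotics.IsBigO.of_bound C ?_
      filter_upwards [eventually_gt_atTop 0] with x hx
      rw [Real.norm_of_nonneg (Real.exp_pos _).le, neg_mul]
      exact hb x hx
    exact h1.trans (isLittleO_exp_neg_mul_rpow_atTop hc _).isBigO
  have hbot : f =O[𝓝[>] 0] fun x : ℝ => x ^ (-(0 : ℝ)) := by
    simp only [neg_zero, Real.rpow_zero]
    exact (hf.tendsto 0).isBigO_one ℝ |>.mono nhdsWithin_le_nhds
  obtain ⟨h1, h2⟩ := mellin_hasDerivAt_of_isBigO_rpow (hf.locallyIntegrable.locallyIntegrableOn _)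
    htop (by linarith) hbot hs
  refine ⟨?_, ?_⟩
  · have : IntegrableOn (fun x : ℝ => (x : ℂ) ^ (s - 1) • (Real.log x • f x)) (Ioi 0) := h1
    simpa only [smul_eq_mul, Complex.real_smul, IntegrableOn] using this
  · have h3 : mellin f =ᶠ[𝓝 s] g := by
      have : {w : ℂ | 0 < w.re} ∈ 𝓝 s := (isOpen_lt continuous_const Complex.continuous_re).mem_nhds hs
      filter_upwards [this] with w hw
      rw [← hg w hw]
      simp only [mellin, smul_eq_mul]
    have h4 := (h2.congr_of_eventuallyEq h3.symm).unique hg'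
    rw [← h4]
    simp only [mellin, smul_eq_mul, Complex.real_smul]

theorem hasDerivAt_const_cpow {c : ℝ} (hc : 0 < c) (a w : ℂ) :
    HasDerivAt (fun w => (c : ℂ) ^ (a * w)) ((c : ℂ) ^ (a * w) * Real.log c * a) w := by
  have h := ((hasDerivAt_id w).const_mul a).const_cpow (c := (c : ℂ))
    (Or.inl (Complex.ofReal_ne_zero.mpr hc.ne'))
  refine h.congr_deriv ?_
  rw [Complex.ofReal_log hc.le, mul_one]
  rfl

theorem integral_log_gauss {σ : ℝ} (hσ : 0 < σ) {s G : ℂ} (hs : 0 < s.re)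
    (hG : HasDerivAt Complex.Gamma G (1 / 2 * s)) :
    Integrable (fun x : ℝ => (x : ℂ) ^ (s - 1) * (Real.log x * gaussCut σ x)) hμ ∧
      ∫ x : ℝ, (x : ℂ) ^ (s - 1) * (Real.log x * gaussCut σ x) ∂hμ =
        1 / 4 * (((2 * σ⁻¹ : ℝ) : ℂ) ^ (1 / 2 * s) *
          (Real.log (2 * σ⁻¹) * Complex.Gamma (1 / 2 * s) + G)) := by
  obtain ⟨C, hC, hb⟩ := exists_gauss_bound hσ
  have hσi : 0 < 2 * σ⁻¹ := by positivity
  have hd : HasDerivAt (fun w => 1 / 2 * (((2 * σ⁻¹ : ℝ) : ℂ) ^ (1 / 2 * w) *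
      Complex.Gamma (1 / 2 * w))) _ s :=
    ((hasDerivAt_const_cpow hσi (1 / 2) s).mul
      (HasDerivAt.comp s hG ((hasDerivAt_id s).const_mul (1 / 2)))).const_mul (1 / 2)
  have key := integral_log_of_mellin (f := gaussCut σ) (C := C) (c := 1) (s := s)
    (isCutoff_gaussCut hσ).smooth.continuous one_pos (fun x hx => by
      rw [gaussCut, Complex.norm_real, Real.norm_of_nonneg (Real.exp_pos _).le, one_mul]
      refine le_trans ?_ (hb x hx.le)
      exact le_mul_of_one_le_left (Real.exp_pos _).le (by nlinarith)) hs (fun w hw => by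
      have h := integral_gauss (w := 1 / 2 * w - 1) (by simp; linarith) hσ
      rw [show 2 * (1 / 2 * w - 1) + 1 = w - 1 by ring, sub_add_cancel,
        Complex.cpow_sub _ _ two_ne_zero, Complex.cpow_one] at h
      refine h.trans ?_
      rw [two_mul_ofReal_cpow (inv_pos.mpr hσ), Complex.ofReal_inv, Complex.inv_cpow _ _ (by
        rw [Complex.arg_ofReal_of_nonneg hσ.le]; exact Real.pi_pos.ne), Complex.cpow_neg]
      ring) hd
  refine ⟨key.1, key.2.trans ?_⟩
  simp only [Function.comp_apply]
  ring

/-- Here and in the next lemma the Euler–Mascheroni constant enters, through the derivatives of `Γ`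
at `2` and at `1`. -/
theorem hasDerivAt_Gamma_two :
    HasDerivAt Complex.Gamma (1 - Real.eulerMascheroniConstant) (1 / 2 * 4) := by
  have h := Complex.hasDerivAt_Gamma_nat 1
  norm_num at h ⊢
  rw [sub_eq_neg_add]
  exact h

theorem hasDerivAt_Gamma_one' :
    HasDerivAt Complex.Gamma (-Real.eulerMascheroniConstant) (1 / 2 * 2) := by
  have h := Complex.hasDerivAt_Gamma_one
  norm_num
  exact h

theorem integral_mul_log_gauss {σ : ℝ} (hσ : 0 < σ) :
    Integrable (fun x : ℝ => (x : ℂ) * (Real.log x * gaussCut σ x)) hμ ∧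
      ∫ x : ℝ, (x : ℂ) * (Real.log x * gaussCut σ x) ∂hμ =
        1 / 2 * ((σ : ℂ)⁻¹ * (Real.log (2 * σ⁻¹) - Real.eulerMascheroniConstant)) := by
  have h := integral_log_gauss hσ (s := 2) (by simp) hasDerivAt_Gamma_one'
  norm_num at h ⊢
  refine ⟨h.1, h.2.trans ?_⟩
  ring

theorem integral_cube_mul_log_gauss {σ : ℝ} (hσ : 0 < σ) :
    Integrable (fun x : ℝ => (x : ℂ) ^ 3 * (Real.log x * gaussCut σ x)) hμ ∧
      ∫ x : ℝ, (x : ℂ) ^ 3 * (Real.log x * gaussCut σ x) ∂hμ =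
        (σ : ℂ)⁻¹ ^ 2 * (Real.log (2 * σ⁻¹) - Real.eulerMascheroniConstant + 1) := by
  have h := integral_log_gauss hσ (s := 4) (by simp) hasDerivAt_Gamma_two
  have hG : Complex.Gamma (1 / 2 * 4) = 1 := by
    rw [show (1 / 2 * 4 : ℂ) = 1 + 1 by norm_num, Complex.Gamma_add_one 1 one_ne_zero,
      Complex.Gamma_one, mul_one]
  have e1 : ∀ c : ℂ, c ^ (4 - 1 : ℂ) = c ^ 3 := fun c => by
    rw [show (4 - 1 : ℂ) = ((3 : ℕ) : ℂ) by norm_num, Complex.cpow_natCast]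
  have e2 : ∀ c : ℂ, c ^ (1 / 2 * 4 : ℂ) = c ^ 2 := fun c => by
    rw [show (1 / 2 * 4 : ℂ) = ((2 : ℕ) : ℂ) by norm_num, Complex.cpow_natCast]
  simp only [hG, e1, e2] at h
  refine ⟨h.1, h.2.trans ?_⟩
  push_cast
  ring

theorem integral_log_mul_exp {t : ℝ} (ht : 0 < t) :
    Integrable (fun x : ℝ => (Real.log x : ℂ) * (Real.exp (-(t * x)) : ℝ)) hμ ∧
      ∫ x : ℝ, (Real.log x : ℂ) * (Real.exp (-(t * x)) : ℝ) ∂hμ =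
        (t : ℂ)⁻¹ * (-Real.log t - Real.eulerMascheroniConstant) := by
  have hd : HasDerivAt (fun w => (t : ℂ) ^ (-1 * w) * Complex.Gamma w) _ 1 :=
    (hasDerivAt_const_cpow ht (-1) 1).mul Complex.hasDerivAt_Gamma_one
  have key := integral_log_of_mellin (f := fun x => ((Real.exp (-(t * x)) : ℝ) : ℂ)) (C := 1)
    (c := t) (s := 1) (by fun_prop) ht (fun x _ => by
      rw [Complex.norm_real, Real.norm_of_nonneg (Real.exp_pos _).le, one_mul]) (by simp)
    (fun w hw => by
      have h := integral_cpow_exp (w := w - 1) (by simpa using hw) ht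
      rw [sub_add_cancel] at h
      rw [h, neg_one_mul]) hd
  simp only [sub_self, Complex.cpow_zero, one_mul] at key
  refine ⟨key.1, key.2.trans ?_⟩
  rw [mul_one, Complex.cpow_neg_one, Complex.Gamma_one]
  ring

/-! ### The second solution for `m = 0` -/

theorem isSolution_logSol' : IsSolution (0 ^ 2) logSol := by
  simpa using isSolution_logSol

/-- The pair `(G, L G)` for `G = x^{1/2} ln x e^{-x²/2}`. -/
def logPair : L2 × L2 := cutPair (0 ^ 2) (gaussCut 1) logSol

theorem gaussFun_zero_mul {s x : ℝ} (hx : 0 < x) :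
    gaussFun 0 s x * ((x : ℂ) ^ (1 / 2 : ℂ) * gaussCut 1 x) = (x : ℂ) * gaussCut (s + 1) x := by
  have hx0 : (x : ℂ) ≠ 0 := Complex.ofReal_ne_zero.mpr hx.ne'
  have h1 : (x : ℂ) ^ (1 / 2 : ℂ) * (x : ℂ) ^ (1 / 2 : ℂ) = x := by
    rw [← Complex.cpow_add _ _ hx0, add_halves, Complex.cpow_one]
  have h2 : gaussCut (s + 1) x = gaussCut s x * gaussCut 1 x := by
    rw [gaussCut, gaussCut, gaussCut, ← Complex.ofReal_mul, ← Real.exp_add]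
    congr 3
    ring
  rw [gaussFun, ← gaussCut, h2, zero_add]
  linear_combination gaussCut s x * gaussCut 1 x * h1

theorem Lexpr_logPair {x : ℝ} (hx : 0 < x) : Lexpr (0 ^ 2) (fun x => gaussCut 1 x * logSol x) x =
    (2 - x ^ 2) * (gaussCut 1 x * logSol x) + 2 * ((x : ℂ) ^ (1 / 2 : ℂ) * gaussCut 1 x) := by
  have hx0 : (x : ℂ) ≠ 0 := Complex.ofReal_ne_zero.mpr hx.ne'
  rw [isSolution_logSol'.Lexpr_mul (isCutoff_gaussCut one_pos) hx, deriv_deriv_gaussCut,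
    deriv_gaussCut, (hasDerivAt_logSol hx).deriv, cpow_sub_one_eq hx, logSol]
  push_cast
  field_simp
  ring

theorem pairing_log_fst {s : ℝ} (hs : 0 < s) : pairing (gaussVec 0 s) logPair.1 =
    1 / 2 * (((s + 1 : ℝ) : ℂ)⁻¹ *
      (Real.log (2 * (s + 1)⁻¹) - Real.eulerMascheroniConstant)) := by
  have hs1 : 0 < s + 1 := by linarith
  rw [← (integral_mul_log_gauss hs1).2, gaussVec, logPair, cutPair, pairing_toL2
    (memLp_gaussFun (by simp) hs) (isSolution_logSol'.memLp_mul (isCutoff_gaussCut one_pos))]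
  refine setIntegral_congr_fun measurableSet_Ioi fun x hx => ?_
  have := gaussFun_zero_mul (s := s) hx
  simp only [logSol]
  linear_combination (Real.log x : ℂ) * this

theorem pairing_log_snd {s : ℝ} (hs : 0 < s) : pairing (gaussVec 0 s) logPair.2 =
    ((s + 1 : ℝ) : ℂ)⁻¹ * (Real.log (2 * (s + 1)⁻¹) - Real.eulerMascheroniConstant) -
      ((s + 1 : ℝ) : ℂ)⁻¹ ^ 2 * (Real.log (2 * (s + 1)⁻¹) - Real.eulerMascheroniConstant + 1) +
      2 * ((s + 1 : ℝ) : ℂ)⁻¹ := by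
  have hs1 : 0 < s + 1 := by linarith
  obtain ⟨i1, j1⟩ := integral_mul_log_gauss hs1
  obtain ⟨i3, j3⟩ := integral_cube_mul_log_gauss hs1
  have i0 := integrable_mul_gauss hs1
  have j0 := integral_mul_gauss hs1
  rw [gaussVec, logPair, cutPair, pairing_toL2
    (memLp_gaussFun (by simp) hs) (isSolution_logSol'.memLp_Lexpr (isCutoff_gaussCut one_pos))]
  have h := integral_add ((i1.const_mul 2).sub i3) (i0.const_mul 2)
  rw [integral_sub' (i1.const_mul 2) i3, integral_const_mul, integral_const_mul, j1, j3, j0] at h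
  rw [show ∀ A B C : ℂ, A * C - A ^ 2 * B + 2 * A = 2 * (1 / 2 * (A * C)) - A ^ 2 * B + 2 * A by
    intros; ring, ← h]
  refine setIntegral_congr_fun measurableSet_Ioi fun x hx => ?_
  have := gaussFun_zero_mul (s := s) hx
  simp only [Pi.sub_apply]
  rw [Lexpr_logPair hx, logSol, ← gaussCut]
  linear_combination ((2 - x ^ 2) * (Real.log x : ℂ) + 2) * this

/-- The value is the Wronskian of `x^{1/2} ln x` and `x^{1/2}`; being nonzero, it makes the
logarithmic pair a valid second vector. -/
theorem bdryForm_log : bdryForm logPair (gaussPair 0 1) = -1 := by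
  have h1 := pairing_log_fst one_pos
  have h2 := pairing_log_snd one_pos
  have hfst : gaussVec 0 1 = toL2 fun x => gaussCut 1 x * (x : ℂ) ^ (1 / 2 + 0 : ℂ) :=
    (gaussPair_fst 0 1).symm
  have h3 : pairing (gaussPair 0 1).2 logPair.1 =
      2 * pairing (gaussVec 0 1) logPair.1 - ∫ x : ℝ, (x : ℂ) ^ 3 * (Real.log x * gaussCut (1 + 1) x) ∂hμ := by
    have hs1 : (0 : ℝ) < 1 + 1 := by norm_num
    obtain ⟨i1, j1⟩ := integral_mul_log_gauss hs1
    obtain ⟨i3, j3⟩ := integral_cube_mul_log_gauss hs1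
    rw [h1, ← j1, ← integral_const_mul, ← integral_sub (i1.const_mul 2) i3,
      gaussPair_snd (by simp) one_pos, logPair, cutPair, pairing_toL2
      (memLp_Lgauss (by simp) one_pos)
      (isSolution_logSol'.memLp_mul (isCutoff_gaussCut one_pos))]
    refine setIntegral_congr_fun measurableSet_Ioi fun x hx => ?_
    have := gaussFun_zero_mul (s := 1) hx
    simp only [logSol]
    push_cast
    linear_combination (2 - x ^ 2) * (Real.log x : ℂ) * this
  rw [bdryForm, gaussPair_fst, pairing_comm logPair.1, pairing_comm logPair.2, h3, h2, h1,
    (integral_cube_mul_log_gauss (by norm_num : (0 : ℝ) < 1 + 1)).2]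
  push_cast
  ring

/-- The boundary term of the Laplace integral for `m = 0`. -/
def logBoundary (t k τ : ℝ) : ℝ :=
  1 / 2 * (Real.exp (-(t * τ)) * ((τ * Real.log τ + k * τ + 2 * Real.log (τ + 2)) / (τ + 2)))

theorem tendsto_logBoundary {t : ℝ} (ht : 0 < t) (k : ℝ) :
    Tendsto (logBoundary t k) atTop (𝓝 0) := by
  have h1 := tendsto_rpow_mul_exp_neg_mul_atTop_nhds_zero 1 t ht
  have h0 := tendsto_rpow_mul_exp_neg_mul_atTop_nhds_zero 0 t ht
  have h := h1.add (h0.const_mul (|k| + 2))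
  rw [mul_zero, add_zero] at h
  refine squeeze_zero_norm' ?_ h
  filter_upwards [eventually_ge_atTop 1] with τ hτ
  have hτ0 : 0 < τ := by linarith
  have hl1 : 0 ≤ Real.log τ := Real.log_nonneg hτ
  have hl2 : Real.log τ ≤ τ := (Real.log_le_sub_one_of_pos hτ0).trans (by linarith)
  have hl3 : 0 ≤ Real.log (τ + 2) := Real.log_nonneg (by linarith)
  have hl4 : Real.log (τ + 2) ≤ τ + 2 :=
    (Real.log_le_sub_one_of_pos (by linarith)).trans (by linarith)
  have hb : |(τ * Real.log τ + k * τ + 2 * Real.log (τ + 2)) / (τ + 2)| ≤ τ + |k| + 2 := by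
    rw [abs_div, abs_of_pos (by linarith : 0 < τ + 2), div_le_iff₀ (by linarith)]
    have hk1 := neg_abs_le k
    have hk2 := le_abs_self k
    have hk := abs_nonneg k
    rw [abs_le]
    constructor <;> nlinarith
  rw [logBoundary, Real.norm_eq_abs, abs_mul, abs_mul, abs_of_pos (Real.exp_pos _),
    Real.rpow_one, Real.rpow_zero, neg_mul, abs_of_pos (by norm_num : (0 : ℝ) < 1 / 2)]
  have hE := Real.exp_pos (-(t * τ))
  have := mul_le_mul_of_nonneg_left hb hE.le
  have hnn : 0 ≤ Real.exp (-(t * τ)) *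
    |(τ * Real.log τ + k * τ + 2 * Real.log (τ + 2)) / (τ + 2)| := by positivity
  nlinarith

theorem hasDerivAt_logBoundary {t k τ : ℝ} (hτ : 0 < τ) : HasDerivAt (logBoundary t k)
    (1 / 2 * (Real.exp (-(t * τ)) * (-t * ((τ * Real.log τ + k * τ + 2 * Real.log (τ + 2)) / (τ + 2))
      + (Real.log τ + 1 + k + 2 / (τ + 2)) / (τ + 2) -
      (τ * Real.log τ + k * τ + 2 * Real.log (τ + 2)) / (τ + 2) ^ 2))) τ := by
  have hτ2 : τ + 2 ≠ 0 := by positivity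
  have d1 : HasDerivAt (fun τ : ℝ => Real.exp (-(t * τ))) (Real.exp (-(t * τ)) * -(t * 1)) τ :=
    ((hasDerivAt_id τ).const_mul t).neg.exp
  have d2 : HasDerivAt (fun τ : ℝ => τ + 2) 1 τ := (hasDerivAt_id τ).add_const 2
  have d3 : HasDerivAt (fun τ : ℝ => τ * Real.log τ) (1 * Real.log τ + τ * τ⁻¹) τ :=
    (hasDerivAt_id τ).mul (Real.hasDerivAt_log hτ.ne')
  have d4 : HasDerivAt (fun τ : ℝ => k * τ) (k * 1) τ := (hasDerivAt_id τ).const_mul k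
  have d5 : HasDerivAt (fun τ : ℝ => 2 * Real.log (τ + 2)) (2 * (1 / (τ + 2))) τ :=
    (d2.log hτ2).const_mul 2
  have d6 := (d1.mul (((d3.add d4).add d5).div d2 hτ2)).const_mul (1 / 2)
  refine d6.congr_deriv ?_
  simp only [Pi.add_apply, Pi.div_apply]
  field_simp
  ring

theorem continuous_logBoundary_zero (t k : ℝ) :
    ContinuousWithinAt (logBoundary t k) (Ici 0) 0 := by
  have h1 : ContinuousAt (fun τ : ℝ => τ * Real.log τ) 0 := Real.continuous_mul_log.continuousAt
  have h2 : ContinuousAt (fun τ : ℝ => Real.log (τ + 2)) 0 :=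
    ContinuousAt.log (by fun_prop) (by norm_num)
  refine ContinuousAt.continuousWithinAt ?_
  refine continuousAt_const.mul (ContinuousAt.mul (by fun_prop) (ContinuousAt.div ?_ (by fun_prop)
    (by norm_num)))
  exact (h1.add (by fun_prop)).add (h2.const_mul 2)

/-- The integrand has the antiderivative `logBoundary`, which tends to `0` at `∞`. At `0` only the
term with `ln (τ + 2)` survives and equals `(ln 2) / 2`. -/
theorem integral_logBoundary {t k : ℝ} (ht : 0 < t) {g : ℝ → ℂ} (hg : Integrable g hμ)
    (h : ∀ τ : ℝ, 0 < τ → g τ = ((1 / 2 * (Real.exp (-(t * τ)) *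
      (-t * ((τ * Real.log τ + k * τ + 2 * Real.log (τ + 2)) / (τ + 2))
      + (Real.log τ + 1 + k + 2 / (τ + 2)) / (τ + 2) -
      (τ * Real.log τ + k * τ + 2 * Real.log (τ + 2)) / (τ + 2) ^ 2)) : ℝ) : ℂ)) :
    ∫ τ, g τ ∂hμ = -(1 / 2 * Real.log 2) := by
  have hc : ContinuousWithinAt (fun τ => ((logBoundary t k τ : ℝ) : ℂ)) (Ici 0) 0 :=
    Complex.continuous_ofReal.continuousAt.comp_continuousWithinAt
      (continuous_logBoundary_zero t k)
  have ht' : Tendsto (fun τ => ((logBoundary t k τ : ℝ) : ℂ)) atTop (𝓝 0) := by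
    have := (Complex.continuous_ofReal.tendsto 0).comp (tendsto_logBoundary ht k)
    simpa [Function.comp_def] using this
  have := integral_Ioi_of_hasDerivAt_of_tendsto hc (f' := g) (fun τ hτ => ?_) hg ht'
  · rw [this, logBoundary]
    norm_num
  · rw [h τ hτ]
    exact (hasDerivAt_logBoundary hτ).ofReal_comp

theorem laplaceFun_log {t τ : ℝ} (hτ : 0 < τ) : laplaceFun 0 t logPair τ =
    (Real.exp (-(t * τ)) : ℂ) * (τ : ℂ)⁻¹ *
      (t / 2 * (τ / (τ + 2)) * (Real.log 2 + Real.log τ - Real.log (τ + 2) -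
        Real.eulerMascheroniConstant) +
      1 / 4 * (τ / (τ + 2) * (Real.log 2 + Real.log τ - Real.log (τ + 2) -
        Real.eulerMascheroniConstant) - (τ / (τ + 2)) ^ 2 * (Real.log 2 + Real.log τ -
        Real.log (τ + 2) - Real.eulerMascheroniConstant + 1) + 2 * (τ / (τ + 2)))) := by
  have hs : 0 < 2 / τ := by positivity
  have hτ' : (τ : ℂ) ≠ 0 := Complex.ofReal_ne_zero.mpr hτ.ne'
  have e : (2 / τ + 1 : ℝ)⁻¹ = τ / (τ + 2) := by
    field_simp
    ring
  have e1 : ((2 / τ + 1 : ℝ) : ℂ)⁻¹ = τ / (τ + 2) := by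
    rw [← Complex.ofReal_inv, e]
    push_cast
    rfl
  have e2 : Real.log (2 * (2 / τ + 1)⁻¹) = Real.log 2 + Real.log τ - Real.log (τ + 2) := by
    rw [e, Real.log_mul two_ne_zero (by positivity), Real.log_div hτ.ne' (by positivity)]
    ring
  rw [laplaceFun, pairing_log_fst hs, pairing_log_snd hs, e1, e2, zero_add, Complex.cpow_neg_one]
  push_cast
  ring

theorem integral_laplaceFun_log {t : ℝ} (ht : 0 < t) : ∫ τ, laplaceFun 0 t logPair τ ∂hμ =
    -(1 / 2 * (Real.eulerMascheroniConstant + 1 / 2 * Real.log t)) := by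
  have hi := integrable_laplaceFun (m := 0) (by simp) ht logPair
  obtain ⟨il, jl⟩ := integral_log_mul_exp ht
  have ie : Integrable (fun τ => ((Real.exp (-(t * τ)) : ℝ) : ℂ)) hμ :=
    (integrable_exp_neg_mul ht).ofReal
  have je : ∫ τ, ((Real.exp (-(t * τ)) : ℝ) : ℂ) ∂hμ = (t : ℂ)⁻¹ := by
    rw [integral_complex_ofReal, integral_exp_neg_mul ht, Complex.ofReal_inv]
  have ht' : (t : ℂ) ≠ 0 := Complex.ofReal_ne_zero.mpr ht.ne'
  -- With this `k`, subtracting `(t/2) e^{-tτ} (ln τ + k)` from twice the integrand leaves precisely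
  -- the derivative of `logBoundary`. The contributions of `ln 2` cancel in the end.
  set k : ℝ := Real.log 2 - Real.eulerMascheroniConstant with hk
  have i1 := (il.const_mul ((t : ℂ) / 2)).add (ie.const_mul ((t : ℂ) / 2 * k))
  have h0 := integral_logBoundary (k := k) ht ((hi.const_mul 2).sub i1) (fun τ hτ => by
    have hτ' : (τ : ℂ) ≠ 0 := Complex.ofReal_ne_zero.mpr hτ.ne'
    have hτ2 : (τ : ℂ) + 2 ≠ 0 := by
      rw [show (τ : ℂ) + 2 = ((τ + 2 : ℝ) : ℂ) by push_cast; ring]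
      exact Complex.ofReal_ne_zero.mpr (by positivity)
    simp only [Pi.sub_apply, Pi.add_apply]
    rw [laplaceFun_log hτ, hk]
    push_cast
    field_simp
    ring)
  rw [integral_sub' (hi.const_mul 2) i1, integral_add' (il.const_mul _) (ie.const_mul _),
    integral_const_mul, integral_const_mul, integral_const_mul, jl, je, hk] at h0
  push_cast at h0
  field_simp at h0 ⊢
  linear_combination h0

theorem profileValue_log {z : ℂ} (hz : -z ∈ Complex.slitPlane) :
    profileValue 0 z (by simp) hz logPair =
      -((2 : ℂ) ^ (-(1 / 2) : ℂ) * (Real.eulerMascheroniConstant + 1 / 2 * Complex.log (-z))) := by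
  refine profileValue_of_pos (m := 0) (by simp) (g := fun w => -((2 : ℂ) ^ (-(1 / 2) : ℂ) *
    (Real.eulerMascheroniConstant + 1 / 2 * Complex.log w))) ?_ (fun t ht => ?_) z hz
  · intro w hw
    exact ((((Complex.differentiableAt_log hw).const_mul _).const_add _).const_mul
      _).neg.differentiableWithinAt
  · rw [profileValue_neg (by simp) ht, integral_laplaceFun_log ht, ← Complex.ofReal_log ht.le,
      show (-(1 / 2) : ℂ) = 1 / 2 - 1 by ring, Complex.cpow_sub _ _ two_ne_zero,
      Complex.cpow_one]
    ring

/-! ### Linear combinations of solutions -/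

section
variable {α : ℂ} {u v : ℝ → ℂ}

theorem SolutionBound.exists_norm_le {δ : ℝ} (hu : SolutionBound δ u) (a : ℂ) :
    ∃ C : ℝ, 0 ≤ C ∧ ∀ x, 0 < x → ‖a * u x‖ ≤ C * (x ^ (δ - 1 / 2) * Real.exp (x / 2)) ∧
      ‖a * deriv u x‖ ≤ C * (x ^ (δ - 1 / 2) * Real.exp (x / 2)) / x := by
  obtain ⟨C, hC, h⟩ := hu
  refine ⟨‖a‖ * C, by positivity, fun x hx => ⟨?_, ?_⟩⟩
  · rw [norm_mul, mul_assoc]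
    exact mul_le_mul_of_nonneg_left (h x hx).1 (norm_nonneg a)
  · rw [norm_mul, mul_assoc, mul_div_assoc]
    exact mul_le_mul_of_nonneg_left (h x hx).2 (norm_nonneg a)

theorem deriv_linear_combination (hu : ContDiffOn ℝ (⊤ : ℕ∞) u (Ioi 0))
    (hv : ContDiffOn ℝ (⊤ : ℕ∞) v (Ioi 0)) (a b : ℂ) {x : ℝ} (hx : 0 < x) :
    deriv (fun x => a * u x + b * v x) x = a * deriv u x + b * deriv v x := by
  have h1 : DifferentiableAt ℝ u x :=
    (hu.contDiffAt (Ioi_mem_nhds hx)).differentiableAt (by simp)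
  have h2 : DifferentiableAt ℝ v x :=
    (hv.contDiffAt (Ioi_mem_nhds hx)).differentiableAt (by simp)
  exact ((h1.hasDerivAt.const_mul a).add (h2.hasDerivAt.const_mul b)).deriv

theorem Lexpr_linear_combination (hu : ContDiffOn ℝ (⊤ : ℕ∞) u (Ioi 0))
    (hv : ContDiffOn ℝ (⊤ : ℕ∞) v (Ioi 0)) (a b : ℂ) {x : ℝ} (hx : 0 < x) :
    Lexpr α (fun x => a * u x + b * v x) x = a * Lexpr α u x + b * Lexpr α v x := by
  have d : deriv (fun x => a * u x + b * v x) =ᶠ[𝓝 x] fun x => a * deriv u x + b * deriv v x := by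
    filter_upwards [Ioi_mem_nhds hx] with y hy
    exact deriv_linear_combination hu hv a b hy
  have h1 : DifferentiableAt ℝ (deriv u) x :=
    ((hu.deriv_of_isOpen isOpen_Ioi (m := (⊤ : ℕ∞)) (by simp)).contDiffAt
      (Ioi_mem_nhds hx)).differentiableAt (by simp)
  have h2 : DifferentiableAt ℝ (deriv v) x :=
    ((hv.deriv_of_isOpen isOpen_Ioi (m := (⊤ : ℕ∞)) (by simp)).contDiffAt
      (Ioi_mem_nhds hx)).differentiableAt (by simp)
  rw [Lexpr, Lexpr, Lexpr, iteratedDeriv_two, iteratedDeriv_two, iteratedDeriv_two, d.deriv_eq,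
    HasDerivAt.deriv (f := fun x => a * deriv u x + b * deriv v x)
      ((h1.hasDerivAt.const_mul a).add (h2.hasDerivAt.const_mul b))]
  ring

theorem IsSolution.linear_combination (hu : IsSolution α u) (hv : IsSolution α v) {δ : ℝ}
    (hδ : 0 < δ) (bu : SolutionBound δ u) (bv : SolutionBound δ v) (a b : ℂ) :
    IsSolution α fun x => a * u x + b * v x := by
  refine ⟨(contDiffOn_const.mul hu.smooth).add (contDiffOn_const.mul hv.smooth), fun x hx => ?_,
    δ, hδ, ?_⟩
  · rw [Lexpr_linear_combination hu.smooth hv.smooth a b hx, hu.eq x hx, hv.eq x hx, mul_zero,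
      mul_zero, add_zero]
  · obtain ⟨C, hC, h⟩ := bu.exists_norm_le a
    obtain ⟨D, hD, k⟩ := bv.exists_norm_le b
    refine ⟨C + D, by positivity, fun x hx => ⟨?_, ?_⟩⟩
    · rw [add_mul]
      exact (norm_add_le _ _).trans (add_le_add (h x hx).1 (k x hx).1)
    · rw [deriv_linear_combination hu.smooth hv.smooth a b hx, add_mul, add_div]
      exact (norm_add_le _ _).trans (add_le_add (h x hx).2 (k x hx).2)

theorem cutPair_linear_combination (hu : IsSolution α u) (hv : IsSolution α v) {ζ : ℝ → ℂ}
    (hζ : IsCutoff ζ) (a b : ℂ) :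
    cutPair α ζ (fun x => a * u x + b * v x) = a • cutPair α ζ u + b • cutPair α ζ v := by
  have eu := hu.memLp_mul hζ
  have ev := hv.memLp_mul hζ
  have lu := hu.memLp_Lexpr hζ
  have lv := hv.memLp_Lexpr hζ
  rw [cutPair, cutPair, cutPair, Prod.smul_mk, Prod.smul_mk, Prod.mk_add_mk, ← toL2_smul a eu,
    ← toL2_smul b ev, ← toL2_smul a lu, ← toL2_smul b lv,
    ← toL2_add (eu.const_mul a) (ev.const_mul b), ← toL2_add (lu.const_mul a) (lv.const_mul b)]
  have e : (fun x => ζ x * (a * u x + b * v x)) = fun x => a * (ζ x * u x) + b * (ζ x * v x) := by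
    funext x
    ring
  rw [e]
  refine Prod.ext rfl (toL2_congr_pos fun x hx => ?_)
  exact Lexpr_linear_combination (hu.smooth_mul hζ) (hv.smooth_mul hζ) a b hx

end

/-! ### The equality of operators -/

/-- The operator given by rank one perturbed resolvents is conjugate to the restriction of
`L_{m²}^max / 4` by the boundary condition `a u₂ + b x^{1/2+m}`, if the coefficients match. -/
theorem conjugate_ofResolvents_rankOne {m : ℂ} (hm : |m.re| < 1) {u₂ : ℝ → ℂ}
    (hu₂ : IsSolution (m ^ 2) u₂) {δ : ℝ} (hδ : 0 < δ) (hδm : δ ≤ 1 + m.re)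
    (b₂ : SolutionBound δ u₂) {ω : ℂ} (hω : ω ≠ 0)
    (hform : bdryForm (cutPair (m ^ 2) (gaussCut 1) u₂) (gaussPair m 1) = ω) {a b : ℂ}
    (hab : a ≠ 0 ∨ b ≠ 0) {Ω : Set ℂ} (hΩ : ∀ z ∈ Ω, -z ∈ Complex.slitPlane) (hne : Ω.Nonempty)
    (c : Ω → ℂ) (hc : ∀ z : Ω, a * (2 ^ (1 / 2 : ℂ) * ω / Complex.Gamma (m + 1) / 4) +
      c z * (a * profileValue m z hm (hΩ z z.2) (cutPair (m ^ 2) (gaussCut 1) u₂) +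
        b * (2 ^ (-(1 / 2) : ℂ) * Complex.Gamma (m + 1))) = 0) :
    HasResolvents Ω (fun z => rankOneResolvent m z hm (hΩ z z.2) (c z))
      (ofResolvents Ω fun z => rankOneResolvent m z hm (hΩ z z.2) (c z)) ∧
    conjugate (opWEquiv m (neg_one_lt_re hm))
      (ofResolvents Ω fun z => rankOneResolvent m z hm (hΩ z z.2) (c z)) =
      (1 / 4 : ℂ) • (Lmax (m ^ 2)).domRestrict
        (boundaryCondition (m ^ 2) fun x => a * u₂ x + b * (x : ℂ) ^ (1 / 2 + m)) := by
  have hm1 := neg_one_lt_re hm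
  have hu₁ := isSolution_cpow hm1
  have hG := isCutoff_gaussCut one_pos
  have hu := hu₂.linear_combination hu₁ hδ b₂ (solutionBound_cpow hδm) a b
  have hU := cutPair_linear_combination hu₂ hu₁ hG a b
  have hform' : bdryForm (cutPair (m ^ 2) (gaussCut 1) u₂) (gaussPair m 1) ≠ 0 := hform ▸ hω
  refine conjugate_ofResolvents (hasResolvents_rankOne hm (hu₂.cutPair_mem_graphMax hG) hform' hab
    rfl hΩ c (fun z => ?_) fun p => ?_) hne
  · rw [profileValue_add, profileValue_smul, profileValue_smul, profileValue_gaussPair, bdryCoef,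
      bdryForm_add_left, bdryForm_smul_left, bdryForm_smul_left, hform, bdryForm_self]
    refine Eq.trans ?_ (hc z)
    ring
  · rw [mem_conjugate_graph, ← opWEquiv_apply m hm1, ← opWEquiv_apply m hm1, ← map_smul]
    simp only [ContinuousLinearEquiv.symm_apply_apply]
    rw [mem_smul_graph_iff (by norm_num), graph_boundaryCondition hm1 hu₂ hform' hu, hU]
    rfl

/-! ### The regular sets -/

theorem cpow_nonconstant {m : ℂ} (hm : m ≠ 0) (c : ℂ) :
    ∃ z : ℂ, -z ∈ Complex.slitPlane ∧ (-z) ^ m ≠ c := by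
  by_contra! h
  have h1 : ∀ t : ℝ, 0 < t → (t : ℂ) ^ m = c := fun t ht => by
    have := h (-t) (by rw [neg_neg]; exact Complex.ofReal_mem_slitPlane.mpr ht)
    rwa [neg_neg] at this
  have h2 := hasDerivAt_cpow (w := m) one_pos
  have h3 : (fun y : ℝ => (y : ℂ) ^ m) =ᶠ[𝓝 1] fun _ => c := by
    filter_upwards [Ioi_mem_nhds one_pos] with y hy using h1 y hy
  have := h2.unique ((hasDerivAt_const (1 : ℝ) c).congr_of_eventuallyEq h3)
  simp at this
  exact hm this

/-- An operator is recovered from its resolvents only if there is at least one regular point, and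
for `m ≠ 0` the power `(-z)^m` cannot be constantly equal to the single excluded value. -/
theorem regularSet_nonempty {m : ℂ} (hm : m ≠ 0) (lam : OnePoint ℂ) :
    (regularSet m lam).Nonempty := by
  cases lam with
  | infty => exact ⟨-1, by simp [regularSet]⟩
  | coe l =>
    -- For `l = 0` nothing is excluded; the value `0` that the inverse then takes does no harm.
    obtain ⟨z, hz, h⟩ := cpow_nonconstant hm (l * (Real.pi / Complex.sin (Real.pi * m)))⁻¹
    refine ⟨z, hz, fun h0 => h ?_⟩
    rw [freeG] at h0
    exact eq_inv_of_mul_eq_one_left (by linear_combination -h0)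

theorem regularSetLog_nonempty (rho : OnePoint ℂ) : (regularSetLog rho).Nonempty := by
  cases rho with
  | infty => exact ⟨-1, by simp [regularSetLog]⟩
  | coe r =>
    by_cases h : r = 0
    · refine ⟨-(Real.exp 1 : ℝ), ?_, ?_⟩
      · rw [neg_neg]
        exact Complex.ofReal_mem_slitPlane.mpr (Real.exp_pos 1)
      · rw [neg_neg, h, zero_add, ← Complex.ofReal_log (Real.exp_pos 1).le, Real.log_exp]
        simp
    · refine ⟨-1, by simp, ?_⟩
      rw [neg_neg, Complex.log_one, add_zero]
      exact h

/-! ### The coefficients -/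

theorem sin_pi_mul_ne_zero {m : ℂ} (hm : |m.re| < 1) (hm0 : m ≠ 0) :
    Complex.sin (Real.pi * m) ≠ 0 := by
  rw [Complex.sin_ne_zero_iff]
  intro k hk
  have hpi : (Real.pi : ℂ) ≠ 0 := Complex.ofReal_ne_zero.mpr Real.pi_pos.ne'
  have h : m = k := mul_left_cancel₀ hpi (by rw [hk, mul_comm])
  rw [h, Complex.intCast_re] at hm
  have hk0 : k = 0 := by
    have : |k| < 1 := by exact_mod_cast hm
    exact Int.abs_lt_one_iff.mp this
  exact hm0 (by rw [h, hk0, Int.cast_zero])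

theorem two_cpow_half : (2 : ℂ) ^ (1 / 2 : ℂ) = 2 * 2 ^ (-(1 / 2) : ℂ) := by
  rw [show (1 / 2 : ℂ) = 1 + -(1 / 2) by norm_num, Complex.cpow_add _ _ two_ne_zero,
    Complex.cpow_one]
  norm_num

/-- The pair `(a, b)` consists of homogeneous coordinates of the boundary condition: `(1, κ)` for
finite `κ` and `(0, 1)` for `κ = ∞`. By the reflection formula `π / sin πm = Γ(m) Γ(1-m)`, the terms
with `(-z)^m` cancel, and for finite parameters both the required identity and the relation reduce
to `λ κ m Γ(m)² = -1`. -/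
theorem coeff_identity {m : ℂ} (hm : |m.re| < 1) (hm0 : m ≠ 0) {lam kap : OnePoint ℂ}
    (h : Related m lam kap) : ∃ a b : ℂ, (a ≠ 0 ∨ b ≠ 0) ∧
      (bdryFun m kap = fun x : ℝ => a * (x : ℂ) ^ (1 / 2 + -m) + b * (x : ℂ) ^ (1 / 2 + m)) ∧
      ∀ z ∈ regularSet m lam, a * (2 ^ (1 / 2 : ℂ) * (2 * m) / Complex.Gamma (m + 1) / 4) +
        resolventCoeff m lam z * (a * (2 ^ (-(1 / 2) : ℂ) * ((-z) ^ m * Complex.Gamma (1 - m))) +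
          b * (2 ^ (-(1 / 2) : ℂ) * Complex.Gamma (m + 1))) = 0 := by
  have hs := sin_pi_mul_ne_zero hm hm0
  have hpi : (Real.pi : ℂ) ≠ 0 := Complex.ofReal_ne_zero.mpr Real.pi_pos.ne'
  have hr := Complex.Gamma_mul_Gamma_one_sub m
  have h1 : Complex.Gamma (m + 1) = m * Complex.Gamma m := Complex.Gamma_add_one m hm0
  have h2 : Complex.Gamma (1 - m) = -m * Complex.Gamma (-m) := by
    rw [← Complex.Gamma_add_one (-m) (neg_ne_zero.mpr hm0)]
    congr 1
    ring
  have hprod : Complex.Gamma m * Complex.Gamma (1 - m) ≠ 0 := by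
    rw [hr]
    exact div_ne_zero hpi hs
  have hG1 := left_ne_zero_of_mul hprod
  have hG2 := right_ne_zero_of_mul hprod
  have hG3 : Complex.Gamma (-m) ≠ 0 := by
    rw [h2] at hG2
    exact right_ne_zero_of_mul hG2
  have hfree : ∀ z, freeG m z = (-z) ^ m * (Complex.Gamma m * Complex.Gamma (1 - m)) := fun z => by
    rw [freeG, hr]
  have key : ∀ k : ℂ, bdryFun m (k : OnePoint ℂ) =
      fun x : ℝ => 1 * (x : ℂ) ^ (1 / 2 + -m) + k * (x : ℂ) ^ (1 / 2 + m) := fun k => by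
    funext x
    rw [one_mul, ← sub_eq_add_neg]
    rfl
  cases lam with
  | infty =>
    have hk : kap = ((0 : ℂ) : OnePoint ℂ) := h
    refine ⟨1, 0, Or.inl one_ne_zero, by rw [hk, key], fun z hz => ?_⟩
    have hz0 : (-z) ^ m ≠ 0 := by
      have hz' : -z ∈ Complex.slitPlane := hz
      rw [Complex.cpow_ne_zero_iff_of_exponent_ne_zero hm0]
      exact Complex.slitPlane_ne_zero hz'
    rw [show resolventCoeff m OnePoint.infty z = (-freeG m z)⁻¹ from rfl, hfree, h1, two_cpow_half]
    field_simp
    ring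
  | coe l =>
    cases kap with
    | infty =>
      have hl : l = 0 := h
      refine ⟨0, 1, Or.inr one_ne_zero, ?_, fun z _ => ?_⟩
      · funext x
        rw [zero_mul, zero_add, one_mul]
        rfl
      · rw [show resolventCoeff m (l : OnePoint ℂ) z = l / (1 - l * freeG m z) from rfl, hl]
        ring
    | coe k =>
      have hlk : l * (Real.pi / Complex.sin (Real.pi * m)) *
        (k * (Complex.Gamma m / Complex.Gamma (-m))) = 1 := h
      refine ⟨1, k, Or.inl one_ne_zero, key k, fun z hz => ?_⟩
      have hd : 1 - l * freeG m z ≠ 0 := hz.2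
      have hlk' : l * k * m * Complex.Gamma m ^ 2 = -1 := by
        rw [← hr, h2] at hlk
        field_simp at hlk
        linear_combination -hlk
      rw [show resolventCoeff m (l : OnePoint ℂ) z = l / (1 - l * freeG m z) from rfl, h1,
        two_cpow_half]
      have hfz := hfree z
      field_simp
      linear_combination (4 * (2 : ℂ) ^ (-(1 / 2) : ℂ)) * (hlk' - l * hfz)

/-- For finite parameters the identity says that `ρ + ln(-z)` equals twice `γ + ln(-z)/2 - ν`. The
logarithms cancel and the relation `ρ = 2γ - 2ν` remains. -/
theorem coeff_identity_log {rho nu : OnePoint ℂ} (h : RelatedLog rho nu) :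
    ∃ a b : ℂ, (a ≠ 0 ∨ b ≠ 0) ∧
      (bdryFunLog nu = fun x : ℝ => a * logSol x + b * (x : ℂ) ^ (1 / 2 + 0 : ℂ)) ∧
      ∀ z ∈ regularSetLog rho, a * (2 ^ (1 / 2 : ℂ) * -1 / Complex.Gamma (0 + 1) / 4) +
        resolventCoeffLog rho z *
          (a * -(2 ^ (-(1 / 2) : ℂ) * (Real.eulerMascheroniConstant + 1 / 2 * Complex.log (-z))) +
            b * (2 ^ (-(1 / 2) : ℂ) * Complex.Gamma (0 + 1))) = 0 := by
  cases rho with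
  | infty =>
    have hn : nu = OnePoint.infty := h
    refine ⟨0, 1, Or.inr one_ne_zero, ?_, fun z _ => ?_⟩
    · funext x
      rw [hn, zero_mul, zero_add, one_mul, add_zero]
      rfl
    · rw [show resolventCoeffLog OnePoint.infty z = 0 from rfl]
      ring
  | coe r =>
    cases nu with
    | infty => exact absurd h id
    | coe n =>
      have hr : r = 2 * Real.eulerMascheroniConstant - 2 * n := h
      refine ⟨1, n, Or.inl one_ne_zero, ?_, fun z hz => ?_⟩
      · funext x
        rw [one_mul, add_zero]
        rfl
      · have hd : r + Complex.log (-z) ≠ 0 := hz.2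
        rw [show resolventCoeffLog (r : OnePoint ℂ) z = -(r + Complex.log (-z))⁻¹ from rfl,
          zero_add, Complex.Gamma_one, two_cpow_half]
        field_simp
        rw [hr]
        ring

theorem conjugate_Hpert {m : ℂ} (hm : |m.re| < 1) (hm0 : m ≠ 0) {lam kap : OnePoint ℂ}
    (h : Related m lam kap) :
    HasResolvents (regularSet m lam) (pertResolvent m hm lam) (Hpert m hm lam) ∧
      conjugate (opWEquiv m (neg_one_lt_re hm)) (Hpert m hm lam) = (1 / 4 : ℂ) • Hschr m kap := by
  obtain ⟨a, b, hab, hu, hc⟩ := coeff_identity hm hm0 h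
  obtain ⟨hm1, hm2⟩ := neg_re_bounds hm
  have hsq : (-m) ^ 2 = m ^ 2 := neg_sq m
  have hsol := isSolution_cpow hm2
  have hpair : gaussPair (-m) 1 = cutPair ((-m) ^ 2) (gaussCut 1) fun x => (x : ℂ) ^ (1 / 2 + -m) :=
    rfl
  rw [hsq] at hsol hpair
  rw [Hschr, hu]
  -- The choice `δ = 1 - |Re m|` gives a common exponent for the bounds of `x^{1/2-m}` and
  -- `x^{1/2+m}`, so that their linear combinations are again admissible solutions.
  refine conjugate_ofResolvents_rankOne hm hsol (δ := 1 - |m.re|) (by linarith)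
    (by linarith [neg_abs_le m.re])
    (solutionBound_cpow (by rw [Complex.neg_re]; linarith [le_abs_self m.re]))
    (mul_ne_zero two_ne_zero hm0) (hpair ▸ bdryForm_second hm) hab
    (fun z hz => neg_mem_of_mem_regularSet hz) (regularSet_nonempty hm0 lam)
    (fun z => resolventCoeff m lam z) fun z => ?_
  rw [← hpair, profileValue_second]
  exact hc z z.2

theorem conjugate_HpertLog {rho nu : OnePoint ℂ} (h : RelatedLog rho nu) :
    HasResolvents (regularSetLog rho) (pertResolventLog rho) (HpertLog rho) ∧
      conjugate (opWEquiv 0 (by simp)) (HpertLog rho) = (1 / 4 : ℂ) • HschrLog nu := by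
  obtain ⟨a, b, hab, hu, hc⟩ := coeff_identity_log h
  have key := conjugate_ofResolvents_rankOne (m := 0) (by simp) isSolution_logSol' (δ := 1 / 2)
    (by norm_num) (by norm_num) solutionBound_logSol (neg_ne_zero.mpr one_ne_zero) bdryForm_log hab
    (fun z hz => neg_mem_of_mem_regularSetLog hz) (regularSetLog_nonempty rho)
    (fun z => resolventCoeffLog rho z) (fun z => by
      rw [← logPair, profileValue_log]
      exact hc z z.2)
  rw [HschrLog, hu]
  rw [zero_pow two_ne_zero] at key
  exact key

end RankOneBessel

end

theorem mainTheorem12 :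
    (∀ (m : ℂ) (hm : |m.re| < 1), m ≠ 0 →
      ∃ F : L2 ≃L[ℂ] L2, IsHankel m (F : L2 →L[ℂ] L2) ∧
        ∀ lam kap : OnePoint ℂ, Related m lam kap →
          HasResolvents (regularSet m lam) (pertResolvent m hm lam) (Hpert m hm lam) ∧
          conjugate (F.trans unitaryI.toContinuousLinearEquiv) (Hpert m hm lam) =
            (1 / 4 : ℂ) • Hschr m kap) ∧
    (∃ F : L2 ≃L[ℂ] L2, IsHankel 0 (F : L2 →L[ℂ] L2) ∧
        ∀ rho nu : OnePoint ℂ, RelatedLog rho nu →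
          HasResolvents (regularSetLog rho) (pertResolventLog rho) (HpertLog rho) ∧
          conjugate (F.trans unitaryI.toContinuousLinearEquiv) (HpertLog rho) =
            (1 / 4 : ℂ) • HschrLog nu) := by
  refine ⟨fun m hm hm0 => ⟨hankelEquiv m (neg_one_lt_re hm),
    hankelCLM_isHankel (neg_one_lt_re hm), fun lam kap h => conjugate_Hpert hm hm0 h⟩,
    hankelEquiv 0 (by simp), hankelCLM_isHankel (by simp), fun rho nu h => conjugate_HpertLog h⟩
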